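/- Let $k$ be a perfect field of characteristic $\neq 3$, let $K = k(x)$ be a rational function field, and let $K' = K(r)$ be a separable quadratic extension of $K$ of genus zero (possibly a constant extension), where $r$ has minimal polynomial $X^2 - aX - b$ over $K$. Let $\sigma$ generate $\mathrm{Gal}(K'/K)$, and let $S$ be the set of places of $K$ that ramify in $K'$. Degrees of places and divisors are taken over $k$. Let $T$ be a non-empty finite set of places of $K$ that split in $K'$, and for every $\mathfrak p \in T$ fix one of the two places $\mathfrak P_{\mathfrak p}^-$ of $K'$ over $\mathfrak p$, so that $\mathfrak p = \mathfrak P_{\mathfrak p}^- + \mathfrak P_{\mathfrak p}^+$ with $\mathfrak P_{\mathfrak p}^+ = \sigma(\mathfrak P_{\mathfrak p}^-)$. Write $\deg T = \sum_{\mathfrak p \in T} \deg \mathfrak p$. A cubic extension of $K$ is a separable extension of degree three that is not of the form $K\ell$ with $\ell/k$ of degree three. Its purely cubic closure is the smallest extension $M/K$ such that $LM/M$ is generated by an element with minimal polynomial $X^3 - \beta$ over $M$. Two cubic extensions $L_1, L_2$ of $K$ are twists of each other if $L_1 \overline k$ and $L_2 \overline k$ are isomorphic over $K \overline k$. We say that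 a cubic extension $L/K$ corresponds to the given data if its purely cubic closure is $K'$, it is totally ramified exactly at the places in $T$ and partially ramified (with an index two place) exactly over the places in $S$, and $LK' = K'(w)$ with $w^3 = g \in K'^*$ and $\mathrm{div}(g) \equiv \sum_{\mathfrak p \in T} (\mathfrak P_{\mathfrak p}^+ - \mathfrak P_{\mathfrak p}^-) \pmod 3$. Let $N_1$ be the group of constants $u \in K'^*$ (elements algebraic over $k$) with $u\,\sigma(u) = 1$. Call the case where $\deg T$ is odd and $S$ consists of a single place of degree two the exceptional case. Consider the following divisors $D$ of $K'$, where $\eta$ denotes the pullback to $K'$ of a degree-one place of $K$: * if $\deg T = 2e$ is even: $D = \sum_{\mathfrak p \in T} \mathfrak P_{\mathfrak p}^- - e \eta$; * if $\deg T$ is odd and $\mathfrak Q$ is a place of $K'$ over a degree-one place in $S$: $D = \sum_{\mathfrak p \in T} \mathfrak P_{\mathfrak p}^- - \deg(T)\, \mathfrak Q$; * in the exceptional case, if $\mathfrak p_1 \in T$ and $\deg T - 3 \deg \mathfrak p_1 = 2e$ with $e \in \mathbb Z$: $D = -3 \mathfrak P_{\mathfrak p_1}^- + \sum_{\mathfrak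 p \in T} \mathfrak P_{\mathfrak p}^- - e \eta$. **Theorem.** There is always such a divisor $D$. For each such $D$ the Riemann–Roch space $\mathcal L(-D) = \{z \in K' : z = 0 \text{ or } \mathrm{div}(z) \geq D\}$ is one-dimensional over the field of constants of $K'$, and for each non-zero $\vartheta \in \mathcal L(-D)$, written as $\vartheta = P + Qr$ with $P, Q \in K$, the following holds with $f = \sigma(\vartheta)/\vartheta$ and $$\alpha = f + f^{-1} = \frac{2(P^2 + aPQ) + (a^2 + 2b) Q^2}{P^2 + aPQ - bQ^2} \in K.$$ 1. The polynomial $x^3 - 3x - \alpha$ is irreducible over $K$, and the extension $L/K$ that it defines corresponds to the given data. 2. The poles of $\alpha$ are exactly the places in $T$. Outside the exceptional case $v_{\mathfrak p}(\alpha) \geq -1$ for all $\mathfrak p \in T$. In the exceptional case there is one place $\mathfrak p \in T$ with $v_{\mathfrak p}(\alpha) = -2$, and $v_{\mathfrak p'}(\alpha) \geq -1$ for all other $\mathfrak p' \in T$. 3. For every $u \in N_1$ the polynomial $x^3 - 3x - (uf + (uf)^{-1})$ has coefficients in $K$ and is irreducible over $K$; let $L_u$ be the extension that it defines. The twists of $L/K$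 are, up to isomorphism, exactly the $L_u$ with $u \in N_1$; these are also, up to isomorphism, exactly the extensions that correspond to the given data; and $L_u$ and $L_{u'}$ are isomorphic over $K$ if and only if $u$ and $u'$ have the same class in $N_1/N_1^3$. -/

import Mathlib

open scoped Polynomial TensorProduct WithZero

namespace CubicFunctionField

section Places

/-- A place of a function field `F` over `k`, given by its normalized discrete valuation: a
surjective valuation `F → ℤ ∪ {∞}` that is trivial on `k`. The value group is written
multiplicatively, so `v z = exp (-ord z)`. -/
structure Place (k F : Type*) [Field k] [Field F] [Algebra k F] where
  /-- the normalized valuation -/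
  v : Valuation F ℤᵐ⁰
  surjective : Function.Surjective v
  trivial : ∀ c : k, c ≠ 0 → v (algebraMap k F c) = 1

variable {k F : Type*} [Field k] [Field F] [Algebra k F]

/-- The order `v_P(z)` of `z` at the place `P` (with the convention that the order of `0` is `0`;
no statement uses it at `z = 0` except to say that `0` has no pole). -/
noncomputable def Place.ord (P : Place k F) (z : F) : ℤ := -WithZero.log (P.v z)

theorem Place.v_algebraMap_le_one (P : Place k F) (c : k) : P.v (algebraMap k F c) ≤ 1 := by
  by_cases hc : c = 0
  · simp [hc]
  · exact (P.trivial c hc).le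

/-- The valuation ring of a place. -/
abbrev Place.ring (P : Place k F) : ValuationSubring F := P.v.valuationSubring

noncomputable instance Place.algebraRing (P : Place k F) : Algebra k P.ring :=
  ((algebraMap k F).codRestrict P.ring
    fun c => (Valuation.mem_valuationSubring_iff _ _).2 (P.v_algebraMap_le_one c)).toAlgebra

/-- The degree over `k` of a place: the degree over `k` of its residue field. -/
noncomputable def Place.degree (P : Place k F) : ℕ :=
  Module.finrank k (IsLocalRing.ResidueField P.ring)

variable (k F) in
/-- Divisors of `F`. -/
abbrev Divisor : Type _ := Place k F →₀ ℤ

/-- The degree over `k` of a divisor. -/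
noncomputable def Divisor.degree (D : Divisor k F) : ℤ := D.sum fun P n => n * (P.degree : ℤ)

/-- The Riemann–Roch space `𝓛(D) = {z | z = 0 or v_P(z) ≥ -D(P) for all P}`. -/
def riemannRochSpace (D : Divisor k F) : Submodule k F where
  carrier := {z | ∀ P : Place k F, P.v z ≤ WithZero.exp (D P)}
  zero_mem' := by intro P; simp
  add_mem' := by
    intro x y hx hy P
    exact (P.v.map_add x y).trans (max_le (hx P) (hy P))
  smul_mem' := by
    intro c x hx P
    rw [Algebra.smul_def, map_mul]
    exact (mul_le_of_le_one_left' (P.v_algebraMap_le_one c)).trans (hx P)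

variable (k F) in
/-- `F`, a function field with full field of constants `k`, has genus `g`:
`g` is the maximum of `deg D - ℓ(D) + 1` over all divisors `D`. -/
def HasGenus (g : ℤ) : Prop :=
  IsGreatest (Set.range fun D : Divisor k F =>
    D.degree - (Module.finrank k (riemannRochSpace D) : ℤ) + 1) g

end Places

section Extensions

variable {k K F : Type*} [Field k] [Field K] [Field F] [Algebra k K] [Algebra k F] [Algebra K F]

/-- The place `𝔓` of `F` lies over the place `𝔭` of `K` with ramification index `e`. -/
def HasRamificationIndex (𝔓 : Place k F) (𝔭 : Place k K) (e : ℕ) : Prop :=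
  0 < e ∧ ∀ z : K, 𝔓.v (algebraMap K F z) = 𝔭.v z ^ e

/-- The place `𝔓` of `F` lies over the place `𝔭` of `K`. -/
def LiesOver (𝔓 : Place k F) (𝔭 : Place k K) : Prop := ∃ e, HasRamificationIndex 𝔓 𝔭 e

/-- The divisor `η` of `F` is the pullback of the place `𝔬` of `K`:
`η = ∑_{𝔓 ∣ 𝔬} e(𝔓 ∣ 𝔬) 𝔓`. -/
def IsPullback (η : Divisor k F) (𝔬 : Place k K) : Prop :=
  (∀ 𝔓 e, HasRamificationIndex 𝔓 𝔬 e → η 𝔓 = e) ∧ ∀ 𝔓, ¬ LiesOver 𝔓 𝔬 → η 𝔓 = 0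

variable (k K F) in
/-- The set of places of `K` over which there is a place of `F` with ramification index `e`. -/
def placesWithIndex (e : ℕ) : Set (Place k K) :=
  {𝔭 | ∃ 𝔓 : Place k F, HasRamificationIndex 𝔓 𝔭 e}

/-- The conjugate `σ(𝔓)` of a place `𝔓` of `F` under `σ`, an automorphism of `F` over `K`:
`v_{σ(𝔓)}(z) = v_𝔓(σ⁻¹(z))`. -/
def Place.conj [IsScalarTower k K F] (σ : F ≃ₐ[K] F) (𝔓 : Place k F) : Place k F where
  v := 𝔓.v.comap (σ.symm : F →+* F)
  surjective := by
    intro y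
    obtain ⟨x, hx⟩ := 𝔓.surjective y
    exact ⟨σ x, by simpa using hx⟩
  trivial := by
    intro c hc
    rw [IsScalarTower.algebraMap_apply k K F, Valuation.comap_apply]
    have h : (σ.symm : F →+* F) (algebraMap K F (algebraMap k K c))
        = algebraMap K F (algebraMap k K c) := σ.symm.commutes _
    rw [h, ← IsScalarTower.algebraMap_apply k K F]
    exact 𝔓.trivial c hc

end Extensions

section Cubic

universe u v w

/-- `E / F` is a field extension with a generator whose minimal polynomial is `X³ - β`. -/
def IsPurelyCubic (F E : Type*) [Field F] [CommRing E] [Algebra F E] : Prop :=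
  IsField E ∧ ∃ y : E, Algebra.adjoin F {y} = ⊤ ∧
    ∃ β : F, minpoly F y = Polynomial.X ^ 3 - Polynomial.C β

/-- `L / K` is a cubic extension of function fields over `k`: separable, of degree three, and
geometric, that is, not of the form `K ℓ` with `ℓ` an extension of `k` of degree three. -/
structure IsCubicExtension (k K L : Type*) [Field k] [Field K] [Field L]
    [Algebra k L] [Algebra K L] : Prop where
  degree : Module.finrank K L = 3
  separable : Algebra.IsSeparable K L
  geometric : ¬ ∃ ℓ : IntermediateField k L,
    Module.finrank k ℓ = 3 ∧ IntermediateField.adjoin K (ℓ : Set L) = ⊤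

/-- `K'` is the purely cubic closure of the cubic extension `L / K`, the smallest extension `M` of
`K` such that `L M / M` is purely cubic. If `L M / M` has degree three, the compositum `L M`
is the tensor product `M ⊗ L` over `K`. -/
def IsPurelyCubicClosure (K : Type v) (K' L : Type*) [Field K] [Field K'] [Field L]
    [Algebra K K'] [Algebra K L] : Prop :=
  IsPurelyCubic K' (K' ⊗[K] L) ∧
    ∀ (M : Type v) [Field M] [Algebra K M], IsPurelyCubic M (M ⊗[K] L) → Nonempty (K' →ₐ[K] M)

/-- The cubic extensions `L₁ / K` and `L₂ / K` are twists of each other: they become isomorphic over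
`K k̄`. Here `K k̄ = K ⊗ k̄` (over `k`) and `Lᵢ k̄ = (K k̄) ⊗ Lᵢ` (over `K`), since `k` is
algebraically closed in `K` and in `Lᵢ`. -/
def IsTwist (k K L₁ L₂ : Type*) [Field k] [Field K] [Field L₁] [Field L₂] [Algebra k K]
    [Algebra K L₁] [Algebra K L₂] : Prop :=
  Nonempty (((K ⊗[k] AlgebraicClosure k) ⊗[K] L₁) ≃ₐ[K ⊗[k] AlgebraicClosure k]
    ((K ⊗[k] AlgebraicClosure k) ⊗[K] L₂))

/-- The polynomial `X³ - 3 X - α`. -/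
noncomputable def cubicPoly {K : Type*} [Field K] (α : K) : K[X] :=
  Polynomial.X ^ 3 - 3 * Polynomial.X - Polynomial.C α

/-- `x³ - 3 x - α` is a defining equation for `L / K`. -/
def IsDefinedBy {K : Type*} (L : Type*) [Field K] [Field L] [Algebra K L] (α : K) : Prop :=
  ∃ y : L, IntermediateField.adjoin K {y} = ⊤ ∧ minpoly K y = cubicPoly α

variable {k : Type u} {K : Type v} {K' : Type w} [Field k] [Field K] [Field K']
  [Algebra k K] [Algebra k K'] [Algebra K K'] [IsScalarTower k K K']

/-- The total degree of a finite set of places. -/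
noncomputable def totalDegree (T : Finset (Place k K)) : ℕ := ∑ 𝔭 ∈ T, 𝔭.degree

/-- The divisor `∑ (𝔓⁺ - 𝔓⁻)` over the `𝔭 ∈ T`, where `𝔓⁻ = 𝔓 𝔭` is the chosen place over `𝔭` and
`𝔓⁺ = σ(𝔓⁻)`. -/
noncomputable def signDivisor (σ : K' ≃ₐ[K] K') (T : Finset (Place k K))
    (𝔓 : Place k K → Place k K') : Divisor k K' :=
  ∑ 𝔭 ∈ T, (Finsupp.single ((𝔓 𝔭).conj σ) 1 - Finsupp.single (𝔓 𝔭) 1)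

/-- `L / K` is a cubic extension that corresponds to the purely cubic closure `K'`, the total
ramification locus `T` and the sign choices `𝔭 = 𝔓⁻ + 𝔓⁺`, `𝔓⁻ = 𝔓 𝔭`: the purely cubic closure
of `L / K` is `K'`; the places that are totally ramified in `L` are those in `T`; the places that
are partially ramified in `L` are those that ramify in `K'`; and `L K' = K'(w)` with `w³ = g` for a
function `g` whose divisor is `∑ (𝔓⁺ - 𝔓⁻)` modulo `3`. (As `w⁻¹` also generates `L K'`, a global
change of sign is immaterial.) -/
structure Corresponds (σ : K' ≃ₐ[K] K') (T : Finset (Place k K))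
    (𝔓 : Place k K → Place k K') (L : Type*) [Field L] [Algebra k L] [Algebra K L] : Prop where
  cubic : IsCubicExtension k K L
  closure : IsPurelyCubicClosure K K' L
  total : placesWithIndex k K L 3 = (T : Set (Place k K))
  partially : placesWithIndex k K L 2 = placesWithIndex k K K' 2
  signs : ∃ (w : K' ⊗[K] L) (g : K'), g ≠ 0 ∧ Algebra.adjoin K' {w} = ⊤ ∧
    w ^ 3 = algebraMap K' (K' ⊗[K] L) g ∧
    ∀ 𝔔 : Place k K', 𝔔.ord g ≡ signDivisor σ T 𝔓 𝔔 [ZMOD 3]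

variable (K') in
/-- The exceptional case: `deg T` is odd, and the set `S` of places of `K` that ramify in `K'`
consists of a single place of degree two. -/
def IsExceptional (T : Finset (Place k K)) : Prop :=
  Odd (totalDegree T) ∧ ∃ 𝔮 : Place k K, placesWithIndex k K K' 2 = {𝔮} ∧ 𝔮.degree = 2

/-- The explicit divisors that `ϑ` is allowed to have, in terms of `T` and the chosen places
`𝔓⁻ = 𝔓 𝔭` over the `𝔭 ∈ T`. -/
inductive IsThetaDivisor (T : Finset (Place k K)) (𝔓 : Place k K → Place k K') :
    Divisor k K' → Prop
  /-- `deg T = 2 e`, and `η` is the pullback of a place of `K` of degree one. -/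
  | even (e : ℤ) (he : (totalDegree T : ℤ) = 2 * e)
      (𝔬 : Place k K) (h𝔬 : 𝔬.degree = 1) (η : Divisor k K') (hη : IsPullback η 𝔬) :
      IsThetaDivisor T 𝔓 (∑ 𝔭 ∈ T, Finsupp.single (𝔓 𝔭) 1 - e • η)
  /-- `deg T` is odd, and `𝔔` lies over a place of degree one that ramifies in `K'`. -/
  | odd (hodd : Odd (totalDegree T)) (𝔮 : Place k K) (h𝔮 : 𝔮.degree = 1)
      (𝔔 : Place k K') (h𝔔 : HasRamificationIndex 𝔔 𝔮 2) :
      IsThetaDivisor T 𝔓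
        (∑ 𝔭 ∈ T, Finsupp.single (𝔓 𝔭) 1 - (totalDegree T : ℤ) • Finsupp.single 𝔔 1)
  /-- The exceptional case: `𝔭₁ ∈ T` has odd degree, and `deg T - 3 deg 𝔭₁ = 2 e`. -/
  | exceptional (hexc : IsExceptional K' T) (𝔭₁ : Place k K) (h𝔭₁ : 𝔭₁ ∈ T) (e : ℤ)
      (he : (totalDegree T : ℤ) - 3 * (𝔭₁.degree : ℤ) = 2 * e)
      (𝔬 : Place k K) (h𝔬 : 𝔬.degree = 1) (η : Divisor k K') (hη : IsPullback η 𝔬) :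
      IsThetaDivisor T 𝔓
        ((-3 : ℤ) • Finsupp.single (𝔓 𝔭₁) 1 + ∑ 𝔭 ∈ T, Finsupp.single (𝔓 𝔭) 1 - e • η)

variable (k) in
/-- The group `N₁` of constants `u` of `K'` with `u σ(u) = 1`. -/
def normOne (σ : K' ≃ₐ[K] K') : Set K' := {u | u ∈ algebraicClosure k K' ∧ u * σ u = 1}

end Cubic

end CubicFunctionField

open CubicFunctionField
universe u v w

/-!
Throughout, `F` is the quadratic extension `K'` of `K = k(x)`, and `M` is a cubic extension of `K`.

*The function `ϑ`.* Principal divisors have degree zero, for `k(x)` by inspection of the irreducible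
polynomials and for `F` by taking norms. In genus zero, conversely, the Riemann inequality makes
every divisor of degree zero principal (`exists_isDivisorOf_of_degree_eq_zero`). As a divisor `D` of
the required form has degree zero, `𝓛(-D)` consists of the constant multiples of a function `ϑ` with
divisor `D` (`finrank_riemannRochSpace_neg`). Such a `D` exists (`exists_isThetaDivisor`) because
`F`, if it has no new constants, is the function field of a conic: it is given by a quadratic
equation whose trace and norm are polynomials in `x` of degree at most one and two, and its
ramification can be read off (`exists_ramified`).

*The extension.* The quotient `f = σ(ϑ) / ϑ` has norm one, and its divisor `σ(D) - D` is the sign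
divisor modulo three and has support over `T`. These properties (`IsKummerGenerator`) are all that
matters from here on, and they are shared by `u f` for `u ∈ N₁`. Let `M` be defined by `X³ - 3 X -
(f + f⁻¹)`. The compositum `N = F M` contains a cube root `w` of `f` such that `w + w⁻¹` is a root
in `M`, and the conjugation `τ` of `N / M` inverts `w`. Irreducibility and total ramification over
`T` follow from the order of `f + f⁻¹`, which is prime to three there. Outside `T` the extension `N
/ F` is unramified, and comparing the indices of `N / F / K` and `N / M / K` shows that the places
with index two in `M` are those that ramify in `F` (`index_of_notMem`, `exists_index_two`). If `M`
becomes purely cubic over `E`, then `E` contains a root of `X² - (f + f⁻¹) X + 1`, hence `F`. This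
gives `IsKummerGenerator.corresponds`.

*Classification.* Let `F M` be generated by a cube root `w` of some `g` with the given signs. Then
`τ(w) / w` is a cube root of `σ(g) / g`, whose divisor is `-2 ≡ 1` times the sign divisor modulo
three. So `σ(g) / g` is `f` times a function of norm one with divisor divisible by three, and in
genus zero the latter is an element of `N₁` times the cube of an element of norm one
(`exists_normOne_mul_cube`). Therefore `M` is defined by some `u f` with `u ∈ N₁`
(`exists_normOne_isDefinedBy`). Comparing coordinates with respect to the powers of a cube root, the
extensions defined by two Kummer generators are isomorphic exactly if these differ by the cube of an
element of norm one (`IsKummerGenerator.nonempty_algEquiv_iff`).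

*Twists.* If `M` is a twist of the extension defined by `f`, then `F M` lies in `F k̄ (w)` inside a
separable closure of `F`. By Galois descent it contains a multiple of `w` by an element of `F k̄`;
the cube of this multiple lies in `F`, and its orders are those of `f` modulo three, since constant
extensions are unramified (`exists_cube_root_of_le`). So the classification applies. Conversely, an
element of `N₁` becomes a cube over `k̄` (`isTwist_of_normOne`).

Ramification indices are bounded by one criterion, `HasRamificationIndex.eq_one_of_separable`: a
place is unramified if `F = K(y)` and `y` is a simple root of the reduction of its equation. It
covers square and cube roots of units as well as constant extensions.
-/

set_option linter.unusedSectionVars false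

namespace CubicFunctionField

/-! ### Places and their orders -/

section Orders

variable {k F : Type*} [Field k] [Field F] [Algebra k F] (P : Place k F)

theorem Place.ext' {P Q : Place k F} (h : ∀ z, P.v z = Q.v z) : P = Q := by
  cases P; cases Q
  congr 1
  exact Valuation.ext h

theorem Place.v_eq_exp {z : F} (hz : z ≠ 0) : P.v z = WithZero.exp (-P.ord z) := by
  rw [Place.ord, neg_neg, WithZero.exp_log ((Valuation.ne_zero_iff P.v).2 hz)]

theorem Place.v_le_exp_iff {z : F} (hz : z ≠ 0) (n : ℤ) :
    P.v z ≤ WithZero.exp n ↔ -n ≤ P.ord z := by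
  rw [P.v_eq_exp hz, WithZero.exp_le_exp]; omega

theorem Place.v_le_one_iff {z : F} (hz : z ≠ 0) : P.v z ≤ 1 ↔ 0 ≤ P.ord z := by
  rw [← WithZero.exp_zero, P.v_le_exp_iff hz]; simp

theorem Place.v_lt_one_iff {z : F} (hz : z ≠ 0) : P.v z < 1 ↔ 0 < P.ord z := by
  rw [P.v_eq_exp hz, ← WithZero.exp_zero, WithZero.exp_lt_exp]; omega

theorem Place.v_eq_one_iff {z : F} (hz : z ≠ 0) : P.v z = 1 ↔ P.ord z = 0 := by
  rw [P.v_eq_exp hz, ← WithZero.exp_zero, WithZero.exp_inj]; omega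

theorem Place.ord_eq_of_v {z : F} {n : ℤ} (h : P.v z = WithZero.exp n) : P.ord z = -n := by
  simp [Place.ord, h]

@[simp] theorem Place.ord_zero : P.ord 0 = 0 := by simp [Place.ord]

@[simp] theorem Place.ord_one : P.ord 1 = 0 := by simp [Place.ord]

theorem Place.ord_mul {y z : F} (hy : y ≠ 0) (hz : z ≠ 0) :
    P.ord (y * z) = P.ord y + P.ord z := by
  simp only [Place.ord, map_mul]
  rw [WithZero.log_mul ((Valuation.ne_zero_iff _).2 hy) ((Valuation.ne_zero_iff _).2 hz)]
  ring

@[simp] theorem Place.ord_inv (z : F) : P.ord z⁻¹ = -P.ord z := by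
  simp [Place.ord, WithZero.log_inv]

theorem Place.ord_div {y z : F} (hy : y ≠ 0) (hz : z ≠ 0) :
    P.ord (y / z) = P.ord y - P.ord z := by
  rw [div_eq_mul_inv, P.ord_mul hy (inv_ne_zero hz), P.ord_inv]; ring

@[simp] theorem Place.ord_pow (z : F) (n : ℕ) : P.ord (z ^ n) = n * P.ord z := by
  simp [Place.ord, WithZero.log_pow]

theorem Place.ord_const {c : k} (hc : c ≠ 0) : P.ord (algebraMap k F c) = 0 := by
  simp [Place.ord, P.trivial c hc]

theorem Place.exists_uniformizer : ∃ z : F, z ≠ 0 ∧ P.ord z = 1 := by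
  obtain ⟨z, hz⟩ := P.surjective (WithZero.exp (-1 : ℤ))
  refine ⟨z, ?_, ?_⟩
  · rintro rfl; rw [map_zero] at hz; exact WithZero.exp_ne_zero hz.symm
  · rw [P.ord_eq_of_v hz]; rfl

theorem Place.v_add_lt_one {y z : F} (hy : P.v y < 1) (hz : P.v z < 1) : P.v (y + z) < 1 :=
  (P.v.map_add y z).trans_lt (max_lt hy hz)

theorem Place.v_mul_le_one {y z : F} (hy : P.v y ≤ 1) (hz : P.v z ≤ 1) : P.v (y * z) ≤ 1 := by
  rw [map_mul]; exact mul_le_one' hy hz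

theorem Place.v_add_le_one {y z : F} (hy : P.v y ≤ 1) (hz : P.v z ≤ 1) : P.v (y + z) ≤ 1 :=
  (P.v.map_add y z).trans (max_le hy hz)

theorem Place.v_sub_le_one {y z : F} (hy : P.v y ≤ 1) (hz : P.v z ≤ 1) : P.v (y - z) ≤ 1 :=
  (P.v.map_sub y z).trans (max_le hy hz)

theorem Place.v_sub_lt_one {y z : F} (hy : P.v y < 1) (hz : P.v z < 1) : P.v (y - z) < 1 :=
  (P.v.map_sub y z).trans_lt (max_lt hy hz)

/-- The valuation ring of a place is maximal: a place is determined by any place whose valuation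
ring contains its own. -/
theorem Place.eq_of_le {P Q : Place k F} (h : ∀ z, P.v z ≤ 1 → Q.v z ≤ 1) : P = Q := by
  have hunit : ∀ z, P.v z = 1 → Q.v z = 1 := fun z hz => by
    have h0 : z ≠ 0 := by rintro rfl; simp at hz
    refine le_antisymm (h z hz.le) ?_
    have h1 := h z⁻¹ (by rw [map_inv₀, hz, inv_one])
    rw [map_inv₀] at h1
    exact (inv_le_one₀ (zero_lt_iff.2 ((Valuation.ne_zero_iff _).2 h0))).1 h1
  obtain ⟨t, ht0, ht⟩ := P.exists_uniformizer
  -- the orders at `Q` are proportional to those at `P`, and the factor is one, since `Q` is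
  -- surjective
  have key : ∀ z, z ≠ 0 → Q.ord z = P.ord z * Q.ord t := fun z hz => by
    have h1 : P.v (z * t ^ (-P.ord z)) = 1 := by
      rw [map_mul, map_zpow₀, P.v_eq_exp hz, P.v_eq_exp ht0, ht, ← WithZero.exp_zsmul,
        ← WithZero.exp_add]
      simp
    have h2 := hunit _ h1
    rw [map_mul, map_zpow₀, Q.v_eq_exp hz, Q.v_eq_exp ht0, ← WithZero.exp_zsmul,
      ← WithZero.exp_add, ← WithZero.exp_zero, WithZero.exp_inj] at h2
    simp only [smul_eq_mul] at h2
    linarith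
  have hpos : 0 ≤ Q.ord t := by
    rw [← Q.v_le_one_iff ht0]; exact h t ((P.v_le_one_iff ht0).2 (by omega))
  obtain ⟨s, hs0, hs⟩ := Q.exists_uniformizer
  have hone : Q.ord t = 1 := by
    have := key s hs0
    rw [hs] at this
    exact Int.eq_one_or_neg_one_of_mul_eq_one' this.symm |>.elim (·.2) (fun h => by omega)
  refine Place.ext' fun z => ?_
  by_cases hz : z = 0
  · simp [hz]
  · rw [P.v_eq_exp hz, Q.v_eq_exp hz, key z hz, hone, mul_one]

/-- Weak approximation for two places, in the form of an approximate idempotent. -/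
theorem Place.exists_separating {P Q : Place k F} (h : P ≠ Q) :
    ∃ w : F, P.v (w - 1) < 1 ∧ Q.v w < 1 := by
  have h1 : ∃ a, P.v a ≤ 1 ∧ 1 < Q.v a := by
    by_contra! hc; exact h (Place.eq_of_le hc)
  have h2 : ∃ b, Q.v b ≤ 1 ∧ 1 < P.v b := by
    by_contra! hc; exact h (Place.eq_of_le hc).symm
  obtain ⟨a, ha, ha'⟩ := h1
  obtain ⟨b, hb, hb'⟩ := h2
  have ha0 : a ≠ 0 := by rintro rfl; simp at ha'
  have hb0 : b ≠ 0 := by rintro rfl; simp at hb'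
  -- `c = b / a` has a pole at `P` and a zero at `Q`, so that `c / (1 + c)` is near one at `P` and
  -- near zero at `Q`
  have hPc : 1 < P.v (b / a) := by
    rw [map_div₀]
    exact hb'.trans_le (le_div_iff₀ (zero_lt_iff.2 ((Valuation.ne_zero_iff _).2 ha0)) |>.2
      (mul_le_of_le_one_right' ha))
  have hQc : Q.v (b / a) < 1 := by
    rw [map_div₀, div_lt_one₀ (zero_lt_one.trans ha')]
    exact hb.trans_lt ha'
  set c := b / a with hc
  have hP1 : P.v (1 + c) = P.v c :=
    Valuation.map_add_eq_of_lt_right P.v (x := 1) (y := c) (by rwa [map_one])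
  have hQ1 : Q.v (1 + c) = 1 := by
    rw [Valuation.map_add_eq_of_lt_left Q.v (x := 1) (y := c) (by rwa [map_one]), map_one]
  have hne : 1 + c ≠ 0 := by
    intro h0; rw [h0, map_zero] at hQ1; exact zero_ne_one hQ1
  refine ⟨c / (1 + c), ?_, ?_⟩
  · have : c / (1 + c) - 1 = -(1 + c)⁻¹ := by field_simp; ring
    rw [this, Valuation.map_neg, map_inv₀, hP1]
    exact inv_lt_one_of_one_lt₀ hPc
  · rw [map_div₀, hQ1, div_one]; exact hQc

theorem Place.v_eq_one_of_sub {w : F} (h : P.v (w - 1) < 1) : P.v w = 1 := by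
  have := Valuation.map_add_eq_of_lt_left P.v (x := 1) (y := w - 1) (by rwa [map_one])
  rwa [add_sub_cancel, map_one] at this

theorem Place.v_pow_sub_one {w : F} (h : P.v (w - 1) < 1) (n : ℕ) : P.v (w ^ n - 1) < 1 := by
  induction n with
  | zero => simp
  | succ n ih =>
    have : w ^ (n + 1) - 1 = w * (w ^ n - 1) + (w - 1) := by ring
    rw [this]
    refine P.v_add_lt_one ?_ h
    rw [map_mul, P.v_eq_one_of_sub h, one_mul]; exact ih

/-- The powers of an element of the maximal ideal tend to zero. -/
theorem Place.exists_pow_mul_lt {w : F} (h : P.v w < 1) (z : F) (n : ℤ) :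
    ∃ m : ℕ, P.v (z * w ^ m) < WithZero.exp n := by
  by_cases hz : z = 0
  · exact ⟨0, by simp [hz]⟩
  by_cases hw : w = 0
  · exact ⟨1, by simp [hw]⟩
  have h1 := (P.v_lt_one_iff hw).1 h
  refine ⟨(-n - P.ord z).toNat + 1, ?_⟩
  have hne : z * w ^ ((-n - P.ord z).toNat + 1) ≠ 0 := mul_ne_zero hz (pow_ne_zero _ hw)
  rw [P.v_eq_exp hne, WithZero.exp_lt_exp, P.ord_mul hz (pow_ne_zero _ hw), P.ord_pow]
  push_cast
  have h2 := Int.self_le_toNat (-n - P.ord z)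
  have h3 : (0 : ℤ) ≤ ((-n - P.ord z).toNat : ℤ) := by positivity
  nlinarith

/-- Approximation at two places: near `1` at `P`, and `z` times it as small as wanted at `Q`. -/
theorem Place.exists_separating_small {P Q : Place k F} (h : P ≠ Q) (z : F) (n : ℤ) :
    ∃ w : F, P.v (w - 1) < 1 ∧ Q.v (z * w) < WithZero.exp n := by
  obtain ⟨w, hw, hw'⟩ := Place.exists_separating h
  obtain ⟨m, hm⟩ := Q.exists_pow_mul_lt hw' z n
  exact ⟨w ^ m, P.v_pow_sub_one hw m, hm⟩

theorem Place.v_isIntegral_le_one {z : F} (hz : IsIntegral P.ring z) : P.v z ≤ 1 := by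
  obtain ⟨y, hy⟩ := IsIntegrallyClosed.isIntegral_iff.1 hz
  rw [← hy]; exact y.2

end Orders

/-! ### Places in algebraic extensions -/

section Ramification

variable {k K F : Type*} [Field k] [Field K] [Field F] [Algebra k K] [Algebra k F] [Algebra K F]

theorem HasRamificationIndex.ord {𝔓 : Place k F} {𝔭 : Place k K} {e : ℕ}
    (h : HasRamificationIndex 𝔓 𝔭 e) (z : K) : 𝔓.ord (algebraMap K F z) = e * 𝔭.ord z := by
  simp [Place.ord, h.2, WithZero.log_pow]

theorem hasRamificationIndex_of_ord {𝔓 : Place k F} {𝔭 : Place k K} {e : ℕ} (he : 0 < e)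
    (h : ∀ z : K, z ≠ 0 → 𝔓.ord (algebraMap K F z) = e * 𝔭.ord z) :
    HasRamificationIndex 𝔓 𝔭 e := by
  refine ⟨he, fun z => ?_⟩
  by_cases hz : z = 0
  · simp [hz, he.ne']
  · rw [𝔓.v_eq_exp (by simpa using hz), 𝔭.v_eq_exp hz, h z hz, ← WithZero.exp_nsmul]
    congr 1; simp

theorem HasRamificationIndex.v_le_one_iff {𝔓 : Place k F} {𝔭 : Place k K} {e : ℕ}
    (h : HasRamificationIndex 𝔓 𝔭 e) (z : K) : 𝔓.v (algebraMap K F z) ≤ 1 ↔ 𝔭.v z ≤ 1 := by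
  rw [h.2, pow_le_one_iff h.1.ne']

theorem HasRamificationIndex.v_lt_one_iff {𝔓 : Place k F} {𝔭 : Place k K} {e : ℕ}
    (h : HasRamificationIndex 𝔓 𝔭 e) (z : K) : 𝔓.v (algebraMap K F z) < 1 ↔ 𝔭.v z < 1 := by
  rw [h.2, pow_lt_one_iff h.1.ne']

theorem HasRamificationIndex.v_eq_one_iff {𝔓 : Place k F} {𝔭 : Place k K} {e : ℕ}
    (h : HasRamificationIndex 𝔓 𝔭 e) (z : K) : 𝔓.v (algebraMap K F z) = 1 ↔ 𝔭.v z = 1 := by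
  rw [h.2]
  exact ⟨fun h' => (pow_eq_one_iff_of_nonneg zero_le h.1.ne').1 h', fun h' => by rw [h', one_pow]⟩

theorem HasRamificationIndex.place_eq {𝔓 : Place k F} {𝔭 𝔮 : Place k K} {e d : ℕ}
    (h : HasRamificationIndex 𝔓 𝔭 e) (h' : HasRamificationIndex 𝔓 𝔮 d) : 𝔭 = 𝔮 :=
  Place.eq_of_le fun z hz => (h'.v_le_one_iff z).1 ((h.v_le_one_iff z).2 hz)

theorem HasRamificationIndex.index_eq {𝔓 : Place k F} {𝔭 : Place k K} {e d : ℕ}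
    (h : HasRamificationIndex 𝔓 𝔭 e) (h' : HasRamificationIndex 𝔓 𝔭 d) : e = d := by
  obtain ⟨t, -, ht⟩ := 𝔭.exists_uniformizer
  have h1 := h.ord t
  rw [h'.ord t, ht] at h1
  omega

theorem LiesOver.place_eq {𝔓 : Place k F} {𝔭 𝔮 : Place k K}
    (h : LiesOver 𝔓 𝔭) (h' : LiesOver 𝔓 𝔮) : 𝔭 = 𝔮 :=
  h.choose_spec.place_eq h'.choose_spec

theorem HasRamificationIndex.trans {N : Type*} [Field N] [Algebra k N] [Algebra K N] [Algebra F N]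
    [IsScalarTower K F N] {𝔑 : Place k N} {𝔓 : Place k F} {𝔭 : Place k K} {e d : ℕ}
    (h : HasRamificationIndex 𝔑 𝔓 d) (h' : HasRamificationIndex 𝔓 𝔭 e) :
    HasRamificationIndex 𝔑 𝔭 (e * d) :=
  ⟨Nat.mul_pos h'.1 h.1, fun z => by
    rw [IsScalarTower.algebraMap_apply K F N, h.2, h'.2, pow_mul]⟩

/-- If `z` is algebraic over `K`, and a valuation is trivial on `K`, then `z` is integral for it. -/
theorem Place.v_le_one_of_isAlgebraic (𝔓 : Place k F)
    (h : ∀ z : K, z ≠ 0 → 𝔓.v (algebraMap K F z) = 1) {z : F} (hz : IsAlgebraic K z) :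
    𝔓.v z ≤ 1 := by
  have h1 : ∀ c : K, algebraMap K F c ∈ 𝔓.ring := fun c => by
    by_cases hc : c = 0
    · simp [hc]
    · exact (h c hc).le
  have h2 : IsIntegral 𝔓.ring z := by
    obtain ⟨p, hp, hp'⟩ := hz.isIntegral
    refine ⟨p.map ((algebraMap K F).codRestrict 𝔓.ring h1), hp.map _, ?_⟩
    rw [Polynomial.eval₂_map]
    exact hp'
  exact 𝔓.v_isIntegral_le_one h2

/-- A constant, that is, an element algebraic over `k`, is a unit at every place. -/
theorem Place.v_eq_one_of_isAlgebraic (𝔓 : Place k F) {z : F} (h0 : z ≠ 0)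
    (hz : IsAlgebraic k z) : 𝔓.v z = 1 := by
  refine le_antisymm (𝔓.v_le_one_of_isAlgebraic 𝔓.trivial hz) ?_
  have := 𝔓.v_le_one_of_isAlgebraic 𝔓.trivial hz.inv
  rw [map_inv₀] at this
  exact (inv_le_one₀ (zero_lt_iff.2 ((Valuation.ne_zero_iff _).2 h0))).1 this

/-- Every place of an algebraic extension lies over a place of the base field. -/
theorem Place.exists_restriction [IsScalarTower k K F] [Algebra.IsAlgebraic K F] (𝔓 : Place k F) :
    ∃ (𝔭 : Place k K) (e : ℕ), HasRamificationIndex 𝔓 𝔭 e := by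
  -- the subgroup of `ℤ` of the orders of elements of `K`, and its positive generator
  let φ : Additive Kˣ →+ ℤ := AddMonoidHom.mk' (fun u => 𝔓.ord (algebraMap K F (u.toMul : Kˣ)))
    (fun a b => by
      simp only [toMul_add, Units.val_mul, map_mul]
      exact 𝔓.ord_mul (by simp) (by simp))
  obtain ⟨g, hg⟩ := Int.subgroup_cyclic φ.range
  have hg' : ∀ n : ℤ, n ∈ φ.range ↔ g ∣ n := fun n => by
    rw [hg, ← Int.mem_zmultiples_iff, AddSubgroup.zmultiples_eq_closure]
  have hdvd : ∀ z : K, g ∣ 𝔓.ord (algebraMap K F z) := fun z => by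
    by_cases hz : z = 0
    · simp [hz]
    · rw [← hg']; exact ⟨Additive.ofMul (Units.mk0 z hz), rfl⟩
  -- if all elements of `K` had order zero, then `F`, algebraic over `K`, would have no poles at `𝔓`
  have hg0 : g ≠ 0 := by
    rintro rfl
    have h1 : ∀ z : K, z ≠ 0 → 𝔓.v (algebraMap K F z) = 1 := fun z hz =>
      (𝔓.v_eq_one_iff (by simpa using hz)).2 (by simpa using hdvd z)
    obtain ⟨t, ht0, ht⟩ := 𝔓.exists_uniformizer
    have h2 := 𝔓.v_le_one_of_isAlgebraic h1 (Algebra.IsAlgebraic.isAlgebraic (R := K) t⁻¹)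
    rw [𝔓.v_le_one_iff (inv_ne_zero ht0), 𝔓.ord_inv, ht] at h2
    omega
  set e := g.natAbs with he
  have he0 : 0 < e := Int.natAbs_pos.2 hg0
  have hdvd' : ∀ z : K, (e : ℤ) ∣ 𝔓.ord (algebraMap K F z) := fun z =>
    (Int.natAbs_dvd).2 (hdvd z)
  -- the orders, divided by the generator, form a normalized valuation of `K`
  let q : K → ℤ := fun z => 𝔓.ord (algebraMap K F z) / e
  have hq : ∀ z, 𝔓.ord (algebraMap K F z) = e * q z := fun z =>
    (Int.mul_ediv_cancel' (hdvd' z)).symm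
  have he0' : (0 : ℤ) < e := by exact_mod_cast he0
  classical
  let v : Valuation K ℤᵐ⁰ :=
    { toFun := fun z => if z = 0 then 0 else WithZero.exp (-q z)
      map_zero' := by simp
      map_one' := by simp [q]
      map_mul' := fun x y => by
        by_cases hx : x = 0
        · simp [hx]
        by_cases hy : y = 0
        · simp [hy]
        simp only [hx, hy, mul_eq_zero, or_self, if_false]
        rw [← WithZero.exp_add, WithZero.exp_inj]
        have := 𝔓.ord_mul (y := algebraMap K F x) (z := algebraMap K F y) (by simpa) (by simpa)
        rw [← map_mul, hq, hq, hq, ← mul_add] at this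
        have := mul_left_cancel₀ he0'.ne' this
        linarith
      map_add_le_max' := fun x y => by
        by_cases hx : x = 0
        · simp [hx]
        by_cases hy : y = 0
        · simp [hy]
        by_cases hxy : x + y = 0
        · simp [hxy]
        simp only [hx, hy, hxy, if_false]
        have := 𝔓.v.map_add (algebraMap K F x) (algebraMap K F y)
        rw [← map_add, 𝔓.v_eq_exp (z := algebraMap K F (x + y)) (by rwa [Ne, map_eq_zero]),
            𝔓.v_eq_exp (z := algebraMap K F x) (by simpa),
            𝔓.v_eq_exp (z := algebraMap K F y) (by simpa),
          le_max_iff, WithZero.exp_le_exp, WithZero.exp_le_exp, hq, hq, hq] at this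
        rw [le_max_iff, WithZero.exp_le_exp, WithZero.exp_le_exp]
        refine this.imp (fun h => ?_) fun h => ?_ <;> nlinarith }
  have hv : ∀ z, z ≠ 0 → v z = WithZero.exp (-q z) := fun z hz => if_neg hz
  refine ⟨⟨v, fun y => ?_, fun c hc => ?_⟩, e, ?_⟩
  · by_cases hy : y = 0
    · exact ⟨0, by simp [hy]⟩
    obtain ⟨u, hu⟩ := (hg' (e * (-WithZero.log y))).2
      (Dvd.dvd.mul_right (Int.dvd_natAbs.2 dvd_rfl) _)
    refine ⟨(u.toMul : Kˣ), ?_⟩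
    rw [hv _ (by simp)]
    have h1 : (e : ℤ) * q (u.toMul : Kˣ) = e * (-WithZero.log y) := by
      rw [← hq]; exact hu
    rw [mul_left_cancel₀ he0'.ne' h1, neg_neg, WithZero.exp_log hy]
  · rw [hv _ (by simpa), WithZero.exp_eq_one]
    have := hq (algebraMap k K c)
    rw [← IsScalarTower.algebraMap_apply, 𝔓.ord_const hc] at this
    simpa [he0.ne'] using this.symm
  · refine hasRamificationIndex_of_ord he0 fun z hz => ?_
    rw [hq]
    congr 1
    rw [Place.ord_eq_of_v _ (hv z hz), neg_neg]

/-- Elements of distinct orders modulo the ramification index are linearly independent: the order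
of a linear combination is attained by one of its terms. -/
theorem HasRamificationIndex.exists_v_sum {𝔓 : Place k F} {𝔭 : Place k K} {e : ℕ}
    (h : HasRamificationIndex 𝔓 𝔭 e) {ι : Type*} (s : Finset ι) (t : ι → F)
    (ht0 : ∀ i ∈ s, t i ≠ 0)
    (ht : ∀ i ∈ s, ∀ j ∈ s, (e : ℤ) ∣ 𝔓.ord (t i) - 𝔓.ord (t j) → i = j)
    (a : ι → K) : ∀ i ∈ s, 𝔓.v (algebraMap K F (a i) * t i) ≤
      𝔓.v (∑ j ∈ s, algebraMap K F (a j) * t j) := by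
  classical
  by_cases hall : ∀ i ∈ s, a i = 0
  · intro i hi; simp [hall i hi]
  push Not at hall
  obtain ⟨i₁, hi₁, hai₁⟩ := hall
  obtain ⟨i₀, hi₀, hmax⟩ := s.exists_max_image (fun i => 𝔓.v (algebraMap K F (a i) * t i)) ⟨i₁, hi₁⟩
  have hne0 : algebraMap K F (a i₀) * t i₀ ≠ 0 := by
    intro h0
    have := hmax i₁ hi₁
    rw [h0, map_zero, le_zero_iff, Valuation.zero_iff] at this
    exact mul_ne_zero (by simpa using hai₁) (ht0 _ hi₁) this
  have hlt : ∀ i ∈ s \ {i₀}, 𝔓.v (algebraMap K F (a i) * t i)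
      < 𝔓.v (algebraMap K F (a i₀) * t i₀) := fun i hi => by
    rw [Finset.mem_sdiff, Finset.mem_singleton] at hi
    refine (hmax i hi.1).lt_of_ne fun heq => hi.2 ?_
    have hi0 : algebraMap K F (a i) * t i ≠ 0 := by
      intro h0
      rw [h0, map_zero] at heq
      exact hne0 ((Valuation.zero_iff _).1 heq.symm)
    rw [𝔓.v_eq_exp hi0, 𝔓.v_eq_exp hne0, WithZero.exp_inj,
      𝔓.ord_mul (left_ne_zero_of_mul hi0) (right_ne_zero_of_mul hi0),
      𝔓.ord_mul (left_ne_zero_of_mul hne0) (right_ne_zero_of_mul hne0), h.ord, h.ord] at heq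
    refine ht i hi.1 i₀ hi₀ ⟨𝔭.ord (a i₀) - 𝔭.ord (a i), ?_⟩
    rw [mul_sub]; linarith
  have := Valuation.map_sum_eq_of_lt 𝔓.v hi₀ hlt
  rw [this]
  exact hmax

/-- `e ≤ [F : K]`, since the first `e` powers of a uniformizer are linearly independent. -/
theorem HasRamificationIndex.index_le_finrank [FiniteDimensional K F] {𝔓 : Place k F}
    {𝔭 : Place k K} {e : ℕ} (h : HasRamificationIndex 𝔓 𝔭 e) : e ≤ Module.finrank K F := by
  obtain ⟨t, ht0, ht⟩ := 𝔓.exists_uniformizer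
  have hli : LinearIndependent K fun i : Fin e => t ^ (i : ℕ) := by
    rw [Fintype.linearIndependent_iff]
    intro a ha i
    have h1 := h.exists_v_sum Finset.univ (fun i : Fin e => t ^ (i : ℕ))
      (fun i _ => pow_ne_zero _ ht0) (fun i _ j _ hij => by
        simp only [𝔓.ord_pow, ht, mul_one] at hij
        obtain ⟨c, hc⟩ := hij
        have h2 := i.2
        have h3 := j.2
        have hc0 : c = 0 := by
          by_contra hc0
          rcases lt_or_gt_of_ne hc0 with h4 | h4 <;> nlinarith
        rw [hc0] at hc
        ext; omega) a i (Finset.mem_univ i)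
    simp only [Algebra.smul_def] at ha
    rw [ha, map_zero, le_zero_iff, Valuation.zero_iff] at h1
    simpa [ht0] using h1
  simpa using hli.fintype_card_le_finrank

end Ramification

section Integral

variable {k K F : Type*} [Field k] [Field K] [Field F] [Algebra k K] [Algebra k F] [Algebra K F]

instance Place.isDiscreteValuationRing (P : Place k K) : IsDiscreteValuationRing P.ring := by
  have : P.v.IsNontrivial := by
    obtain ⟨t, ht0, ht⟩ := P.exists_uniformizer
    refine ⟨t, (Valuation.ne_zero_iff _).2 ht0, ?_⟩
    rw [Ne, P.v_eq_one_iff ht0, ht]; simp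
  infer_instance

/-- An element of a finite separable extension `F / K` without poles over the place `𝔭` of `K` is
integral over the valuation ring of `𝔭`. -/
theorem Place.isIntegral_of_forall [IsScalarTower k K F] [FiniteDimensional K F]
    [Algebra.IsSeparable K F]
    (𝔭 : Place k K) (z : F) (h : ∀ 𝔓 : Place k F, LiesOver 𝔓 𝔭 → 𝔓.v z ≤ 1) :
    IsIntegral 𝔭.ring z := by
  let B := integralClosure 𝔭.ring F
  have : IsDedekindDomain B := integralClosure.isDedekindDomain 𝔭.ring K F
  have : IsFractionRing B F := integralClosure.isFractionRing_of_finite_extension K F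
  obtain ⟨b, hb⟩ := IsDedekindDomain.HeightOneSpectrum.mem_integers_of_valuation_le_one (R := B) F z
    (fun P => by
      have hO : ∀ c : K, 𝔭.v c ≤ 1 → P.valuation F (algebraMap K F c) ≤ 1 := fun c hc =>
        P.valuation_le_one (K := F) (algebraMap 𝔭.ring B ⟨c, hc⟩)
      let Q : Place k F := ⟨P.valuation F, P.valuation_surjective F, fun c hc => by
        have h1 := hO _ (𝔭.v_algebraMap_le_one c)
        have h2 := hO _ (𝔭.v_algebraMap_le_one c⁻¹)
        rw [← IsScalarTower.algebraMap_apply] at h1 h2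
        rw [map_inv₀, map_inv₀] at h2
        refine le_antisymm h1 ((inv_le_one₀ (zero_lt_iff.2 ((Valuation.ne_zero_iff _).2 ?_))).1 h2)
        simpa using hc⟩
      obtain ⟨𝔮, e, he⟩ := Q.exists_restriction (K := K)
      have : 𝔭 = 𝔮 := Place.eq_of_le fun c hc => (he.v_le_one_iff c).1 (hO c hc)
      subst this
      exact h Q ⟨e, he⟩)
  rw [← hb]
  exact b.2

/-- An element that is not integral over the valuation ring of `𝔭` has a pole over `𝔭`. -/
theorem Place.exists_one_lt_of_not_isIntegral [IsScalarTower k K F] [FiniteDimensional K F]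
    [Algebra.IsSeparable K F] (𝔭 : Place k K) (z : F) (h : ¬ IsIntegral 𝔭.ring z) :
    ∃ 𝔓 : Place k F, LiesOver 𝔓 𝔭 ∧ 1 < 𝔓.v z := by
  by_contra! hc
  exact h (𝔭.isIntegral_of_forall z hc)

/-- There is a place above every place: the inverse of a uniformizer is not integral. -/
theorem Place.exists_liesOver [IsScalarTower k K F] [FiniteDimensional K F]
    [Algebra.IsSeparable K F] (𝔭 : Place k K) : ∃ 𝔓 : Place k F, LiesOver 𝔓 𝔭 := by
  obtain ⟨t, ht0, ht⟩ := 𝔭.exists_uniformizer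
  obtain ⟨𝔓, h, -⟩ := 𝔭.exists_one_lt_of_not_isIntegral (algebraMap K F t⁻¹) (fun hint => by
    rw [isIntegral_algebraMap_iff (FaithfulSMul.algebraMap_injective K F)] at hint
    have := 𝔭.v_isIntegral_le_one hint
    rw [𝔭.v_le_one_iff (inv_ne_zero ht0), 𝔭.ord_inv, ht] at this
    omega)
  exact ⟨𝔓, h⟩

/-- An element of `F` integral over the valuation ring of `𝔭` has no poles over `𝔭`. -/
theorem LiesOver.v_le_one_of_isIntegral {𝔓 : Place k F} {𝔭 : Place k K} (h : LiesOver 𝔓 𝔭) {z : F}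
    (hz : IsIntegral 𝔭.ring z) : 𝔓.v z ≤ 1 := by
  obtain ⟨e, he⟩ := h
  refine 𝔓.v_isIntegral_le_one ?_
  obtain ⟨p, hp, hp'⟩ := hz
  refine ⟨p.map (((algebraMap K F).comp (algebraMap 𝔭.ring K)).codRestrict 𝔓.ring
    fun c => (he.v_le_one_iff _).2 c.2), hp.map _, ?_⟩
  rw [Polynomial.eval₂_map]
  exact hp'

/-- A place of `F = K(y)` at which a monic integral equation `p(y) = 0` reduces to a polynomial with
simple root `y` is unramified over `K`. If `q` lifts the minimal polynomial of the residue of `y`,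
then `q(y)` is divisible by a uniformizer `π` of `𝔭`, so that an element `A(y)` of the maximal ideal
is `π` times an element of the same kind. -/
theorem HasRamificationIndex.eq_one_of_separable [FiniteDimensional K F]
    {𝔓 : Place k F} {𝔭 : Place k K} {e : ℕ}
    (h : HasRamificationIndex 𝔓 𝔭 e) (y : F) (hy : IntermediateField.adjoin K {y} = ⊤)
    (p : K[X]) (hp : p.Monic) (hint : ∀ i, 𝔭.v (p.coeff i) ≤ 1)
    (hroot : Polynomial.aeval y p = 0)
    (hder : 𝔓.v (Polynomial.aeval y (Polynomial.derivative p)) = 1) : e = 1 := by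
  let O := 𝔭.ring
  let ι₀ : O →+* F := (algebraMap K F).comp (algebraMap O K)
  let ι : O →+* 𝔓.ring := ι₀.codRestrict 𝔓.ring fun c => (h.v_le_one_iff _).2 c.2
  -- the equation over the valuation ring
  obtain ⟨P, hPmap, -, hPmonic⟩ := Polynomial.lifts_and_natDegree_eq_and_monic (f := algebraMap O K)
    (p := p) ((Polynomial.lifts_iff_coeff_lifts _).2 fun i => ⟨⟨p.coeff i, hint i⟩, rfl⟩) hp
  have hyO : y ∈ 𝔓.ring := LiesOver.v_le_one_of_isIntegral ⟨e, h⟩ (z := y) ⟨P, hPmonic, by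
    have h1 : algebraMap O F = ι₀ := rfl
    rw [h1, ← Polynomial.eval₂_map, hPmap]; exact hroot⟩
  let φ : O[X] →+* 𝔓.ring := Polynomial.eval₂RingHom ι ⟨y, hyO⟩
  have hφ : ∀ A, ((φ A : 𝔓.ring) : F) = Polynomial.aeval y (A.map (algebraMap O K)) := fun A => by
    have h1 : (𝔓.ring.subtype.comp φ) A = Polynomial.aeval y (A.map (algebraMap O K)) := by
      rw [Polynomial.aeval_def, Polynomial.eval₂_map]
      exact Polynomial.hom_eval₂ A ι 𝔓.ring.subtype ⟨y, hyO⟩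
    exact h1
  have hloc : IsLocalHom ι := ⟨fun a ha => by
    by_contra hna
    have h1 : 𝔭.v (a : K) < 1 := by
      rw [← mem_nonunits_iff, ← IsLocalRing.mem_maximalIdeal] at hna
      exact (Valuation.mem_maximalIdeal_iff _ _).1 hna
    have h2 : ι a ∈ IsLocalRing.maximalIdeal 𝔓.ring :=
      (Valuation.mem_maximalIdeal_iff _ _).2 ((h.v_lt_one_iff _).2 h1)
    exact h2 ha⟩
  let κ := IsLocalRing.ResidueField O
  let κ' := IsLocalRing.ResidueField 𝔓.ring
  let ρ : O →+* κ := IsLocalRing.residue O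
  let ρ' : 𝔓.ring →+* κ' := IsLocalRing.residue 𝔓.ring
  let Ψ : κ[X] →+* κ' := Polynomial.eval₂RingHom (IsLocalRing.ResidueField.map ι) (ρ' ⟨y, hyO⟩)
  have hΨ : ∀ A : O[X], Ψ (A.map ρ) = ρ' (φ A) := fun A => by
    change Polynomial.eval₂ _ _ _ = ρ' (Polynomial.eval₂ _ _ _)
    rw [Polynomial.eval₂_map, Polynomial.hom_eval₂]
    rfl
  obtain ⟨π₀, hπ0, hπ1⟩ := 𝔭.exists_uniformizer
  let π : O := ⟨π₀, (𝔭.v_le_one_iff hπ0).2 (by omega)⟩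
  have hdvd : ∀ A : O[X], A.map ρ = 0 → ∃ B, A = Polynomial.C π * B := fun A hA => by
    refine Polynomial.C_dvd_iff_dvd_coeff _ _ |>.2 fun i => ?_
    have h1 : ρ (A.coeff i) = 0 := by rw [← Polynomial.coeff_map, hA, Polynomial.coeff_zero]
    have h2 : 𝔭.v (A.coeff i : K) < 1 :=
      (Valuation.mem_maximalIdeal_iff _ _).1 ((IsLocalRing.residue_eq_zero_iff _).1 h1)
    by_cases h0 : (A.coeff i : K) = 0
    · rw [Subtype.ext (a1 := A.coeff i) (a2 := 0) h0]; exact dvd_zero _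
    refine ⟨⟨(A.coeff i : K) / π₀, ?_⟩, Subtype.ext ?_⟩
    · refine (𝔭.v_le_one_iff (div_ne_zero h0 hπ0)).2 ?_
      rw [𝔭.ord_div h0 hπ0, hπ1]
      have := (𝔭.v_lt_one_iff h0).1 h2
      omega
    · exact (mul_div_cancel₀ _ hπ0).symm
  -- the minimal polynomial of the residue of `y`, as the generator of a kernel
  obtain ⟨q₀, hq₀⟩ := (IsPrincipalIdealRing.principal (RingHom.ker Ψ)).principal
  have hker : ∀ A : κ[X], Ψ A = 0 → ∃ C, A = q₀ * C := fun A hA => by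
    have : A ∈ RingHom.ker Ψ := hA
    rw [hq₀] at this
    exact Ideal.mem_span_singleton.1 this
  have hq₀0 : Ψ q₀ = 0 := by
    have : q₀ ∈ RingHom.ker Ψ := by rw [hq₀]; exact Ideal.mem_span_singleton_self _
    exact this
  have hφP : φ P = 0 := Subtype.ext (by rw [hφ, hPmap, hroot]; rfl)
  obtain ⟨h₀, hh₀⟩ := hker (P.map ρ) (by rw [hΨ, hφP, map_zero])
  -- the cofactor of `q` in `p` is a unit at `y`, as the residue of `y` is a simple root of `p`
  have hh0 : Ψ h₀ ≠ 0 := fun h0 => by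
    have h1 : Ψ ((Polynomial.derivative P).map ρ) = 0 := by
      rw [← Polynomial.derivative_map, hh₀, Polynomial.derivative_mul, map_add, map_mul, map_mul,
        h0,
        hq₀0, mul_zero, zero_mul, add_zero]
    rw [hΨ] at h1
    have h2 := (Valuation.mem_maximalIdeal_iff _ _).1 ((IsLocalRing.residue_eq_zero_iff _).1 h1)
    change 𝔓.v ((φ (Polynomial.derivative P) : 𝔓.ring) : F) < 1 at h2
    rw [hφ, ← Polynomial.derivative_map, hPmap, hder] at h2
    exact lt_irrefl _ h2
  have hsurj : Function.Surjective (Polynomial.map ρ) :=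
    Polynomial.map_surjective ρ IsLocalRing.residue_surjective
  obtain ⟨q, rfl⟩ := hsurj q₀
  obtain ⟨H, rfl⟩ := hsurj h₀
  obtain ⟨r, hr⟩ := hdvd (P - q * H) (by rw [Polynomial.map_sub, Polynomial.map_mul, hh₀, sub_self])
  have hunit : ∀ A : O[X], Ψ (A.map ρ) ≠ 0 → 𝔓.ord ((φ A : 𝔓.ring) : F) = 0 := fun A hA => by
    rw [hΨ] at hA
    have h0 : ((φ A : 𝔓.ring) : F) ≠ 0 := fun h0 => hA (by
      rw [Subtype.ext (a1 := φ A) (a2 := 0) h0, map_zero])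
    have h1 : ¬ 𝔓.v ((φ A : 𝔓.ring) : F) < 1 := fun hlt => hA
      ((IsLocalRing.residue_eq_zero_iff _).2 ((Valuation.mem_maximalIdeal_iff _ _).2 hlt))
    rw [← 𝔓.v_eq_one_iff h0]
    exact le_antisymm (φ A).2 (not_lt.1 h1)
  have hφC : ∀ c : O, ((φ (Polynomial.C c) : 𝔓.ring) : F) = algebraMap K F c := fun c => by
    rw [hφ]; simp
  have hpos : ∀ A, ((φ A : 𝔓.ring) : F) ≠ 0 → 0 ≤ 𝔓.ord ((φ A : 𝔓.ring) : F) := fun A hA =>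
    (𝔓.v_le_one_iff hA).1 (φ A).2
  -- The order of an element `A(y)` is a multiple of `e`, by induction on the order: if `A(y)` is in
  -- the maximal ideal, then `A = q C + π D`, and `q(y)` is `-π r(y)` up to a unit.
  have key : ∀ n : ℕ, ∀ A : O[X], ((φ A : 𝔓.ring) : F) ≠ 0 → 𝔓.ord ((φ A : 𝔓.ring) : F) ≤ n →
      (e : ℤ) ∣ 𝔓.ord ((φ A : 𝔓.ring) : F) := by
    intro n
    induction n with
    | zero =>
      intro A hA hn
      rw [le_antisymm (by exact_mod_cast hn) (hpos A hA)]; exact dvd_zero _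
    | succ n ih =>
      intro A hA hn
      by_cases hψ : Ψ (A.map ρ) = 0
      swap
      · rw [hunit A hψ]; exact dvd_zero _
      obtain ⟨C₀, hC₀⟩ := hker _ hψ
      obtain ⟨C, rfl⟩ := hsurj C₀
      obtain ⟨D, hD⟩ := hdvd (A - q * C) (by
        rw [Polynomial.map_sub, Polynomial.map_mul, hC₀, sub_self])
      have h1 : φ A * φ H = φ (Polynomial.C π) * φ (D * H - r * C) := by
        have hA' : A = q * C + Polynomial.C π * D := by rw [← hD]; ring
        have hP' : φ q * φ H = - (φ (Polynomial.C π) * φ r) := by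
          rw [← map_mul, ← map_mul, ← hr, map_sub, hφP]; ring
        rw [hA']
        simp only [map_add, map_sub, map_mul]
        linear_combination φ C * hP'
      have h2 : ((φ A : 𝔓.ring) : F) * ((φ H : 𝔓.ring) : F)
          = algebraMap K F π₀ * ((φ (D * H - r * C) : 𝔓.ring) : F) := by
        rw [← hφC π]; exact_mod_cast congrArg (Subtype.val) h1
      have hH0 : ((φ H : 𝔓.ring) : F) ≠ 0 := fun h0 => hh0 (by
        rw [hΨ, Subtype.ext (a1 := φ H) (a2 := 0) h0, map_zero])
      have hr0 := mul_ne_zero hA hH0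
      rw [h2] at hr0
      have h3 := congrArg 𝔓.ord h2
      rw [𝔓.ord_mul hA hH0, hunit H hh0, 𝔓.ord_mul (left_ne_zero_of_mul hr0)
        (right_ne_zero_of_mul hr0), h.ord, hπ1, add_zero, mul_one] at h3
      rw [h3]
      refine dvd_add dvd_rfl (ih _ (right_ne_zero_of_mul hr0) ?_)
      have := h.1
      push_cast at hn
      omega
  obtain ⟨t, ht0, ht⟩ := 𝔓.exists_uniformizer
  have htop : t ∈ IntermediateField.adjoin K {y} := by rw [hy]; trivial
  -- a uniformizer is, up to a factor from `K`, of the form `A(y)` with `A` integral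
  obtain ⟨A, hA⟩ : ∃ A : K[X], t = Polynomial.aeval y A := by
    rw [← IntermediateField.mem_toSubalgebra,
      IntermediateField.adjoin_simple_toSubalgebra_of_isAlgebraic
        (Algebra.IsAlgebraic.isAlgebraic y), Algebra.adjoin_singleton_eq_range_aeval] at htop
    obtain ⟨A, hA⟩ := htop
    exact ⟨A, hA.symm⟩
  obtain ⟨b, hbM, hb⟩ := IsLocalization.integerNormalization_spec (nonZeroDivisors O) (S := K) A
  have hb0 : (b : K) ≠ 0 := by
    have := nonZeroDivisors.ne_zero hbM
    exact fun h0 => this (Subtype.ext h0)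
  have h4 : ((φ (IsLocalization.integerNormalization (nonZeroDivisors O) A) : 𝔓.ring) : F)
      = algebraMap K F (b : K) * t := by
    rw [hφ, hb, hA]
    have : b • A = Polynomial.C (b : K) * A := by
      ext i; simp [Algebra.smul_def]
    rw [this, map_mul, Polynomial.aeval_C]
  have hne : algebraMap K F (b : K) * t ≠ 0 := mul_ne_zero (by simp [hb0]) ht0
  have h5 := key (𝔓.ord (algebraMap K F (b : K) * t)).toNat
    (IsLocalization.integerNormalization (nonZeroDivisors O) A) (by rw [h4]; exact hne)
    (by rw [h4]; exact Int.self_le_toNat _)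
  rw [h4, 𝔓.ord_mul (left_ne_zero_of_mul hne) ht0, h.ord, ht] at h5
  have h6 : (e : ℤ) ∣ 1 := (Int.dvd_add_right (dvd_mul_right _ _)).1 h5
  exact_mod_cast Int.eq_one_of_dvd_one (by positivity) h6

end Integral

/-! ### Quadratic extensions -/

section Quadratic

variable {K F : Type*} [Field K] [Field F] [Algebra K F]

theorem exists_add_mul_of_finrank_two (h2 : Module.finrank K F = 2) {ω : F}
    (hω : ω ∉ Set.range (algebraMap K F)) (z : F) :
    ∃ c d : K, z = algebraMap K F c + algebraMap K F d * ω := by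
  have hli : LinearIndependent K ![1, ω] := by
    rw [LinearIndependent.pair_iff]
    intro s t hst
    have ht : t = 0 := by
      by_contra ht
      refine hω ⟨-s / t, ?_⟩
      have ht' : algebraMap K F t ≠ 0 := by simpa using ht
      simp only [Algebra.smul_def, mul_one] at hst
      rw [map_div₀, map_neg, div_eq_iff ht']
      linear_combination -hst
    subst ht
    simpa using hst
  have hspan := hli.span_eq_top_of_card_eq_finrank (by simp [h2])
  have hz : z ∈ Submodule.span K (Set.range ![1, ω]) := by rw [hspan]; trivial
  rw [Matrix.range_cons, Matrix.range_cons, Matrix.range_empty, Set.union_empty,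
    Set.singleton_union, Submodule.mem_span_pair] at hz
  obtain ⟨c, d, hcd⟩ := hz
  exact ⟨c, d, by rw [← hcd]; simp [Algebra.smul_def]⟩

variable {σ : F ≃ₐ[K] F}

theorem exists_apply_ne (hσ : σ ≠ 1) : ∃ ω, σ ω ≠ ω := by
  by_contra! h; exact hσ (AlgEquiv.ext h)

theorem notMem_range_of_apply_ne {ω : F} (hω : σ ω ≠ ω) : ω ∉ Set.range (algebraMap K F) := by
  rintro ⟨c, rfl⟩; exact hω (σ.commutes c)

theorem exists_eq_algebraMap_of_fixed (h2 : Module.finrank K F = 2) (hσ : σ ≠ 1) {z : F}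
    (hz : σ z = z) : ∃ c : K, algebraMap K F c = z := by
  obtain ⟨ω, hω⟩ := exists_apply_ne hσ
  obtain ⟨c, d, rfl⟩ := exists_add_mul_of_finrank_two h2 (notMem_range_of_apply_ne hω) z
  simp only [map_add, map_mul, AlgEquiv.commutes, add_right_inj] at hz
  have hd : algebraMap K F d = 0 := by
    by_contra hd; exact hω (mul_left_cancel₀ hd hz)
  exact ⟨c, by rw [hd]; ring⟩

theorem conj_conj (h2 : Module.finrank K F = 2) (hσ : σ ≠ 1) (z : F) : σ (σ z) = z := by
  have hfd : FiniteDimensional K F := FiniteDimensional.of_finrank_pos (by omega)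
  have hcard : Fintype.card (F ≃ₐ[K] F) ≤ 2 := h2 ▸ AlgEquiv.card_le
  have h1 : 1 < Fintype.card (F ≃ₐ[K] F) := Fintype.one_lt_card_iff.2 ⟨σ, 1, hσ⟩
  have h3 : Fintype.card (F ≃ₐ[K] F) = 2 := by omega
  have h4 := pow_card_eq_one (x := σ)
  rw [h3, pow_two] at h4
  exact DFunLike.congr_fun h4 z

theorem symm_eq_self (h2 : Module.finrank K F = 2) (hσ : σ ≠ 1) : σ.symm = σ :=
  AlgEquiv.ext fun z => by rw [AlgEquiv.symm_apply_eq, conj_conj h2 hσ]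

theorem isGalois_of_finrank_two (h2 : Module.finrank K F = 2) (hσ : σ ≠ 1) : IsGalois K F := by
  have hfd : FiniteDimensional K F := FiniteDimensional.of_finrank_pos (by omega)
  have hcard : Nat.card (F ≃ₐ[K] F) ≤ 2 := by
    rw [Nat.card_eq_fintype_card]; exact h2 ▸ AlgEquiv.card_le
  have h1 : 1 < Nat.card (F ≃ₐ[K] F) := by
    rw [Nat.card_eq_fintype_card]; exact Fintype.one_lt_card_iff.2 ⟨σ, 1, hσ⟩
  exact IsGalois.of_card_aut_eq_finrank _ _ (by omega)

theorem exists_trace (h2 : Module.finrank K F = 2) (hσ : σ ≠ 1) (z : F) :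
    ∃ c : K, algebraMap K F c = z + σ z :=
  exists_eq_algebraMap_of_fixed h2 hσ (by rw [map_add, conj_conj h2 hσ, add_comm])

theorem exists_norm (h2 : Module.finrank K F = 2) (hσ : σ ≠ 1) (z : F) :
    ∃ c : K, algebraMap K F c = z * σ z :=
  exists_eq_algebraMap_of_fixed h2 hσ (by rw [map_mul, conj_conj h2 hσ, mul_comm])

end Quadratic

/-! ### Places in quadratic extensions -/

section QuadraticPlaces

variable {k K F : Type*} [Field k] [Field K] [Field F] [Algebra k K] [Algebra k F] [Algebra K F]
  [IsScalarTower k K F] {σ : F ≃ₐ[K] F}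

theorem Place.conj_v (h2 : Module.finrank K F = 2) (hσ : σ ≠ 1) (𝔓 : Place k F) (z : F) :
    (𝔓.conj σ).v z = 𝔓.v (σ z) := by
  change 𝔓.v (σ.symm z) = _
  rw [symm_eq_self h2 hσ]

theorem Place.conj_ord (h2 : Module.finrank K F = 2) (hσ : σ ≠ 1) (𝔓 : Place k F) (z : F) :
    (𝔓.conj σ).ord z = 𝔓.ord (σ z) := by
  simp [Place.ord, Place.conj_v h2 hσ]

theorem Place.conj_conj (h2 : Module.finrank K F = 2) (hσ : σ ≠ 1) (𝔓 : Place k F) :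
    (𝔓.conj σ).conj σ = 𝔓 :=
  Place.ext' fun z => by
    rw [Place.conj_v h2 hσ, Place.conj_v h2 hσ, CubicFunctionField.conj_conj h2 hσ]

theorem HasRamificationIndex.conj {𝔓 : Place k F} {𝔭 : Place k K} {e : ℕ}
    (h : HasRamificationIndex 𝔓 𝔭 e) : HasRamificationIndex (𝔓.conj σ) 𝔭 e :=
  ⟨h.1, fun z => by
    rw [← h.2]
    change 𝔓.v (σ.symm (algebraMap K F z)) = _
    rw [AlgEquiv.commutes]⟩

theorem LiesOver.conj {𝔓 : Place k F} {𝔭 : Place k K} (h : LiesOver 𝔓 𝔭) :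
    LiesOver (𝔓.conj σ) 𝔭 :=
  h.imp fun _ he => he.conj

omit [IsScalarTower k K F] in
/-- If the valuation ring of `R` contains the intersection of those of `P` and `Q`, and an element
of the maximal ideal of `P` that is integral at `Q` is a unit for `R`, then `R` is `Q`:
multiplication by powers of the element removes the condition at `P`. -/
theorem Place.eq_of_integral_inter {P Q R : Place k F}
    (h : ∀ z, P.v z ≤ 1 → Q.v z ≤ 1 → R.v z ≤ 1) {w : F} (hP : P.v w < 1) (hQ : Q.v w ≤ 1)
    (hR : R.v w = 1) : Q = R := by
  refine Place.eq_of_le fun z hz => ?_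
  obtain ⟨m, hm⟩ := P.exists_pow_mul_lt hP z 0
  have := h (z * w ^ m) (by simpa using hm.le) (Q.v_mul_le_one hz (by
    rw [map_pow]; exact pow_le_one' hQ m))
  rwa [map_mul, map_pow, hR, one_pow, mul_one] at this

/-- The places over a given place are conjugate. -/
theorem LiesOver.eq_or_eq_conj (h2 : Module.finrank K F = 2) (hσ : σ ≠ 1) {𝔓 𝔔 : Place k F}
    {𝔭 : Place k K} (h : LiesOver 𝔓 𝔭) (h' : LiesOver 𝔔 𝔭) : 𝔔 = 𝔓 ∨ 𝔔 = 𝔓.conj σ := by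
  obtain ⟨e, he⟩ := h
  obtain ⟨d, hd⟩ := h'
  -- `z` is a root of `X² - t X + n`, where the trace `t` and the norm `n` are integral at the place
  -- below
  have hint : ∀ z, 𝔓.v z ≤ 1 → (𝔓.conj σ).v z ≤ 1 → 𝔔.v z ≤ 1 := fun z hz hz' => by
    rw [Place.conj_v h2 hσ] at hz'
    obtain ⟨t, ht⟩ := exists_trace h2 hσ z
    obtain ⟨n, hn⟩ := exists_norm h2 hσ z
    have ht1 : 𝔔.v (algebraMap K F t) ≤ 1 := (hd.v_le_one_iff t).2 ((he.v_le_one_iff t).1 (by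
      rw [ht]; exact 𝔓.v_add_le_one hz hz'))
    have hn1 : 𝔔.v (algebraMap K F n) ≤ 1 := (hd.v_le_one_iff n).2 ((he.v_le_one_iff n).1 (by
      rw [hn]; exact 𝔓.v_mul_le_one hz hz'))
    by_contra! hlt
    have hz0 : z ≠ 0 := by rintro rfl; simp at hlt
    have h1 : z = algebraMap K F t - algebraMap K F n * z⁻¹ := by
      rw [ht, hn]; field_simp; ring
    have h3 : 𝔔.v (algebraMap K F t - algebraMap K F n * z⁻¹) ≤ 1 :=
      𝔔.v_sub_le_one ht1 (𝔔.v_mul_le_one hn1 (by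
        rw [map_inv₀]; exact inv_le_one_of_one_le₀ hlt.le))
    rw [← h1] at h3
    exact absurd hlt (not_lt.2 h3)
  by_cases hc : 𝔓.conj σ = 𝔓
  · rw [hc] at hint
    exact Or.inl (Place.eq_of_le fun z hz => hint z hz hz).symm
  -- `w` is near one at `𝔓` and near zero at its conjugate, so that its norm vanishes over `𝔭`
  obtain ⟨w, hw, hw'⟩ := Place.exists_separating (Ne.symm hc)
  have hw1 : 𝔓.v (w * σ w) < 1 := by
    rw [Place.conj_v h2 hσ] at hw'
    rw [map_mul, 𝔓.v_eq_one_of_sub hw, one_mul]; exact hw'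
  obtain ⟨n, hn⟩ := exists_norm h2 hσ w
  have hw2 : 𝔔.v (w * σ w) < 1 := by
    rw [← hn] at hw1 ⊢
    exact (hd.v_lt_one_iff n).2 ((he.v_lt_one_iff n).1 hw1)
  have h1 : 𝔓.v (1 - w) < 1 := by rwa [Valuation.map_sub_swap]
  have h1' : (𝔓.conj σ).v (1 - w) ≤ 1 := Place.v_sub_le_one _ (by simp) hw'.le
  have hone : ∀ y, 𝔔.v y < 1 → 𝔔.v (1 - y) = 1 := fun y hy =>
    𝔔.v_eq_one_of_sub (by rw [sub_sub_cancel_left, Valuation.map_neg]; exact hy)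
  have hor : 𝔔.v w < 1 ∨ 𝔔.v (σ w) < 1 := by
    by_contra! hcon
    rw [map_mul] at hw2
    exact absurd hw2 (not_lt.2 (one_le_mul hcon.1 hcon.2))
  rcases hor with hlt | hlt
  · exact Or.inr (Place.eq_of_integral_inter hint h1 h1' (hone w hlt)).symm
  · refine Or.inl (Place.eq_of_integral_inter (P := 𝔓.conj σ) (Q := 𝔓) (w := 1 - σ w)
      (fun z a b => hint z b a) ?_ ?_ (hone _ hlt)).symm
    · rw [Place.conj_v h2 hσ, map_sub, map_one, CubicFunctionField.conj_conj h2 hσ]; exact h1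
    · rw [Place.conj_v h2 hσ, map_sub, map_one] at h1'; exact h1'

/-- A split place is unramified. -/
theorem HasRamificationIndex.eq_one_of_split (h2 : Module.finrank K F = 2) (hσ : σ ≠ 1)
    {𝔓 : Place k F} {𝔭 : Place k K} {e : ℕ} (h : HasRamificationIndex 𝔓 𝔭 e)
    (hs : 𝔓.conj σ ≠ 𝔓) : e = 1 := by
  obtain ⟨t, ht0, ht⟩ := 𝔓.exists_uniformizer
  obtain ⟨w, hw, hw'⟩ := Place.exists_separating_small hs.symm t (-1)
  rw [Place.conj_v h2 hσ] at hw'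
  -- the trace of `t w` is an element of `K` of order one
  obtain ⟨c, hc⟩ := exists_trace h2 hσ (t * w)
  have h1 : 𝔓.v (t * w) = WithZero.exp (-1 : ℤ) := by
    rw [map_mul, 𝔓.v_eq_one_of_sub hw, mul_one, 𝔓.v_eq_exp ht0, ht]
  have h3 : 𝔓.v (algebraMap K F c) = WithZero.exp (-1 : ℤ) := by
    rw [hc, Valuation.map_add_eq_of_lt_left _ (by rw [h1]; exact hw'), h1]
  have h4 := 𝔓.ord_eq_of_v h3
  rw [h.ord] at h4
  have h5 : (e : ℤ) ∣ 1 := Dvd.intro _ (by simpa using h4)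
  exact_mod_cast Int.eq_one_of_dvd_one (by positivity) h5

/-- A split place has the same residue field as the place below it. -/
theorem LiesOver.exists_sub_lt_of_split (h2 : Module.finrank K F = 2) (hσ : σ ≠ 1)
    {𝔓 : Place k F} (hs : 𝔓.conj σ ≠ 𝔓) {z : F} (hz : 𝔓.v z ≤ 1) :
    ∃ c : K, 𝔓.v (z - algebraMap K F c) < 1 := by
  obtain ⟨w, hw, hw'⟩ := Place.exists_separating_small hs.symm z 0
  rw [Place.conj_v h2 hσ, WithZero.exp_zero] at hw'
  -- the trace of `z w` approximates `z`
  obtain ⟨c, hc⟩ := exists_trace h2 hσ (z * w)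
  refine ⟨c, ?_⟩
  have : z - algebraMap K F c = -(z * (w - 1)) - σ (z * w) := by rw [hc]; ring
  rw [this]
  refine 𝔓.v_sub_lt_one ?_ hw'
  rw [Valuation.map_neg, map_mul]
  exact mul_lt_one_of_nonneg_of_lt_one_right hz zero_le hw

/-- If `e = 2`, the residue field does not grow. -/
theorem HasRamificationIndex.exists_sub_lt_of_ramified (h2 : Module.finrank K F = 2)
    {𝔓 : Place k F} {𝔭 : Place k K} (h : HasRamificationIndex 𝔓 𝔭 2) {z : F}
    (hz : 𝔓.v z ≤ 1) : ∃ c : K, 𝔓.v (z - algebraMap K F c) < 1 := by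
  obtain ⟨t, ht0, ht⟩ := 𝔓.exists_uniformizer
  have htK : t ∉ Set.range (algebraMap K F) := by
    rintro ⟨c, rfl⟩
    rw [h.ord] at ht
    push_cast at ht
    omega
  obtain ⟨c, d, rfl⟩ := exists_add_mul_of_finrank_two h2 htK z
  have h1 := h.exists_v_sum Finset.univ ![1, t]
    (by simp [Fin.forall_fin_two, ht0])
    (by simp [Fin.forall_fin_two, ht]) ![c, d]
  simp only [Finset.mem_univ, forall_const, Fin.forall_fin_two, Fin.sum_univ_two,
    Matrix.cons_val_zero, Matrix.cons_val_one, mul_one] at h1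
  refine ⟨c, ?_⟩
  rw [add_sub_cancel_left]
  have h3 := h1.2.trans hz
  by_cases hd : d = 0
  · simp [hd]
  have hd' : algebraMap K F d ≠ 0 := by simpa using hd
  rw [𝔓.v_le_one_iff (mul_ne_zero hd' ht0), 𝔓.ord_mul hd' ht0, h.ord, ht] at h3
  rw [𝔓.v_lt_one_iff (mul_ne_zero hd' ht0), 𝔓.ord_mul hd' ht0, h.ord, ht]
  push_cast at h3 ⊢
  omega

theorem HasRamificationIndex.conj_eq_of_ramified (h2 : Module.finrank K F = 2) (hσ : σ ≠ 1)
    {𝔓 : Place k F} {𝔭 : Place k K} (h : HasRamificationIndex 𝔓 𝔭 2) : 𝔓.conj σ = 𝔓 := by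
  by_contra hs
  have := h.eq_one_of_split h2 hσ hs
  omega

/-- At a ramified place the conjugation acts trivially on the residue field. -/
theorem HasRamificationIndex.v_conj_sub_lt_of_ramified (h2 : Module.finrank K F = 2) (hσ : σ ≠ 1)
    {𝔓 : Place k F} {𝔭 : Place k K} (h : HasRamificationIndex 𝔓 𝔭 2) {z : F}
    (hz : 𝔓.v z ≤ 1) : 𝔓.v (σ z - z) < 1 := by
  obtain ⟨c, hc⟩ := h.exists_sub_lt_of_ramified h2 hz
  have h1 : 𝔓.v (σ z - algebraMap K F c) < 1 := by
    rw [← σ.commutes c, ← map_sub, ← Place.conj_v h2 hσ, h.conj_eq_of_ramified h2 hσ]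
    exact hc
  have : σ z - z = (σ z - algebraMap K F c) - (z - algebraMap K F c) := by ring
  rw [this]
  exact 𝔓.v_sub_lt_one h1 hc

/-- A place that is its own conjugate and unramified has a larger residue field: otherwise `K` would
be dense in `F` for its topology, and the conjugation, being continuous, would be trivial. -/
theorem HasRamificationIndex.exists_not_sub_lt (h2 : Module.finrank K F = 2) (hσ : σ ≠ 1)
    {𝔓 : Place k F} {𝔭 : Place k K} (h : HasRamificationIndex 𝔓 𝔭 1)
    (hs : 𝔓.conj σ = 𝔓) : ∃ z, 𝔓.v z ≤ 1 ∧ ∀ c : K, 1 ≤ 𝔓.v (z - algebraMap K F c) := by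
  by_contra! hcon
  obtain ⟨t, ht0, ht⟩ := 𝔭.exists_uniformizer
  have ht0' : algebraMap K F t ≠ 0 := by simpa using ht0
  have ht' : 𝔓.v (algebraMap K F t) = WithZero.exp (-1 : ℤ) := by
    rw [h.2, pow_one, 𝔭.v_eq_exp ht0, ht]
  have hσv : ∀ z, 𝔓.v (σ z) = 𝔓.v z := fun z => by rw [← Place.conj_v h2 hσ, hs]
  obtain ⟨ω, hω⟩ := exists_apply_ne hσ
  have hω0 : ω ≠ 0 := by rintro rfl; simp at hω
  -- successive approximation of `ω` by elements of `K`
  have key : ∀ n : ℕ, ∃ c : K, 𝔓.v (ω - algebraMap K F c)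
      ≤ WithZero.exp (-𝔓.ord ω - n) := by
    intro n
    induction n with
    | zero => exact ⟨0, by simp [𝔓.v_eq_exp hω0]⟩
    | succ n ih =>
      obtain ⟨c, hc⟩ := ih
      have htn : 𝔓.v (algebraMap K F t ^ (𝔓.ord ω + n)) = WithZero.exp (-𝔓.ord ω - n) := by
        rw [map_zpow₀, ht', ← WithZero.exp_zsmul]; congr 1; simp; ring
      obtain ⟨d, hd⟩ := hcon ((ω - algebraMap K F c) / algebraMap K F t ^ (𝔓.ord ω + n)) (by
        rw [map_div₀, htn]
        exact div_le_one_of_le₀ hc zero_le)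
      refine ⟨c + d * t ^ (𝔓.ord ω + n), ?_⟩
      have h1 : ω - algebraMap K F (c + d * t ^ (𝔓.ord ω + n))
          = ((ω - algebraMap K F c) / algebraMap K F t ^ (𝔓.ord ω + n) - algebraMap K F d)
            * algebraMap K F t ^ (𝔓.ord ω + n) := by
        have := zpow_ne_zero (𝔓.ord ω + n) ht0'
        rw [map_add, map_mul, map_zpow₀]; field_simp; ring
      by_cases h0 : ω - algebraMap K F (c + d * t ^ (𝔓.ord ω + n)) = 0
      · rw [h0]; simp
      have h3 : 𝔓.v (ω - algebraMap K F (c + d * t ^ (𝔓.ord ω + n)))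
          < WithZero.exp (-𝔓.ord ω - n) := by
        rw [h1, map_mul, htn]
        exact mul_lt_of_lt_one_left WithZero.exp_pos hd
      rw [𝔓.v_eq_exp h0, WithZero.exp_lt_exp] at h3
      rw [𝔓.v_eq_exp h0, WithZero.exp_le_exp]
      rw [Nat.cast_add, Nat.cast_one]
      omega
  have hne : σ ω - ω ≠ 0 := sub_ne_zero.2 hω
  obtain ⟨c, hc⟩ := key (𝔓.ord (σ ω - ω) - 𝔓.ord ω + 1).toNat
  have h1 : 𝔓.v (σ ω - ω) ≤ WithZero.exp
      (-𝔓.ord ω - (𝔓.ord (σ ω - ω) - 𝔓.ord ω + 1).toNat) := by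
    have h2 : σ (ω - algebraMap K F c) - (ω - algebraMap K F c) = σ ω - ω := by
      rw [map_sub, σ.commutes]; ring
    rw [← h2]
    refine le_trans ?_ (WithZero.exp_le_exp.2 (show _ ≤ _ by rw [h2]))
    exact (𝔓.v.map_sub _ _).trans (max_le (by rw [hσv]; exact hc) hc)
  rw [𝔓.v_eq_exp hne, WithZero.exp_le_exp] at h1
  have := Int.self_le_toNat (𝔓.ord (σ ω - ω) - 𝔓.ord ω + 1)
  omega

end QuadraticPlaces

/-! ### Degrees of places in extensions -/

section ResidueMap

variable {k E F : Type*} [Field k] [Field E] [Field F] [Algebra k E] [Algebra k F]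
  {P : Place k E} {Q : Place k F}

theorem Place.residue_eq_zero_iff (z : P.ring) :
    IsLocalRing.residue P.ring z = 0 ↔ P.v (z : E) < 1 :=
  (IsLocalRing.residue_eq_zero_iff _).trans (Valuation.mem_maximalIdeal_iff _ _)

/-- The `k`-linear map of residue fields induced by a homomorphism compatible with two places. -/
noncomputable def residueMap (ψ : E →+* F) (hk : ∀ c : k, ψ (algebraMap k E c) = algebraMap k F c)
    (hle : ∀ z, P.v z ≤ 1 → Q.v (ψ z) ≤ 1) (hlt : ∀ z, P.v z < 1 → Q.v (ψ z) < 1) :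
    IsLocalRing.ResidueField P.ring →ₗ[k] IsLocalRing.ResidueField Q.ring :=
  let ψ' : P.ring →+* Q.ring :=
    (ψ.comp P.ring.subtype).codRestrict Q.ring fun z => hle _ z.2
  let ψ'' : IsLocalRing.ResidueField P.ring →+* IsLocalRing.ResidueField Q.ring :=
    Ideal.Quotient.lift _ ((IsLocalRing.residue Q.ring).comp ψ') fun z hz =>
      (Q.residue_eq_zero_iff _).2 (hlt _ ((Valuation.mem_maximalIdeal_iff _ _).1 hz))
  { toFun := ψ''
    map_add' := map_add _
    map_smul' := fun c z => by
      rw [Algebra.smul_def, Algebra.smul_def, map_mul]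
      congr 1
      change IsLocalRing.residue Q.ring (ψ' (algebraMap k P.ring c))
        = IsLocalRing.residue Q.ring (algebraMap k Q.ring c)
      congr 1
      exact Subtype.ext (hk c) }

theorem residueMap_residue (ψ : E →+* F) (hk : ∀ c : k, ψ (algebraMap k E c) = algebraMap k F c)
    (hle : ∀ z, P.v z ≤ 1 → Q.v (ψ z) ≤ 1) (hlt : ∀ z, P.v z < 1 → Q.v (ψ z) < 1) (z : P.ring) :
    residueMap ψ hk hle hlt (IsLocalRing.residue P.ring z)
      = IsLocalRing.residue Q.ring ⟨ψ z, hle _ z.2⟩ := rfl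

/-- Places with isomorphic residue fields have the same degree. -/
theorem Place.degree_eq_of_surjective (ψ : E →+* F)
    (hk : ∀ c : k, ψ (algebraMap k E c) = algebraMap k F c)
    (hle : ∀ z, P.v z ≤ 1 → Q.v (ψ z) ≤ 1) (hlt : ∀ z, Q.v (ψ z) < 1 ↔ P.v z < 1)
    (hle' : ∀ z, Q.v (ψ z) ≤ 1 → P.v z ≤ 1)
    (hs : ∀ z, Q.v z ≤ 1 → ∃ c, Q.v (z - ψ c) < 1) : Q.degree = P.degree := by
  refine (LinearEquiv.finrank_eq (LinearEquiv.ofBijective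
    (residueMap ψ hk hle fun z => (hlt z).2) ⟨?_, ?_⟩)).symm
  · rw [injective_iff_map_eq_zero]
    intro a ha
    obtain ⟨z, rfl⟩ := IsLocalRing.residue_surjective a
    rw [residueMap_residue, Q.residue_eq_zero_iff] at ha
    exact (P.residue_eq_zero_iff _).2 ((hlt _).1 ha)
  · intro b
    obtain ⟨z, rfl⟩ := IsLocalRing.residue_surjective b
    obtain ⟨c, hc⟩ := hs z z.2
    have hc1 : Q.v (ψ c) ≤ 1 := by
      have := Q.v_sub_le_one z.2 hc.le
      rwa [sub_sub_cancel] at this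
    refine ⟨IsLocalRing.residue P.ring ⟨c, hle' c hc1⟩, ?_⟩
    rw [residueMap_residue, eq_comm, ← sub_eq_zero, ← map_sub, Q.residue_eq_zero_iff]
    exact hc

/-- If `1` and the residue of `ω` form a basis of the residue field of `Q` over that of `P`, the
degree doubles. -/
theorem Place.degree_eq_two_mul (hP : 0 < P.degree) (ψ : E →+* F)
    (hk : ∀ c : k, ψ (algebraMap k E c) = algebraMap k F c)
    (hle : ∀ z, P.v z ≤ 1 → Q.v (ψ z) ≤ 1) (hlt : ∀ z, P.v z < 1 → Q.v (ψ z) < 1)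
    (ω : F) (hω : Q.v ω ≤ 1)
    (hs : ∀ z, Q.v z ≤ 1 → ∃ c d, P.v c ≤ 1 ∧ P.v d ≤ 1 ∧ Q.v (z - (ψ c + ψ d * ω)) < 1)
    (hi : ∀ c d, P.v c ≤ 1 → P.v d ≤ 1 → Q.v (ψ c + ψ d * ω) < 1 → P.v c < 1 ∧ P.v d < 1) :
    Q.degree = 2 * P.degree := by
  have hfin : Module.Finite k (IsLocalRing.ResidueField P.ring) := Module.finite_of_finrank_pos hP
  let f := residueMap ψ hk hle hlt
  let g : (IsLocalRing.ResidueField P.ring × IsLocalRing.ResidueField P.ring) →ₗ[k]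
      IsLocalRing.ResidueField Q.ring :=
    f.coprod ((LinearMap.mulRight k (IsLocalRing.residue Q.ring ⟨ω, hω⟩)).comp f)
  have hg : ∀ c d : P.ring, g (IsLocalRing.residue P.ring c, IsLocalRing.residue P.ring d) =
      IsLocalRing.residue Q.ring (⟨ψ c, hle _ c.2⟩ + ⟨ψ d, hle _ d.2⟩ * ⟨ω, hω⟩) := fun c d => by
    rw [map_add, map_mul]; rfl
  have h1 := LinearEquiv.finrank_eq (LinearEquiv.ofBijective g ⟨?_, ?_⟩)
  · rw [Module.finrank_prod] at h1
    change Module.finrank k _ = 2 * Module.finrank k _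
    omega
  · rw [injective_iff_map_eq_zero]
    rintro ⟨a, b⟩ hab
    obtain ⟨c, rfl⟩ := IsLocalRing.residue_surjective a
    obtain ⟨d, rfl⟩ := IsLocalRing.residue_surjective b
    rw [hg, Q.residue_eq_zero_iff] at hab
    obtain ⟨hc, hd⟩ := hi c d c.2 d.2 hab
    rw [(P.residue_eq_zero_iff c).2 hc, (P.residue_eq_zero_iff d).2 hd]
    rfl
  · intro b
    obtain ⟨z, rfl⟩ := IsLocalRing.residue_surjective b
    obtain ⟨c, d, hc, hd, h⟩ := hs z z.2
    refine ⟨(IsLocalRing.residue P.ring ⟨c, hc⟩, IsLocalRing.residue P.ring ⟨d, hd⟩), ?_⟩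
    rw [hg, eq_comm, ← sub_eq_zero, ← map_sub, Q.residue_eq_zero_iff]
    exact h

end ResidueMap

section QuadraticDegree

variable {k K F : Type*} [Field k] [Field K] [Field F] [Algebra k K] [Algebra k F] [Algebra K F]
  [IsScalarTower k K F] {σ : F ≃ₐ[K] F} {𝔓 : Place k F} {𝔭 : Place k K} {e : ℕ}

theorem HasRamificationIndex.degree_eq (h : HasRamificationIndex 𝔓 𝔭 e)
    (hs : ∀ z, 𝔓.v z ≤ 1 → ∃ c, 𝔓.v (z - algebraMap K F c) < 1) : 𝔓.degree = 𝔭.degree :=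
  Place.degree_eq_of_surjective (algebraMap K F)
    (fun c => (IsScalarTower.algebraMap_apply k K F c).symm) (fun z => (h.v_le_one_iff z).2)
    h.v_lt_one_iff (fun z => (h.v_le_one_iff z).1) hs

theorem HasRamificationIndex.degree_of_split (h2 : Module.finrank K F = 2) (hσ : σ ≠ 1)
    (h : HasRamificationIndex 𝔓 𝔭 e) (hs : 𝔓.conj σ ≠ 𝔓) : 𝔓.degree = 𝔭.degree :=
  h.degree_eq fun _ hz => LiesOver.exists_sub_lt_of_split h2 hσ hs hz

theorem HasRamificationIndex.degree_of_ramified (h2 : Module.finrank K F = 2)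
    (h : HasRamificationIndex 𝔓 𝔭 2) : 𝔓.degree = 𝔭.degree :=
  h.degree_eq fun _ hz => h.exists_sub_lt_of_ramified h2 hz

/-- An inert place has twice the degree of the place below: the residue field is generated by the
residue of an element `ω` that is not approximated by elements of `K`. -/
theorem HasRamificationIndex.degree_of_inert (h2 : Module.finrank K F = 2) (hσ : σ ≠ 1)
    (hpos : 0 < 𝔭.degree) (h : HasRamificationIndex 𝔓 𝔭 1) (hs : 𝔓.conj σ = 𝔓) :
    𝔓.degree = 2 * 𝔭.degree := by
  obtain ⟨ω, hω, hω'⟩ := h.exists_not_sub_lt h2 hσ hs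
  -- the valuation is the maximum of the valuations of the coordinates
  have hmax : ∀ c d : K, 𝔭.v d ≤ 𝔓.v (algebraMap K F c + algebraMap K F d * ω) := fun c d => by
    by_cases hd : d = 0
    · simp [hd]
    have hd' : algebraMap K F d ≠ 0 := by simpa using hd
    have h1 := hω' (-c / d)
    have h3 : algebraMap K F c + algebraMap K F d * ω
        = algebraMap K F d * (ω - algebraMap K F (-c / d)) := by
      rw [map_div₀, map_neg]; field_simp; ring
    rw [h3, map_mul, h.2, pow_one]
    exact le_mul_of_one_le_right' h1
  refine Place.degree_eq_two_mul hpos (algebraMap K F)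
    (fun c => (IsScalarTower.algebraMap_apply k K F c).symm) (fun z => (h.v_le_one_iff z).2)
    (fun z => (h.v_lt_one_iff z).2) ω hω (fun z hz => ?_) (fun c d hc hd hcd => ?_)
  · have hωK : ω ∉ Set.range (algebraMap K F) := by
      rintro ⟨c, rfl⟩
      have := hω' c
      rw [sub_self, map_zero] at this
      exact absurd zero_lt_one (not_lt.2 this)
    obtain ⟨c, d, rfl⟩ := exists_add_mul_of_finrank_two h2 hωK z
    have hd := (hmax c d).trans hz
    refine ⟨c, d, ?_, hd, by simp⟩
    rw [← h.v_le_one_iff]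
    have := 𝔓.v_sub_le_one hz (𝔓.v_mul_le_one ((h.v_le_one_iff d).2 hd) hω)
    rwa [add_sub_cancel_right] at this
  · have hd' := (hmax c d).trans_lt hcd
    refine ⟨?_, hd'⟩
    rw [← h.v_lt_one_iff]
    have h1 : 𝔓.v (algebraMap K F d * ω) < 1 := by
      rw [map_mul]
      exact mul_lt_one_of_nonneg_of_lt_one_left zero_le ((h.v_lt_one_iff d).2 hd') hω
    have := 𝔓.v_sub_lt_one hcd h1
    rwa [add_sub_cancel_right] at this

theorem Place.degree_conj (h2 : Module.finrank K F = 2) (hσ : σ ≠ 1) (𝔓 : Place k F) :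
    (𝔓.conj σ).degree = 𝔓.degree := by
  have hv : ∀ z, 𝔓.v (σ z) = (𝔓.conj σ).v z := fun z => (Place.conj_v h2 hσ 𝔓 z).symm
  refine (Place.degree_eq_of_surjective (P := 𝔓.conj σ) (Q := 𝔓) (σ : F →+* F) (fun c => ?_)
    (fun z hz => by rw [← hv] at hz; exact hz) (fun z => by rw [← hv]; rfl)
    (fun z hz => by rw [← hv]; exact hz)
    (fun z _ => ⟨σ z, by
      change 𝔓.v (z - σ (σ z)) < 1
      rw [CubicFunctionField.conj_conj h2 hσ]; simp⟩)).symm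
  rw [IsScalarTower.algebraMap_apply k K F]
  exact σ.commutes _

/-- `e f r = 2` for the places over `𝔭` in a quadratic extension. -/
theorem HasRamificationIndex.cases (h2 : Module.finrank K F = 2) (hσ : σ ≠ 1)
    (hpos : 0 < 𝔭.degree) (h : HasRamificationIndex 𝔓 𝔭 e) :
    (𝔓.conj σ ≠ 𝔓 ∧ e = 1 ∧ 𝔓.degree = 𝔭.degree) ∨
      (𝔓.conj σ = 𝔓 ∧ e = 2 ∧ 𝔓.degree = 𝔭.degree) ∨
      (𝔓.conj σ = 𝔓 ∧ e = 1 ∧ 𝔓.degree = 2 * 𝔭.degree) := by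
  have hfd : FiniteDimensional K F := FiniteDimensional.of_finrank_pos (by omega)
  by_cases hs : 𝔓.conj σ = 𝔓
  · have h1 := h.index_le_finrank
    have h3 := h.1
    rw [h2] at h1
    interval_cases e
    · exact Or.inr (Or.inr ⟨hs, rfl, h.degree_of_inert h2 hσ hpos hs⟩)
    · exact Or.inr (Or.inl ⟨hs, rfl, h.degree_of_ramified h2⟩)
  · exact Or.inl ⟨hs, h.eq_one_of_split h2 hσ hs, h.degree_of_split h2 hσ hs⟩

end QuadraticDegree

/-! ### Divisors -/

section Divisors

variable {k F : Type*} [Field k] [Field F] [Algebra k F]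

/-- The degree as a homomorphism. -/
noncomputable def Divisor.degreeHom : Divisor k F →+ ℤ :=
  Finsupp.liftAddHom fun P => AddMonoidHom.mulRight (P.degree : ℤ)

theorem Divisor.degree_add (D E : Divisor k F) :
    Divisor.degree (D + E) = Divisor.degree D + Divisor.degree E :=
  map_add Divisor.degreeHom D E

theorem Divisor.degree_sub (D E : Divisor k F) :
    Divisor.degree (D - E) = Divisor.degree D - Divisor.degree E :=
  map_sub Divisor.degreeHom D E

theorem Divisor.degree_neg (D : Divisor k F) : Divisor.degree (-D) = -Divisor.degree D :=
  map_neg Divisor.degreeHom D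

theorem Divisor.degree_zsmul (n : ℤ) (D : Divisor k F) :
    Divisor.degree (n • D) = n * Divisor.degree D :=
  (map_zsmul Divisor.degreeHom n D).trans (smul_eq_mul _ _)

theorem Divisor.degree_single (P : Place k F) (n : ℤ) :
    Divisor.degree (Finsupp.single P n) = n * P.degree :=
  Finsupp.sum_single_index (zero_mul _)

theorem Divisor.degree_zero : Divisor.degree (0 : Divisor k F) = 0 :=
  map_zero (Divisor.degreeHom (k := k) (F := F))

theorem Divisor.degree_sum {ι : Type*} (s : Finset ι) (D : ι → Divisor k F) :
    Divisor.degree (∑ i ∈ s, D i) = ∑ i ∈ s, Divisor.degree (D i) :=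
  map_sum Divisor.degreeHom D s

/-- `D` is the divisor of `z`. For `z = 0`, of order zero by convention, this means `D = 0`. -/
def IsDivisorOf (D : Divisor k F) (z : F) : Prop := ∀ P : Place k F, P.ord z = D P

theorem mem_riemannRochSpace_iff {D : Divisor k F} {z : F} (hz : z ≠ 0) :
    z ∈ riemannRochSpace D ↔ ∀ P : Place k F, -D P ≤ P.ord z :=
  forall_congr' fun P => P.v_le_exp_iff hz (D P)

end Divisors

section QuadraticDivisors

variable {k K F : Type*} [Field k] [Field K] [Field F] [Algebra k K] [Algebra k F] [Algebra K F]
  [IsScalarTower k K F] {σ : F ≃ₐ[K] F}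

/-- Conjugation as a permutation of the places. -/
noncomputable def conjEquiv (h2 : Module.finrank K F = 2) (hσ : σ ≠ 1) : Equiv.Perm (Place k F) :=
  Function.Involutive.toPerm (Place.conj σ) (Place.conj_conj h2 hσ)

/-- The conjugate of a divisor. -/
noncomputable def Divisor.conj (h2 : Module.finrank K F = 2) (hσ : σ ≠ 1) (D : Divisor k F) :
    Divisor k F :=
  Finsupp.equivMapDomain (conjEquiv h2 hσ) D

theorem Divisor.conj_apply (h2 : Module.finrank K F = 2) (hσ : σ ≠ 1) (D : Divisor k F)
    (P : Place k F) : Divisor.conj h2 hσ D P = D (P.conj σ) := rfl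

theorem Divisor.degree_conj (h2 : Module.finrank K F = 2) (hσ : σ ≠ 1) (D : Divisor k F) :
    Divisor.degree (Divisor.conj h2 hσ D) = Divisor.degree D := by
  have h : ∀ P : Place k F, (conjEquiv h2 hσ P).degree = P.degree := fun P =>
    Place.degree_conj h2 hσ P
  simp only [Divisor.degree, Divisor.conj, Finsupp.sum_equivMapDomain, h]

theorem IsDivisorOf.conj (h2 : Module.finrank K F = 2) (hσ : σ ≠ 1) {D : Divisor k F} {z : F}
    (h : IsDivisorOf D z) : IsDivisorOf (Divisor.conj h2 hσ D) (σ z) := fun P => by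
  rw [Divisor.conj_apply, ← h, Place.conj_ord h2 hσ]

theorem single_conj_apply (h2 : Module.finrank K F = 2) (hσ : σ ≠ 1) (P Q : Place k F) (n : ℤ) :
    Finsupp.single (P.conj σ) n Q = Finsupp.single P n (Q.conj σ) := by
  classical
  rw [Finsupp.single_apply, Finsupp.single_apply]
  congr 1
  rw [eq_iff_iff]
  constructor
  · rintro rfl; rw [Place.conj_conj h2 hσ]
  · rintro rfl; rw [Place.conj_conj h2 hσ]

theorem IsPullback.unique {η η' : Divisor k F} {𝔬 : Place k K} (h : IsPullback η 𝔬)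
    (h' : IsPullback η' 𝔬) : η = η' := by
  ext P
  by_cases hP : LiesOver P 𝔬
  · obtain ⟨e, he⟩ := hP
    rw [h.1 P e he, h'.1 P e he]
  · rw [h.2 P hP, h'.2 P hP]

theorem IsPullback.conj_apply (h2 : Module.finrank K F = 2) (hσ : σ ≠ 1) {η : Divisor k F}
    {𝔬 : Place k K} (h : IsPullback η 𝔬) (P : Place k F) : η (P.conj σ) = η P := by
  by_cases hP : LiesOver P 𝔬
  · obtain ⟨e, he⟩ := hP
    rw [h.1 P e he, h.1 _ e he.conj]
  · rw [h.2 P hP, h.2 _ fun hP' => hP (by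
      have := hP'.conj (σ := σ)
      rwa [Place.conj_conj h2 hσ] at this)]

/-- The pullback of a place exists, and has twice its degree, by `e f r = 2`. -/
theorem exists_isPullback (h2 : Module.finrank K F = 2) (hσ : σ ≠ 1) (𝔬 : Place k K)
    (hpos : 0 < 𝔬.degree) :
    ∃ η : Divisor k F, IsPullback η 𝔬 ∧ Divisor.degree η = 2 * 𝔬.degree := by
  classical
  have hfd : FiniteDimensional K F := FiniteDimensional.of_finrank_pos (by omega)
  have hgal := isGalois_of_finrank_two h2 hσ
  obtain ⟨𝔓, e, he⟩ := 𝔬.exists_liesOver (F := F)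
  have hover : ∀ 𝔔, LiesOver 𝔔 𝔬 → 𝔔 = 𝔓 ∨ 𝔔 = 𝔓.conj σ := fun 𝔔 h =>
    LiesOver.eq_or_eq_conj h2 hσ ⟨e, he⟩ h
  rcases he.cases h2 hσ hpos with ⟨hs, rfl, hdeg⟩ | hs
  · refine ⟨Finsupp.single 𝔓 1 + Finsupp.single (𝔓.conj σ) 1, ⟨fun 𝔔 d hd => ?_, fun 𝔔 h => ?_⟩, ?_⟩
    · rcases hover 𝔔 ⟨d, hd⟩ with rfl | rfl
      · rw [hd.index_eq he]; simp [hs]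
      · rw [hd.index_eq he.conj]; simp [hs.symm]
    · have h1 : 𝔔 ≠ 𝔓 := by rintro rfl; exact h ⟨1, he⟩
      have h3 : 𝔔 ≠ 𝔓.conj σ := by rintro rfl; exact h ⟨1, he.conj⟩
      simp [h1.symm, h3.symm]
    · rw [Divisor.degree_add, Divisor.degree_single, Divisor.degree_single,
        Place.degree_conj h2 hσ, hdeg]
      ring
  · have hs' : 𝔓.conj σ = 𝔓 ∧ e * 𝔓.degree = 2 * 𝔬.degree := by
      rcases hs with ⟨h1, rfl, h3⟩ | ⟨h1, rfl, h3⟩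
      · exact ⟨h1, by rw [h3]⟩
      · exact ⟨h1, by rw [h3]; ring⟩
    refine ⟨Finsupp.single 𝔓 e, ⟨fun 𝔔 d hd => ?_, fun 𝔔 h => ?_⟩, ?_⟩
    · have : 𝔔 = 𝔓 := by
        rcases hover 𝔔 ⟨d, hd⟩ with h | h
        · exact h
        · rw [h, hs'.1]
      subst this
      rw [hd.index_eq he]; simp
    · have h1 : 𝔔 ≠ 𝔓 := by rintro rfl; exact h ⟨e, he⟩
      simp [h1.symm]
    · rw [Divisor.degree_single]; exact_mod_cast hs'.2

theorem IsPullback.degree (h2 : Module.finrank K F = 2) (hσ : σ ≠ 1) {η : Divisor k F}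
    {𝔬 : Place k K} (hpos : 0 < 𝔬.degree) (h : IsPullback η 𝔬) :
    Divisor.degree η = 2 * 𝔬.degree := by
  obtain ⟨η', h', hd⟩ := exists_isPullback h2 hσ 𝔬 hpos
  rw [h.unique h', hd]

/-- The divisor in `F` of an element of `K` is the pullback of its divisor in `K`. -/
theorem exists_isDivisorOf_algebraMap (h2 : Module.finrank K F = 2) (hσ : σ ≠ 1)
    (hpos : ∀ 𝔭 : Place k K, 0 < 𝔭.degree) {E : Divisor k K} {c : K} (hE : IsDivisorOf E c)
    (hdeg : Divisor.degree E = 0) :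
    ∃ D : Divisor k F, IsDivisorOf D (algebraMap K F c) ∧ Divisor.degree D = 0 := by
  classical
  have hfd : FiniteDimensional K F := FiniteDimensional.of_finrank_pos (by omega)
  choose η hη hη' using fun 𝔭 => exists_isPullback (F := F) h2 hσ 𝔭 (hpos 𝔭)
  refine ⟨∑ 𝔭 ∈ E.support, E 𝔭 • η 𝔭, fun 𝔓 => ?_, ?_⟩
  · obtain ⟨𝔭, e, he⟩ := 𝔓.exists_restriction (K := K)
    rw [he.ord, hE]
    simp only [Finsupp.coe_finsetSum, Finset.sum_apply, Finsupp.smul_apply, smul_eq_mul]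
    rw [Finset.sum_eq_single 𝔭]
    · rw [(hη 𝔭).1 𝔓 e he, mul_comm]
    · intro 𝔮 _ hne
      rw [(hη 𝔮).2 𝔓 fun h => hne (h.place_eq ⟨e, he⟩), mul_zero]
    · intro h
      rw [Finsupp.notMem_support_iff.1 h, zero_mul]
  · rw [Divisor.degree_sum]
    simp only [Divisor.degree_zsmul, hη']
    have : Divisor.degree E = ∑ 𝔭 ∈ E.support, E 𝔭 * (𝔭.degree : ℤ) := rfl
    rw [hdeg] at this
    calc _ = 2 * ∑ 𝔭 ∈ E.support, E 𝔭 * (𝔭.degree : ℤ) := by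
            rw [Finset.mul_sum]; exact Finset.sum_congr rfl fun _ _ => by ring
      _ = 0 := by rw [← this, mul_zero]

/-- Principal divisors of a quadratic extension have degree zero, if those of `K` do. -/
theorem exists_isDivisorOf_of_quadratic (h2 : Module.finrank K F = 2) (hσ : σ ≠ 1)
    (hpos : ∀ 𝔭 : Place k K, 0 < 𝔭.degree)
    (hK : ∀ c : K, c ≠ 0 → ∃ E : Divisor k K, IsDivisorOf E c ∧ Divisor.degree E = 0)
    {z : F} (hz : z ≠ 0) : ∃ D : Divisor k F, IsDivisorOf D z ∧ Divisor.degree D = 0 := by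
  obtain ⟨n, hn⟩ := exists_norm h2 hσ z
  obtain ⟨t, ht⟩ := exists_trace h2 hσ z
  have hσz : σ z ≠ 0 := by simpa using hz
  have hn0 : n ≠ 0 := by
    rintro rfl
    rw [map_zero] at hn
    exact mul_ne_zero hz hσz hn.symm
  obtain ⟨E, hE, hE0⟩ := hK n hn0
  obtain ⟨N, hN, hN0⟩ := exists_isDivisorOf_algebraMap (F := F) h2 hσ hpos hE hE0
  -- where the norm of `z` is a unit, a zero or a pole of `z` makes a pole of the trace, so that `z`
  -- has finitely many zeros and poles
  have hfin : {P : Place k F | P.ord z ≠ 0}.Finite := by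
    have htfin : ∃ s : Set (Place k F), s.Finite ∧ ∀ P, P ∉ s → P.v (algebraMap K F t) ≤ 1 := by
      by_cases ht0 : t = 0
      · exact ⟨∅, Set.finite_empty, fun P _ => by simp [ht0]⟩
      obtain ⟨E', hE', hE0'⟩ := hK t ht0
      obtain ⟨M, hM, -⟩ := exists_isDivisorOf_algebraMap (F := F) h2 hσ hpos hE' hE0'
      refine ⟨_, M.hasFiniteSupport, fun P hP => ?_⟩
      rw [P.v_le_one_iff (by simpa using ht0), hM P]
      simp only [Function.mem_support, not_not] at hP
      omega
    obtain ⟨s, hs, hs'⟩ := htfin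
    refine (hs.union N.hasFiniteSupport).subset fun P hP => ?_
    by_contra hcon
    rw [Set.mem_union, not_or] at hcon
    have h1 : P.ord z + P.ord (σ z) = 0 := by
      rw [← P.ord_mul hz hσz, ← hn, hN P]
      simpa using hcon.2
    have h3 := hs' P hcon.1
    have h4 : ¬ (0 < P.ord z) ∧ ¬ (0 < P.ord (σ z)) := by
      rw [← P.v_lt_one_iff hz, ← P.v_lt_one_iff hσz]
      have hlt : ∀ a b : F, P.v (a + b) ≤ 1 → P.v a < 1 → P.v b ≤ 1 := fun a b hab ha => by
        have := P.v_sub_le_one hab ha.le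
        rwa [add_sub_cancel_left] at this
      rw [ht] at h3
      refine ⟨fun h => ?_, fun h => ?_⟩
      · have := hlt _ _ h3 h
        rw [P.v_le_one_iff hσz] at this
        rw [P.v_lt_one_iff hz] at h
        omega
      · rw [add_comm] at h3
        have := hlt _ _ h3 h
        rw [P.v_le_one_iff hz] at this
        rw [P.v_lt_one_iff hσz] at h
        omega
    have : P.ord z ≠ 0 := hP
    omega
  refine ⟨Finsupp.onFinset hfin.toFinset (fun P => P.ord z) (by simp), fun P => rfl, ?_⟩
  set D : Divisor k F := Finsupp.onFinset hfin.toFinset (fun P => P.ord z) (by simp) with hD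
  have hDz : IsDivisorOf D z := fun P => rfl
  -- `D` and its conjugate have the same degree, and their sum is the divisor of the norm
  have hsum : D + Divisor.conj h2 hσ D = N := by
    ext P
    rw [Finsupp.add_apply, ← hDz, ← hDz.conj h2 hσ, ← hN, hn, P.ord_mul hz hσz]
  have := Divisor.degree_add D (Divisor.conj h2 hσ D)
  rw [hsum, hN0, Divisor.degree_conj] at this
  omega

end QuadraticDivisors

/-! ### Places of the rational function field -/

section Rational

open Polynomial

variable {k K : Type*} [Field k] [Field K] [Algebra k K] {x : K}

instance Place.isScalarTower_ring (P : Place k K) : IsScalarTower k P.ring K :=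
  IsScalarTower.of_algebraMap_eq fun _ => rfl

/-- The elements of `k(x)` are reduced fractions of polynomials in `x`. -/
theorem exists_eq_div (htop : IntermediateField.adjoin k {x} = ⊤) (z : K) :
    ∃ A B : k[X], IsCoprime A B ∧ aeval x B ≠ 0 ∧ z = aeval x A / aeval x B := by
  have hz : z ∈ IntermediateField.adjoin k {x} := by rw [htop]; trivial
  obtain ⟨A, B, rfl⟩ := (IntermediateField.mem_adjoin_simple_iff k z).1 hz
  by_cases hB : aeval x B = 0
  · exact ⟨0, 1, isCoprime_zero_left.2 isUnit_one, by simp, by simp [hB]⟩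
  have hB0 : B ≠ 0 := by rintro rfl; simp at hB
  obtain ⟨A', B', d, hcop, rfl, rfl⟩ := UniqueFactorizationMonoid.exists_reduced_factors' A B hB0
  rw [map_mul] at hB
  refine ⟨A', B', hcop.isCoprime, right_ne_zero_of_mul hB, ?_⟩
  rw [map_mul, map_mul, mul_div_mul_left _ _ (left_ne_zero_of_mul hB)]

theorem Place.v_aeval_le_one (P : Place k K) (h : P.v x ≤ 1) (A : k[X]) : P.v (aeval x A) ≤ 1 := by
  have : aeval x A = ((aeval (⟨x, h⟩ : P.ring) A : P.ring) : K) :=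
    (aeval_algebraMap_apply K (⟨x, h⟩ : P.ring) A).trans rfl
  rw [this]
  exact (aeval (⟨x, h⟩ : P.ring) A).2

/-- At a place where `p` vanishes, polynomials prime to `p` are units. -/
theorem Place.v_aeval_eq_one (P : Place k K) (h : P.v x ≤ 1) {p A : k[X]}
    (hp : P.v (aeval x p) < 1) (hA : IsCoprime A p) : P.v (aeval x A) = 1 := by
  obtain ⟨a, b, hab⟩ := hA
  refine le_antisymm (P.v_aeval_le_one h A) (not_lt.1 fun hlt => ?_)
  have h1 : P.v (aeval x (a * A + b * p)) < 1 := by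
    rw [map_add, map_mul, map_mul]
    refine P.v_add_lt_one ?_ ?_ <;> rw [map_mul]
    · exact mul_lt_one_of_nonneg_of_lt_one_right (P.v_aeval_le_one h a) zero_le hlt
    · exact mul_lt_one_of_nonneg_of_lt_one_right (P.v_aeval_le_one h b) zero_le hp
  rw [hab, map_one, map_one] at h1
  exact lt_irrefl _ h1

/-- An irreducible polynomial vanishes at no more than one place where `x` is finite. -/
theorem Place.eq_of_aeval_lt_one (htop : IntermediateField.adjoin k {x} = ⊤) {p : k[X]}
    (hp : Irreducible p) {P Q : Place k K} (hP : P.v x ≤ 1) (hQ : Q.v x ≤ 1)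
    (hPp : P.v (aeval x p) < 1) (hQp : Q.v (aeval x p) < 1) : P = Q := by
  refine Place.eq_of_le fun z hz => ?_
  obtain ⟨A, B, hAB, hB0, rfl⟩ := exists_eq_div htop z
  by_cases hpB : p ∣ B
  · have hA : P.v (aeval x A) = 1 := P.v_aeval_eq_one hP hPp (hAB.of_isCoprime_of_dvd_right hpB)
    have hB : P.v (aeval x B) < 1 := by
      obtain ⟨C, rfl⟩ := hpB
      rw [map_mul, map_mul]
      exact mul_lt_one_of_nonneg_of_lt_one_left zero_le hPp (P.v_aeval_le_one hP C)
    rw [map_div₀, hA, one_div] at hz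
    exact absurd hz (not_le.2 ((one_lt_inv₀ (zero_lt_iff.2
      ((Valuation.ne_zero_iff _).2 hB0))).2 hB))
  · have hB : Q.v (aeval x B) = 1 :=
      Q.v_aeval_eq_one hQ hQp ((hp.coprime_iff_not_dvd.2 hpB).symm)
    rw [map_div₀, hB, div_one]
    exact Q.v_aeval_le_one hQ A

/-- The residue field at the place of an irreducible polynomial `p` is `k[x] / (p)`. -/
theorem Place.degree_of_aeval_lt_one
    (htop : IntermediateField.adjoin k {x} = ⊤) {p : k[X]}
    (hp : Irreducible p) {P : Place k K} (hP : P.v x ≤ 1) (hPp : P.v (aeval x p) < 1) :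
    P.degree = p.natDegree := by
  let f : k[X] →ₐ[k] IsLocalRing.ResidueField P.ring :=
    aeval (IsLocalRing.residue P.ring ⟨x, hP⟩)
  have hf : ∀ A, f A = IsLocalRing.residue P.ring ⟨aeval x A, P.v_aeval_le_one hP A⟩ := fun A => by
    have h1 := aeval_algebraMap_apply (IsLocalRing.ResidueField P.ring) (⟨x, hP⟩ : P.ring) A
    refine h1.trans (congrArg _ (Subtype.ext ?_))
    exact (aeval_algebraMap_apply K (⟨x, hP⟩ : P.ring) A).symm
  have hf0 : ∀ A, f A = 0 ↔ P.v (aeval x A) < 1 := fun A => by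
    rw [hf, P.residue_eq_zero_iff]
  have hsurj : Function.Surjective f := fun b => by
    obtain ⟨z, rfl⟩ := IsLocalRing.residue_surjective b
    obtain ⟨A, B, hAB, hB0, hz⟩ := exists_eq_div htop (z : K)
    have hpB : ¬ p ∣ B := fun hpB => by
      have hA : P.v (aeval x A) = 1 := P.v_aeval_eq_one hP hPp (hAB.of_isCoprime_of_dvd_right hpB)
      have hB : P.v (aeval x B) < 1 := by
        obtain ⟨C, rfl⟩ := hpB
        rw [map_mul, map_mul]
        exact mul_lt_one_of_nonneg_of_lt_one_left zero_le hPp (P.v_aeval_le_one hP C)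
      have hz1 : P.v (z : K) ≤ 1 := z.2
      rw [hz, map_div₀, hA, one_div] at hz1
      exact absurd hz1 (not_le.2 ((one_lt_inv₀ (zero_lt_iff.2
        ((Valuation.ne_zero_iff _).2 hB0))).2 hB))
    -- an inverse of `B` modulo `p`
    obtain ⟨a, b, hab⟩ := (hp.coprime_iff_not_dvd.2 hpB).symm
    refine ⟨A * a, ?_⟩
    rw [hf, ← sub_eq_zero, ← map_sub, P.residue_eq_zero_iff]
    have h1 : aeval x a * aeval x B + aeval x b * aeval x p = 1 := by
      rw [← map_mul, ← map_mul, ← map_add, hab, map_one]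
    have h2 : aeval x (A * a) - (z : K) = -((z : K) * (aeval x b * aeval x p)) := by
      rw [hz, map_mul]
      field_simp
      linear_combination aeval x A * h1
    change P.v (aeval x (A * a) - (z : K)) < 1
    rw [h2, Valuation.map_neg, map_mul, map_mul]
    exact mul_lt_one_of_nonneg_of_lt_one_right z.2 zero_le
      (mul_lt_one_of_nonneg_of_lt_one_right (P.v_aeval_le_one hP b) zero_le hPp)
  have hker : RingHom.ker f = Ideal.span {p} := by
    ext A
    rw [RingHom.mem_ker, hf0, Ideal.mem_span_singleton]
    refine ⟨fun h => ?_, ?_⟩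
    · by_contra hpA
      rw [P.v_aeval_eq_one hP hPp (hp.coprime_iff_not_dvd.2 hpA).symm] at h
      exact lt_irrefl _ h
    · rintro ⟨C, rfl⟩
      rw [map_mul, map_mul]
      exact mul_lt_one_of_nonneg_of_lt_one_left zero_le hPp (P.v_aeval_le_one hP C)
  have h1 := LinearEquiv.finrank_eq
    (Ideal.quotientKerAlgEquivOfSurjective hsurj).toLinearEquiv
  have h2 := LinearEquiv.finrank_eq (Ideal.quotientEquivAlgOfEq k hker).toLinearEquiv
  rw [Place.degree, ← h1, h2]
  exact finrank_quotient_span_eq_natDegree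

/-- The place of an irreducible polynomial. -/
theorem exists_place (hx : Transcendental k x) (htop : IntermediateField.adjoin k {x} = ⊤)
    {p : k[X]} (hp : Irreducible p) :
    ∃ P : Place k K, P.v x ≤ 1 ∧ P.ord (aeval x p) = 1 := by
  let : Algebra k[X] K := (aeval x).toAlgebra
  have hmap : ∀ A : k[X], algebraMap k[X] K A = aeval x A := fun A => rfl
  have hfaith : FaithfulSMul k[X] K :=
    (faithfulSMul_iff_algebraMap_injective _ _).2 (transcendental_iff_injective.1 hx)
  have : IsFractionRing k[X] K := IsFractionRing.of_field _ _ fun z => by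
    obtain ⟨A, B, -, -, h⟩ := exists_eq_div htop z
    exact ⟨A, B, h⟩
  let V : IsDedekindDomain.HeightOneSpectrum k[X] :=
    ⟨Ideal.span {p}, (Ideal.span_singleton_prime hp.ne_zero).2 hp.prime, by
      rw [Ne, Ideal.span_singleton_eq_bot]; exact hp.ne_zero⟩
  refine ⟨⟨V.valuation K, V.valuation_surjective K, fun c hc => ?_⟩, ?_, ?_⟩
  · have h1 : algebraMap k K c = algebraMap k[X] K (C c) := by rw [hmap, aeval_C]
    rw [h1, IsDedekindDomain.HeightOneSpectrum.valuation_eq_one_iff_notMem]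
    intro hmem
    exact hp.not_isUnit (isUnit_of_dvd_unit (Ideal.mem_span_singleton.1 hmem)
      (isUnit_C.2 (isUnit_iff_ne_zero.2 hc)))
  · have h1 : x = algebraMap k[X] K X := by rw [hmap, aeval_X]
    change V.valuation K x ≤ 1
    rw [h1]
    exact V.valuation_le_one X
  · have h1 : V.valuation K (algebraMap k[X] K p) = WithZero.exp (-1 : ℤ) := by
      rw [IsDedekindDomain.HeightOneSpectrum.valuation_of_algebraMap]
      exact V.intValuation_singleton hp.ne_zero rfl
    exact Place.ord_eq_of_v (k := k) ⟨V.valuation K, _, _⟩ h1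

/-- Every place at which `x` is finite belongs to an irreducible polynomial. -/
theorem Place.exists_irreducible (htop : IntermediateField.adjoin k {x} = ⊤)
    (P : Place k K) (hP : P.v x ≤ 1) : ∃ p : k[X], Irreducible p ∧ P.v (aeval x p) < 1 := by
  let I : Ideal k[X] := (IsLocalRing.maximalIdeal P.ring).comap
    (aeval (⟨x, hP⟩ : P.ring) : k[X] →ₐ[k] P.ring)
  have hI : ∀ A, A ∈ I ↔ P.v (aeval x A) < 1 := fun A => by
    rw [Ideal.mem_comap]
    refine (Valuation.mem_maximalIdeal_iff _ _).trans ?_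
    rw [show aeval x A = ((aeval (⟨x, hP⟩ : P.ring) A : P.ring) : K) from
      aeval_algebraMap_apply K (⟨x, hP⟩ : P.ring) A]
  have hprime : I.IsPrime := Ideal.IsPrime.comap _
  obtain ⟨t, ht0, ht⟩ := P.exists_uniformizer
  obtain ⟨A, B, -, hB0, rfl⟩ := exists_eq_div htop t
  have hA0 : aeval x A ≠ 0 := fun h => ht0 (by rw [h, zero_div])
  have hAI : A ∈ I := by
    rw [hI, P.v_lt_one_iff hA0]
    have h1 := (P.v_le_one_iff hB0).1 (P.v_aeval_le_one hP B)
    rw [P.ord_div hA0 hB0] at ht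
    omega
  have hbot : I ≠ ⊥ := fun h => by
    rw [h, Ideal.mem_bot] at hAI
    exact hA0 (by rw [hAI, map_zero])
  refine ⟨Submodule.IsPrincipal.generator I,
    (Submodule.IsPrincipal.prime_generator_of_isPrime I hbot).irreducible, ?_⟩
  rw [← hI]
  exact Submodule.IsPrincipal.generator_mem I

theorem adjoin_inv_eq_top (htop : IntermediateField.adjoin k {x} = ⊤) :
    IntermediateField.adjoin k {x⁻¹} = ⊤ := by
  rw [eq_top_iff, ← htop, IntermediateField.adjoin_simple_le_iff]
  have := IntermediateField.mem_adjoin_simple_self k x⁻¹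
  simpa using inv_mem this

theorem transcendental_inv (hx : Transcendental k x) : Transcendental k x⁻¹ :=
  fun h => hx (IsAlgebraic.inv_iff.1 h)

/-- The infinite place, the only pole of `x`. -/
theorem exists_place_infinity (hx : Transcendental k x)
    (htop : IntermediateField.adjoin k {x} = ⊤) :
    ∃ P : Place k K, P.ord x = -1 ∧ P.degree = 1 ∧ ∀ Q : Place k K, 1 < Q.v x → Q = P := by
  obtain ⟨P, hP, hP'⟩ := exists_place (transcendental_inv hx) (adjoin_inv_eq_top htop)
    (p := X) irreducible_X
  have hx0 : x ≠ 0 := by rintro rfl; exact hx (isAlgebraic_zero)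
  rw [aeval_X] at hP'
  have hlt : P.v (aeval x⁻¹ (X : k[X])) < 1 := by
    rw [aeval_X, P.v_lt_one_iff (inv_ne_zero hx0), hP']; omega
  refine ⟨P, by rw [P.ord_inv] at hP'; omega, ?_, fun Q hQ => ?_⟩
  · rw [Place.degree_of_aeval_lt_one (adjoin_inv_eq_top htop)
      irreducible_X hP hlt, natDegree_X]
  · have hQ' : Q.v x⁻¹ < 1 := by rw [map_inv₀]; exact inv_lt_one_of_one_lt₀ hQ
    exact Place.eq_of_aeval_lt_one (adjoin_inv_eq_top htop) irreducible_X hQ'.le hP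
      (by rwa [aeval_X]) hlt

theorem Place.degree_pos (hx : Transcendental k x) (htop : IntermediateField.adjoin k {x} = ⊤)
    (P : Place k K) : 0 < P.degree := by
  by_cases hP : P.v x ≤ 1
  · obtain ⟨p, hp, hlt⟩ := P.exists_irreducible htop hP
    rw [Place.degree_of_aeval_lt_one htop hp hP hlt]
    exact hp.natDegree_pos
  · obtain ⟨Q, -, hQ, h⟩ := exists_place_infinity hx htop
    rw [h P (not_le.1 hP), hQ]; exact one_pos

/-- At the pole of `x`, the leading term of a polynomial dominates. -/
theorem Place.ord_aeval_of_one_lt (P : Place k K) (hP : 1 < P.v x) {A : k[X]} (hA : A ≠ 0) :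
    aeval x A ≠ 0 ∧ P.ord (aeval x A) = A.natDegree * P.ord x := by
  have hx0 : x ≠ 0 := by rintro rfl; simp at hP
  have hordx : P.ord x < 0 := by
    by_contra! h
    exact absurd hP (not_lt.2 ((P.v_le_one_iff hx0).2 h))
  suffices H : ∀ n, ∀ A : k[X], A ≠ 0 → A.natDegree = n →
      aeval x A ≠ 0 ∧ P.ord (aeval x A) = A.natDegree * P.ord x from H _ A hA rfl
  intro n
  induction n with
  | zero =>
    intro A hA hn
    rw [natDegree_eq_zero] at hn
    obtain ⟨c, rfl⟩ := hn
    have hc : c ≠ 0 := by rintro rfl; simp at hA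
    rw [aeval_C, P.ord_const hc]
    simpa using hc
  | succ n ih =>
    intro A hA hn
    have hn' : A.divX.natDegree = n := by rw [natDegree_divX_eq_natDegree_tsub_one, hn]; rfl
    have hdiv : A.divX ≠ 0 := by
      intro h
      rw [divX_eq_zero_iff] at h
      rw [h, natDegree_C] at hn
      omega
    obtain ⟨h0, h1⟩ := ih _ hdiv hn'
    have h2 : aeval x A = aeval x A.divX * x + algebraMap k K (A.coeff 0) := by
      conv_lhs => rw [← divX_mul_X_add A]
      simp
    have hm0 : aeval x A.divX * x ≠ 0 := mul_ne_zero h0 hx0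
    have hm : P.ord (aeval x A.divX * x) = (n + 1) * P.ord x := by
      rw [P.ord_mul h0 hx0, h1, hn']; ring
    have hv : P.v (aeval x A) = P.v (aeval x A.divX * x) := by
      rw [h2]
      refine Valuation.map_add_eq_of_lt_left _ ((P.v_algebraMap_le_one _).trans_lt ?_)
      rw [← not_le, P.v_le_one_iff hm0, hm]
      nlinarith
    have hA0 : aeval x A ≠ 0 := by
      intro h; rw [h, map_zero] at hv
      exact hm0 ((Valuation.zero_iff _).1 hv.symm)
    refine ⟨hA0, ?_⟩
    have : P.ord (aeval x A) = P.ord (aeval x A.divX * x) := by simp only [Place.ord, hv]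
    rw [this, hm, hn]
    push_cast; ring

/-- Principal divisors of the rational function field have degree zero: an irreducible polynomial
`p` has divisor `P - deg(p) ∞`. -/
theorem exists_isDivisorOf_of_rational (hx : Transcendental k x)
    (htop : IntermediateField.adjoin k {x} = ⊤) {z : K} (hz : z ≠ 0) :
    ∃ D : Divisor k K, IsDivisorOf D z ∧ Divisor.degree D = 0 := by
  classical
  have hinj : ∀ A : k[X], A ≠ 0 → aeval x A ≠ 0 := fun A hA h =>
    hA (transcendental_iff_injective.1 hx (by rw [h, map_zero]))
  have hpoly : ∀ A : k[X], A ≠ 0 →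
      ∃ D : Divisor k K, IsDivisorOf D (aeval x A) ∧ Divisor.degree D = 0 := by
    intro A
    induction A using UniqueFactorizationMonoid.induction_on_prime with
    | h₁ => intro h; exact absurd rfl h
    | h₂ A hA =>
      intro _
      obtain ⟨c, hc, rfl⟩ := isUnit_iff.1 hA
      exact ⟨0, fun P => by rw [aeval_C, P.ord_const hc.ne_zero]; rfl, Divisor.degree_zero⟩
    | h₃ A p hA hp ih =>
      intro _
      obtain ⟨D, hD, hD0⟩ := ih hA
      obtain ⟨P, hP, hP1⟩ := exists_place hx htop hp.irreducible
      obtain ⟨Q, hQ, hQ1, hQ2⟩ := exists_place_infinity hx htop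
      have hp0 := hinj p hp.ne_zero
      have hx0 : x ≠ 0 := by rintro rfl; exact hx isAlgebraic_zero
      have hPlt : P.v (aeval x p) < 1 := (P.v_lt_one_iff hp0).2 (by omega)
      have hPQ : P ≠ Q := by
        rintro rfl
        rw [P.v_le_one_iff hx0] at hP
        omega
      refine ⟨(Finsupp.single P 1 - Finsupp.single Q (p.natDegree : ℤ)) + D, fun R => ?_, ?_⟩
      · rw [map_mul, R.ord_mul hp0 (hinj A hA), hD R, Finsupp.add_apply, Finsupp.sub_apply]
        congr 1
        by_cases hR : R.v x ≤ 1
        · have hRQ : R ≠ Q := by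
            rintro rfl
            rw [R.v_le_one_iff hx0] at hR
            omega
          rw [Finsupp.single_eq_of_ne hRQ, sub_zero]
          by_cases hRp : R.v (aeval x p) < 1
          · rw [Place.eq_of_aeval_lt_one htop hp.irreducible hR hP hRp hPlt, hP1,
              Finsupp.single_eq_same]
          · have hRP : R ≠ P := by rintro rfl; exact hRp hPlt
            rw [Finsupp.single_eq_of_ne hRP, ← R.v_eq_one_iff hp0]
            exact le_antisymm (R.v_aeval_le_one hR p) (not_lt.1 hRp)
        · have hRQ := hQ2 R (not_le.1 hR)
          rw [(R.ord_aeval_of_one_lt (not_le.1 hR) hp.ne_zero).2]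
          subst hRQ
          rw [hQ, Finsupp.single_eq_of_ne hPQ.symm, Finsupp.single_eq_same]
          ring
      · rw [Divisor.degree_add, Divisor.degree_sub, Divisor.degree_single, Divisor.degree_single,
          hD0, hQ1, Place.degree_of_aeval_lt_one htop hp.irreducible hP hPlt]
        ring
  obtain ⟨A, B, -, hB0, rfl⟩ := exists_eq_div htop z
  have hA0 : aeval x A ≠ 0 := fun h => hz (by rw [h, zero_div])
  obtain ⟨D, hD, hD0⟩ := hpoly A (by rintro rfl; simp at hA0)
  obtain ⟨E, hE, hE0⟩ := hpoly B (by rintro rfl; simp at hB0)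
  exact ⟨D - E, fun P => by rw [P.ord_div hA0 hB0, hD, hE]; rfl, by
    rw [Divisor.degree_sub, hD0, hE0, sub_self]⟩

/-- A function that is finite wherever `x` is, is a polynomial in `x`. -/
theorem exists_eq_aeval (hx : Transcendental k x) (htop : IntermediateField.adjoin k {x} = ⊤)
    {z : K} (h : ∀ P : Place k K, P.v x ≤ 1 → P.v z ≤ 1) : ∃ A : k[X], z = aeval x A := by
  obtain ⟨A, B, hAB, hB0, rfl⟩ := exists_eq_div htop z
  by_cases hB : IsUnit B
  · obtain ⟨c, hc, rfl⟩ := isUnit_iff.1 hB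
    refine ⟨C c⁻¹ * A, ?_⟩
    rw [map_mul, aeval_C, aeval_C, map_inv₀, div_eq_mul_inv, mul_comm]
  · have hBne : B ≠ 0 := by rintro rfl; simp at hB0
    -- an irreducible factor of the denominator gives a pole
    obtain ⟨p, hp, hpB⟩ := WfDvdMonoid.exists_irreducible_factor hB hBne
    obtain ⟨P, hP, hP1⟩ := exists_place hx htop hp
    have hp0 : aeval x p ≠ 0 := by intro h0; rw [h0, P.ord_zero] at hP1; omega
    have hPlt : P.v (aeval x p) < 1 := (P.v_lt_one_iff hp0).2 (by omega)
    have hA : P.v (aeval x A) = 1 := P.v_aeval_eq_one hP hPlt (hAB.of_isCoprime_of_dvd_right hpB)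
    have hB' : P.v (aeval x B) < 1 := by
      obtain ⟨C, rfl⟩ := hpB
      rw [map_mul, map_mul]
      exact mul_lt_one_of_nonneg_of_lt_one_left zero_le hPlt (P.v_aeval_le_one hP C)
    have := h P hP
    rw [map_div₀, hA, one_div] at this
    exact absurd this (not_le.2 ((one_lt_inv₀ (zero_lt_iff.2
      ((Valuation.ne_zero_iff _).2 hB0))).2 hB'))

/-- A function whose only pole is that of `x`, of order at most `n`, is a polynomial in `x` of
degree at most `n`. -/
theorem exists_eq_aeval_natDegree_le (hx : Transcendental k x)
    (htop : IntermediateField.adjoin k {x} = ⊤) {z : K} {n : ℕ}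
    (h : ∀ P : Place k K, P.v x ≤ 1 → P.v z ≤ 1)
    (h' : ∀ P : Place k K, 1 < P.v x → P.v z ≤ WithZero.exp (n : ℤ)) :
    ∃ A : k[X], z = aeval x A ∧ A.natDegree ≤ n := by
  obtain ⟨A, rfl⟩ := exists_eq_aeval hx htop h
  refine ⟨A, rfl, ?_⟩
  by_cases hA : A = 0
  · simp [hA]
  obtain ⟨P, hP, -, -⟩ := exists_place_infinity hx htop
  have hx0 : x ≠ 0 := by rintro rfl; exact hx isAlgebraic_zero
  have h1 : 1 < P.v x := by rw [← not_le, P.v_le_one_iff hx0]; omega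
  obtain ⟨h2, h3⟩ := P.ord_aeval_of_one_lt h1 hA
  have := h' P h1
  rw [P.v_le_exp_iff h2, h3, hP] at this
  omega

/-- Functions of `k(x)` without poles are constant. -/
theorem exists_eq_algebraMap_of_forall_v_le_one (hx : Transcendental k x)
    (htop : IntermediateField.adjoin k {x} = ⊤) {z : K} (h : ∀ P : Place k K, P.v z ≤ 1) :
    ∃ c : k, algebraMap k K c = z := by
  obtain ⟨A, rfl, hA⟩ := exists_eq_aeval_natDegree_le hx htop (n := 0) (fun P _ => h P)
    (fun P _ => by simpa using h P)
  obtain ⟨c, rfl⟩ := natDegree_eq_zero.1 (Nat.le_zero.1 hA)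
  exact ⟨c, by rw [aeval_C]⟩

/-- `k` is algebraically closed in the rational function field. -/
theorem exists_eq_algebraMap_of_isAlgebraic (hx : Transcendental k x)
    (htop : IntermediateField.adjoin k {x} = ⊤) {z : K} (h : IsAlgebraic k z) :
    ∃ c : k, algebraMap k K c = z :=
  exists_eq_algebraMap_of_forall_v_le_one hx htop fun P => by
    by_cases hz : z = 0
    · simp [hz]
    · exact (P.v_eq_one_of_isAlgebraic hz h).le

end Rational

/-! ### Constants and the genus -/

section Constants

variable {k K F : Type*} [Field k] [Field K] [Field F] [Algebra k K] [Algebra k F] [Algebra K F]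
  [IsScalarTower k K F] {σ : F ≃ₐ[K] F} {x : K}

theorem degree_pos_of_quadratic (h2 : Module.finrank K F = 2) (hσ : σ ≠ 1)
    (hx : Transcendental k x) (htop : IntermediateField.adjoin k {x} = ⊤) (P : Place k F) :
    0 < P.degree := by
  have hfd : FiniteDimensional K F := FiniteDimensional.of_finrank_pos (by omega)
  obtain ⟨𝔭, e, he⟩ := P.exists_restriction (K := K)
  have h := 𝔭.degree_pos hx htop
  rcases he.cases h2 hσ h with h' | h' | h' <;> omega

theorem exists_isDivisorOf (h2 : Module.finrank K F = 2) (hσ : σ ≠ 1)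
    (hx : Transcendental k x) (htop : IntermediateField.adjoin k {x} = ⊤) {z : F} (hz : z ≠ 0) :
    ∃ D : Divisor k F, IsDivisorOf D z ∧ Divisor.degree D = 0 :=
  exists_isDivisorOf_of_quadratic h2 hσ (Place.degree_pos hx htop)
    (fun _ hc => exists_isDivisorOf_of_rational hx htop hc) hz

/-- A nonzero element of `𝓛(-D)` has divisor `D` if `D` has degree zero. -/
theorem isDivisorOf_of_mem (h2 : Module.finrank K F = 2) (hσ : σ ≠ 1)
    (hx : Transcendental k x) (htop : IntermediateField.adjoin k {x} = ⊤) {D : Divisor k F}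
    (hD : Divisor.degree D = 0) {z : F} (hz : z ≠ 0) (hmem : z ∈ riemannRochSpace (-D)) :
    IsDivisorOf D z := by
  obtain ⟨E, hE, hE0⟩ := exists_isDivisorOf h2 hσ hx htop hz
  rw [mem_riemannRochSpace_iff hz] at hmem
  have hle : ∀ P, 0 ≤ (E - D) P := fun P => by
    have := hmem P
    rw [hE P] at this
    simp only [Finsupp.neg_apply, neg_neg] at this
    simp only [Finsupp.sub_apply]
    omega
  have hdeg : Divisor.degree (E - D) = 0 := by rw [Divisor.degree_sub, hE0, hD, sub_self]
  have h0 := (Finset.sum_eq_zero_iff_of_nonneg (s := (E - D).support)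
    (f := fun P => (E - D) P * (P.degree : ℤ))
    (fun P _ => mul_nonneg (hle P) (by positivity))).1 hdeg
  intro P
  rw [hE P]
  have : (E - D) P = 0 := by
    by_contra hne
    have h1 := h0 P (Finsupp.mem_support_iff.2 hne)
    have h3 := degree_pos_of_quadratic h2 hσ hx htop P
    rcases mul_eq_zero.1 h1 with h | h
    · exact hne h
    · omega
  simpa [sub_eq_zero] using this

theorem v_conj_le_one_of_forall (h2 : Module.finrank K F = 2) (hσ : σ ≠ 1) {z : F}
    (h : ∀ P : Place k F, P.v z ≤ 1) (P : Place k F) : P.v (σ z) ≤ 1 := by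
  rw [← Place.conj_v h2 hσ]; exact h _

/-- Functions without poles are constants. -/
theorem isAlgebraic_of_forall_v_le_one (h2 : Module.finrank K F = 2) (hσ : σ ≠ 1)
    (hx : Transcendental k x) (htop : IntermediateField.adjoin k {x} = ⊤) {z : F}
    (h : ∀ P : Place k F, P.v z ≤ 1) : IsAlgebraic k z := by
  have hfd : FiniteDimensional K F := FiniteDimensional.of_finrank_pos (by omega)
  have hgal := isGalois_of_finrank_two h2 hσ
  obtain ⟨t, ht⟩ := exists_trace h2 hσ z
  obtain ⟨n, hn⟩ := exists_norm h2 hσ z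
  have hconst : ∀ c : K, (∀ P : Place k F, P.v (algebraMap K F c) ≤ 1) →
      ∃ a : k, algebraMap k K a = c := fun c hc =>
    exists_eq_algebraMap_of_forall_v_le_one hx htop fun 𝔭 => by
      obtain ⟨𝔓, e, he⟩ := 𝔭.exists_liesOver (F := F)
      exact (he.v_le_one_iff c).1 (hc 𝔓)
  obtain ⟨t', rfl⟩ := hconst t fun P => by
    rw [ht]; exact P.v_add_le_one (h P) (v_conj_le_one_of_forall h2 hσ h P)
  obtain ⟨n', rfl⟩ := hconst n fun P => by
    rw [hn]; exact P.v_mul_le_one (h P) (v_conj_le_one_of_forall h2 hσ h P)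
  rw [← IsScalarTower.algebraMap_apply] at ht hn
  have hmonic : (Polynomial.X ^ 2 - Polynomial.C t' * Polynomial.X
      + Polynomial.C n' : k[X]).Monic := by monicity!
  refine IsIntegral.isAlgebraic ⟨_, hmonic, ?_⟩
  simp only [Polynomial.eval₂_add, Polynomial.eval₂_sub, Polynomial.eval₂_mul,
    Polynomial.eval₂_pow, Polynomial.eval₂_X, Polynomial.eval₂_C, ht, hn]
  ring

/-- The constants of `F` fixed by the conjugation are those of `K`. -/
theorem exists_eq_algebraMap_of_isAlgebraic_of_fixed (h2 : Module.finrank K F = 2) (hσ : σ ≠ 1)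
    (hx : Transcendental k x) (htop : IntermediateField.adjoin k {x} = ⊤) {z : F}
    (h : IsAlgebraic k z) (hz : σ z = z) : ∃ a : k, algebraMap k F a = z := by
  obtain ⟨c, rfl⟩ := exists_eq_algebraMap_of_fixed h2 hσ hz
  obtain ⟨a, rfl⟩ := exists_eq_algebraMap_of_isAlgebraic hx htop
    ((isAlgebraic_algebraMap_iff (FaithfulSMul.algebraMap_injective K F)).1 h)
  exact ⟨a, IsScalarTower.algebraMap_apply k K F a⟩

theorem isAlgebraic_conj {z : F} (h : IsAlgebraic k z) : IsAlgebraic k (σ z) :=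
  h.algHom (σ.restrictScalars k : F →ₐ[k] F)

/-- The field of constants has degree one over `k` if the conjugation fixes all constants. -/
theorem finrank_constants_of_fixed (h2 : Module.finrank K F = 2) (hσ : σ ≠ 1)
    (hx : Transcendental k x) (htop : IntermediateField.adjoin k {x} = ⊤)
    (h : ∀ z : F, IsAlgebraic k z → σ z = z) :
    Module.finrank k (algebraicClosure k F) = 1 := by
  have : algebraicClosure k F = ⊥ := by
    rw [eq_bot_iff]
    intro z hz
    rw [mem_algebraicClosure_iff] at hz
    obtain ⟨a, rfl⟩ := exists_eq_algebraMap_of_isAlgebraic_of_fixed h2 hσ hx htop hz (h z hz)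
    exact IntermediateField.algebraMap_mem _ _
  rw [this]
  exact IntermediateField.finrank_bot

/-- The field of constants has degree two over `k`, with basis `1, θ`, if the conjugation does not
fix the constant `θ`. -/
theorem finrank_constants_of_ne (h2 : Module.finrank K F = 2) (hσ : σ ≠ 1)
    (hx : Transcendental k x) (htop : IntermediateField.adjoin k {x} = ⊤) {θ : F}
    (hθ : IsAlgebraic k θ) (h : σ θ ≠ θ) :
    Module.finrank k (algebraicClosure k F) = 2 := by
  let θ' : algebraicClosure k F := ⟨θ, mem_algebraicClosure_iff.2 hθ⟩
  let g : (k × k) →ₗ[k] algebraicClosure k F :=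
    (Algebra.linearMap k _).coprod ((LinearMap.mulRight k θ').comp (Algebra.linearMap k _))
  have hg : ∀ a b, ((g (a, b) : algebraicClosure k F) : F)
      = algebraMap k F a + algebraMap k F b * θ := fun a b => rfl
  have hfix : ∀ a : k, σ (algebraMap k F a) = algebraMap k F a := fun a => by
    rw [IsScalarTower.algebraMap_apply k K F, σ.commutes]
  have h1 := LinearEquiv.finrank_eq (LinearEquiv.ofBijective g ⟨?_, ?_⟩)
  · rw [← h1, Module.finrank_prod, Module.finrank_self]
  · rw [injective_iff_map_eq_zero]
    rintro ⟨a, b⟩ hab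
    have h0 : algebraMap k F a + algebraMap k F b * θ = 0 := by rw [← hg, hab]; rfl
    have h3 := congrArg σ h0
    rw [map_add, map_mul, hfix, hfix, map_zero] at h3
    have hb : algebraMap k F b = 0 := by
      by_contra hb
      exact h (mul_left_cancel₀ hb (by linear_combination h3 - h0))
    rw [hb, zero_mul, add_zero] at h0
    simp only [map_eq_zero] at h0 hb
    rw [h0, hb]; rfl
  · rintro ⟨z, hz⟩
    rw [mem_algebraicClosure_iff] at hz
    have hne : θ - σ θ ≠ 0 := sub_ne_zero.2 h.symm
    -- coordinates by Cramer's rule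
    obtain ⟨b, hb⟩ := exists_eq_algebraMap_of_isAlgebraic_of_fixed h2 hσ hx htop
      (z := (z - σ z) / (θ - σ θ))
      (by
        rw [div_eq_mul_inv]
        exact (hz.sub (isAlgebraic_conj hz)).mul (hθ.sub (isAlgebraic_conj hθ)).inv) (by
        rw [map_div₀, map_sub, map_sub, conj_conj h2 hσ, conj_conj h2 hσ, ← neg_sub, ← neg_sub θ,
          neg_div_neg_eq])
    rw [eq_div_iff hne] at hb
    obtain ⟨a, ha⟩ := exists_eq_algebraMap_of_isAlgebraic_of_fixed h2 hσ hx htop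
      (z := z - algebraMap k F b * θ)
      (hz.sub ((isAlgebraic_algebraMap b).mul hθ)) (by
        rw [map_sub, map_mul, hfix]; linear_combination hb)
    exact ⟨(a, b), Subtype.ext (by rw [hg, ha]; ring)⟩

end Constants

section Genus

variable {k F : Type*} [Field k] [Field F] [Algebra k F]

variable (k F) in
/-- Places over `k` and over the field of constants are the same. -/
def placeEquiv : Place k F ≃ Place (algebraicClosure k F) F where
  toFun P := ⟨P.v, P.surjective, fun c hc => P.v_eq_one_of_isAlgebraic
    (by simpa using hc) (mem_algebraicClosure_iff.1 c.2)⟩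
  invFun Q := ⟨Q.v, Q.surjective, fun c hc =>
    Q.trivial (algebraMap k (algebraicClosure k F) c) (by simpa using hc)⟩
  left_inv _ := rfl
  right_inv _ := rfl

/-- The degree over `k` is the degree over the field of constants times that of the constants. -/
theorem degree_placeEquiv (P : Place k F) :
    P.degree = Module.finrank k (algebraicClosure k F) * (placeEquiv k F P).degree := by
  let _ : Algebra (algebraicClosure k F) P.ring := (placeEquiv k F P).algebraRing
  have : IsScalarTower k (algebraicClosure k F) P.ring :=
    IsScalarTower.of_algebraMap_eq fun _ => rfl
  have : IsScalarTower k (algebraicClosure k F) (IsLocalRing.ResidueField P.ring) :=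
    IsScalarTower.of_algebraMap_eq fun _ => rfl
  exact (Module.finrank_mul_finrank k (algebraicClosure k F)
    (IsLocalRing.ResidueField P.ring)).symm

/-- The Riemann inequality in genus zero, in terms of degrees and dimensions over `k`. -/
theorem HasGenus.degree_add_le (h : HasGenus (algebraicClosure k F) F 0) (D : Divisor k F) :
    Divisor.degree D + Module.finrank k (algebraicClosure k F)
      ≤ Module.finrank k (riemannRochSpace D) := by
  set n := Module.finrank k (algebraicClosure k F)
  let E : Divisor (algebraicClosure k F) F := Finsupp.equivMapDomain (placeEquiv k F) D
  have h1 : Divisor.degree E - Module.finrank (algebraicClosure k F) (riemannRochSpace E) + 1 ≤ 0 :=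
    h.2 ⟨E, rfl⟩
  have h2 : Divisor.degree D = n * Divisor.degree E := by
    have hE : Divisor.degree E = D.sum fun P m => m * ((placeEquiv k F P).degree : ℤ) :=
      Finsupp.sum_equivMapDomain _ _ _
    rw [hE, Finsupp.mul_sum]
    refine Finsupp.sum_congr fun P _ => ?_
    rw [degree_placeEquiv P]
    push_cast
    ring
  have h3 : Module.finrank k (riemannRochSpace D)
      = n * Module.finrank (algebraicClosure k F) (riemannRochSpace E) := by
    rw [Module.finrank_mul_finrank k (algebraicClosure k F) (riemannRochSpace E)]
    refine LinearEquiv.finrank_eq (LinearEquiv.ofEq _ ((riemannRochSpace E).restrictScalars k) ?_)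
    ext z
    exact ⟨fun hz Q => hz ((placeEquiv k F).symm Q), fun hz P => hz (placeEquiv k F P)⟩
  rw [h2, h3]
  push_cast
  have hn : (0 : ℤ) ≤ n := by positivity
  nlinarith

end Genus

section GenusZero

variable {k K F : Type*} [Field k] [Field K] [Field F] [Algebra k K] [Algebra k F] [Algebra K F]
  [IsScalarTower k K F] {σ : F ≃ₐ[K] F} {x : K}

theorem finrank_constants_pos (h2 : Module.finrank K F = 2) (hσ : σ ≠ 1)
    (hx : Transcendental k x) (htop : IntermediateField.adjoin k {x} = ⊤) :
    0 < Module.finrank k (algebraicClosure k F) := by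
  by_cases h : ∀ z : F, IsAlgebraic k z → σ z = z
  · rw [finrank_constants_of_fixed h2 hσ hx htop h]; exact one_pos
  · push Not at h
    obtain ⟨θ, hθ, hne⟩ := h
    rw [finrank_constants_of_ne h2 hσ hx htop hθ hne]; exact two_pos

/-- Divisors of degree zero are principal in genus zero. -/
theorem exists_isDivisorOf_of_degree_eq_zero (h2 : Module.finrank K F = 2) (hσ : σ ≠ 1)
    (hx : Transcendental k x) (htop : IntermediateField.adjoin k {x} = ⊤)
    (hg : HasGenus (algebraicClosure k F) F 0) {D : Divisor k F} (hD : Divisor.degree D = 0) :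
    ∃ z : F, z ≠ 0 ∧ z ∈ riemannRochSpace (-D) ∧ IsDivisorOf D z := by
  have h1 := hg.degree_add_le (-D)
  have h3 := finrank_constants_pos h2 hσ hx htop (F := F)
  rw [Divisor.degree_neg, hD, neg_zero, zero_add] at h1
  have h4 : 0 < Module.finrank k (riemannRochSpace (-D)) := by omega
  have : Nontrivial (riemannRochSpace (-D)) := Module.nontrivial_of_finrank_pos h4
  obtain ⟨z, hz⟩ := exists_ne (0 : riemannRochSpace (-D))
  have hz0 : (z : F) ≠ 0 := fun h => hz (Subtype.ext h)
  exact ⟨z, hz0, z.2, isDivisorOf_of_mem h2 hσ hx htop hD hz0 z.2⟩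

/-- If `D` has degree zero, then `𝓛(-D)` is one-dimensional over the constants: a nonzero element
has divisor exactly `D`, so that quotients of two of them have no poles. -/
theorem finrank_riemannRochSpace_neg (h2 : Module.finrank K F = 2) (hσ : σ ≠ 1)
    (hx : Transcendental k x) (htop : IntermediateField.adjoin k {x} = ⊤)
    (hg : HasGenus (algebraicClosure k F) F 0) {D : Divisor k F} (hD : Divisor.degree D = 0) :
    Module.finrank k (riemannRochSpace (-D)) = Module.finrank k (algebraicClosure k F) := by
  obtain ⟨ϑ, h0, hmem, hdiv⟩ := exists_isDivisorOf_of_degree_eq_zero h2 hσ hx htop hg hD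
  have hmul : ∀ c : algebraicClosure k F, (c : F) * ϑ ∈ riemannRochSpace (-D) := fun c P => by
    rw [map_mul]
    by_cases hc : (c : F) = 0
    · simp [hc]
    · rw [P.v_eq_one_of_isAlgebraic hc (mem_algebraicClosure_iff.1 c.2), one_mul]
      exact hmem P
  let g : algebraicClosure k F →ₗ[k] riemannRochSpace (-D) :=
    { toFun := fun c => ⟨(c : F) * ϑ, hmul c⟩
      map_add' := fun a b => Subtype.ext (by simp [add_mul])
      map_smul' := fun a b => Subtype.ext (by simp) }
  refine (LinearEquiv.finrank_eq (LinearEquiv.ofBijective g ⟨?_, ?_⟩)).symm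
  · rw [injective_iff_map_eq_zero]
    intro c hc
    have : (c : F) * ϑ = 0 := congrArg Subtype.val hc
    exact Subtype.ext ((mul_eq_zero.1 this).resolve_right h0)
  · rintro ⟨z, hz⟩
    have halg : IsAlgebraic k (z / ϑ) := by
      by_cases hz0 : z = 0
      · rw [hz0, zero_div]; exact isAlgebraic_zero
      refine isAlgebraic_of_forall_v_le_one h2 hσ hx htop fun P => ?_
      rw [P.v_le_one_iff (div_ne_zero hz0 h0), P.ord_div hz0 h0, hdiv P]
      have := (mem_riemannRochSpace_iff hz0).1 hz P
      simp only [Finsupp.neg_apply, neg_neg] at this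
      omega
    exact ⟨⟨z / ϑ, mem_algebraicClosure_iff.2 halg⟩, Subtype.ext (div_mul_cancel₀ z h0)⟩

end GenusZero

/-! ### Ramification of quadratic extensions of genus zero -/

section Conics

open Polynomial

variable {k K F : Type*} [Field k] [Field K] [Field F] [Algebra k K] [Algebra k F] [Algebra K F]
  [IsScalarTower k K F] {σ : F ≃ₐ[K] F} {x : K}

/-- Adjoining a square root of a function of odd order is ramified. -/
theorem HasRamificationIndex.eq_two_of_sq (h2 : Module.finrank K F = 2) {s : F} {δ : K}
    (hs : s ^ 2 = algebraMap K F δ) {𝔓 : Place k F} {𝔭 : Place k K} {e : ℕ}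
    (he : HasRamificationIndex 𝔓 𝔭 e) (hodd : Odd (𝔭.ord δ)) : e = 2 := by
  have hfd : FiniteDimensional K F := FiniteDimensional.of_finrank_pos (by omega)
  have h1 := he.index_le_finrank
  have h3 := he.1
  have h4 := congrArg 𝔓.ord hs
  rw [𝔓.ord_pow, he.ord] at h4
  obtain ⟨m, hm⟩ := hodd
  rw [h2] at h1
  interval_cases e
  · push_cast at h4; omega
  · rfl

theorem adjoin_eq_top_of_finrank_two (h2 : Module.finrank K F = 2) {s : F}
    (hs : s ∉ Set.range (algebraMap K F)) : IntermediateField.adjoin K {s} = ⊤ := by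
  rw [eq_top_iff]
  intro z _
  obtain ⟨c, d, rfl⟩ := exists_add_mul_of_finrank_two h2 hs z
  exact add_mem (IntermediateField.algebraMap_mem _ _)
    (mul_mem (IntermediateField.algebraMap_mem _ _) (IntermediateField.mem_adjoin_simple_self K s))

/-- Adjoining the square root of a unit is unramified away from two. -/
theorem HasRamificationIndex.eq_one_of_sq (h2 : Module.finrank K F = 2) (htwo : (2 : k) ≠ 0)
    {s : F} {δ : K} (hs : s ^ 2 = algebraMap K F δ) (hsK : s ∉ Set.range (algebraMap K F))
    {𝔓 : Place k F} {𝔭 : Place k K} {e : ℕ}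
    (he : HasRamificationIndex 𝔓 𝔭 e) (h0 : 𝔭.v δ = 1) : e = 1 := by
  have hfd : FiniteDimensional K F := FiniteDimensional.of_finrank_pos (by omega)
  have hsv : 𝔓.v s = 1 := by
    have := congrArg 𝔓.v hs
    rw [map_pow, (he.v_eq_one_iff δ).2 h0] at this
    exact (pow_eq_one_iff_of_nonneg zero_le two_ne_zero).1 this
  refine he.eq_one_of_separable s (adjoin_eq_top_of_finrank_two h2 hsK) (X ^ 2 - C δ)
    (monic_X_pow_sub_C δ two_ne_zero) (fun i => ?_) (by simp [hs]) ?_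
  · rw [coeff_sub, coeff_X_pow, coeff_C]
    refine 𝔭.v_sub_le_one ?_ ?_ <;> split_ifs <;> simp [h0]
  · have h2F : 𝔓.v (2 : F) = 1 := by
      have := 𝔓.trivial 2 htwo
      rwa [map_ofNat] at this
    simp only [map_sub, derivative_X_pow, derivative_C, sub_zero, aeval_X,
      Nat.cast_ofNat, pow_one, map_mul, hsv, map_ofNat, h2F, mul_one, Nat.reduceSub]

/-- Characteristic different from two: `F = K(√p)` with `p` a polynomial of degree at most two. -/
theorem exists_ramified_of_sq (h2 : Module.finrank K F = 2) (hσ : σ ≠ 1)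
    (hx : Transcendental k x) (htop : IntermediateField.adjoin k {x} = ⊤)
    (hfix : ∀ z : F, IsAlgebraic k z → σ z = z) (htwo : (2 : k) ≠ 0) {s : F} (hs0 : s ≠ 0)
    (hs : σ s = -s) {p : k[X]} (hp : p.natDegree ≤ 2) (hsq : s ^ 2 = algebraMap K F (aeval x p)) :
    (∃ (𝔮 : Place k K) (𝔔 : Place k F), 𝔮.degree = 1 ∧ HasRamificationIndex 𝔔 𝔮 2) ∨
      ∃ 𝔮 : Place k K, placesWithIndex k K F 2 = {𝔮} ∧ 𝔮.degree = 2 := by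
  have hfd : FiniteDimensional K F := FiniteDimensional.of_finrank_pos (by omega)
  have hgal := isGalois_of_finrank_two h2 hσ
  have h2F : (2 : F) ≠ 0 := by
    have := (map_ne_zero (algebraMap k F)).2 htwo
    rwa [map_ofNat] at this
  have hsne : σ s ≠ s := fun h => by
    rw [hs] at h
    have : (2 : F) * s = 0 := by linear_combination -h
    exact (mul_ne_zero h2F hs0) this
  -- a square root of a constant would be a constant that is not fixed
  have hsqrt : ∀ (c : k) (d : K), s ^ 2 ≠ algebraMap k F c * algebraMap K F d ^ 2 := fun c d h => by
    have hd : algebraMap K F d ≠ 0 := by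
      intro hd
      rw [hd] at h
      exact hs0 (by simpa using h)
    have h1 : IsAlgebraic k (s / algebraMap K F d) := by
      refine IsAlgebraic.of_pow two_pos (n := 2) ?_
      rw [div_pow, h, mul_div_cancel_right₀ _ (pow_ne_zero 2 hd)]
      exact isAlgebraic_algebraMap c
    have h3 := hfix _ h1
    rw [map_div₀, σ.commutes, div_left_inj' hd] at h3
    exact hsne h3
  have hsK : s ∉ Set.range (algebraMap K F) := notMem_range_of_apply_ne hsne
  have hp0 : p ≠ 0 := by
    rintro rfl
    exact hs0 (by simpa using hsq)
  have hodd : ∀ 𝔮 : Place k K, Odd (𝔮.ord (aeval x p)) →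
      ∃ 𝔔 : Place k F, HasRamificationIndex 𝔔 𝔮 2 := fun 𝔮 h => by
    obtain ⟨𝔔, e, he⟩ := 𝔮.exists_liesOver (F := F)
    have := he.eq_two_of_sq h2 hsq h
    subst this
    exact ⟨𝔔, he⟩
  obtain ⟨Q, hQx, hQ1, hQ⟩ := exists_place_infinity hx htop
  have hx0 : x ≠ 0 := by rintro rfl; exact hx isAlgebraic_zero
  have hQlt : 1 < Q.v x := by rw [← not_le, Q.v_le_one_iff hx0]; omega
  have hcase : p.natDegree = 0 ∨ p.natDegree = 1 ∨ p.natDegree = 2 := by omega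
  rcases hcase with hd | hd | hd
  -- degree zero is impossible
  · obtain ⟨c, rfl⟩ := natDegree_eq_zero.1 hd
    refine absurd ?_ (hsqrt c 1)
    rw [hsq, aeval_C, ← IsScalarTower.algebraMap_apply]; simp
  -- in degree one, the infinite place ramifies
  · left
    have h1 := (Q.ord_aeval_of_one_lt hQlt hp0).2
    rw [hQx, hd] at h1
    obtain ⟨𝔔, h𝔔⟩ := hodd Q (by rw [h1]; decide)
    exact ⟨Q, 𝔔, hQ1, h𝔔⟩
  -- In degree two, a root of `p` is simple and its place ramifies. If there is no root, then only
  -- the place of `p` ramifies; infinity does not, since the square of `s / x` is a unit there.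
  by_cases hroot : ∃ a, p.IsRoot a
  · left
    obtain ⟨a, ha⟩ := hroot
    obtain ⟨q, rfl⟩ := dvd_iff_isRoot.2 ha
    have hq0 : q ≠ 0 := right_ne_zero_of_mul hp0
    have hqd : q.natDegree = 1 := by
      rw [natDegree_mul (X_sub_C_ne_zero a) hq0, natDegree_X_sub_C] at hd; omega
    have hqa : ¬ q.IsRoot a := fun hqa => by
      obtain ⟨q', rfl⟩ := dvd_iff_isRoot.2 hqa
      rw [natDegree_mul (X_sub_C_ne_zero a) (right_ne_zero_of_mul hq0), natDegree_X_sub_C] at hqd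
      obtain ⟨c, rfl⟩ := natDegree_eq_zero.1 (show q'.natDegree = 0 by omega)
      refine hsqrt c (aeval x (X - C a)) ?_
      rw [hsq, map_mul, map_mul, map_mul, map_mul, aeval_C, ← IsScalarTower.algebraMap_apply]
      ring
    obtain ⟨P, hP, hP1⟩ := exists_place hx htop (irreducible_X_sub_C a)
    have hne : aeval x (X - C a) ≠ 0 := by intro h0; rw [h0, P.ord_zero] at hP1; omega
    have hlt : P.v (aeval x (X - C a)) < 1 := (P.v_lt_one_iff hne).2 (by omega)
    have hcop : IsCoprime q (X - C a) :=
      ((irreducible_X_sub_C a).coprime_iff_not_dvd.2 fun h => hqa (dvd_iff_isRoot.1 h)).symm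
    have hq1 := P.v_aeval_eq_one hP hlt hcop
    have hq2 : aeval x q ≠ 0 := by intro h; simp [h] at hq1
    obtain ⟨𝔔, h𝔔⟩ := hodd P (by
      rw [map_mul, P.ord_mul hne hq2, hP1, (P.v_eq_one_iff hq2).1 hq1]; decide)
    exact ⟨P, 𝔔, by rw [Place.degree_of_aeval_lt_one htop (irreducible_X_sub_C a) hP hlt,
      natDegree_X_sub_C], h𝔔⟩
  · right
    push Not at hroot
    have hirr : Irreducible p := irreducible_of_degree_le_three_of_not_isRoot
      (by rw [hd]; decide) hroot
    obtain ⟨P, hP, hP1⟩ := exists_place hx htop hirr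
    have hne : aeval x p ≠ 0 := by intro h0; rw [h0, P.ord_zero] at hP1; omega
    have hlt : P.v (aeval x p) < 1 := (P.v_lt_one_iff hne).2 (by omega)
    refine ⟨P, ?_, by rw [Place.degree_of_aeval_lt_one htop hirr hP hlt, hd]⟩
    ext 𝔮
    rw [Set.mem_singleton_iff]
    constructor
    · rintro ⟨𝔔, h𝔔⟩
      by_cases h𝔮 : 𝔮.v x ≤ 1
      · refine Place.eq_of_aeval_lt_one htop hirr h𝔮 hP (lt_of_not_ge fun hge => ?_) hlt
        have := h𝔔.eq_one_of_sq h2 htwo hsq hsK (le_antisymm (𝔮.v_aeval_le_one h𝔮 p) hge)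
        omega
      · have h1 := (𝔮.ord_aeval_of_one_lt (not_le.1 h𝔮) hp0).2
        have hx0' : algebraMap K F x ≠ 0 := by simpa using hx0
        have := h𝔔.eq_one_of_sq h2 htwo (s := s / algebraMap K F x) (δ := aeval x p / x ^ 2)
          (by rw [div_pow, hsq, map_div₀, map_pow])
          (by
            rintro ⟨c, hc⟩
            exact hsK ⟨c * x, by rw [map_mul, hc, div_mul_cancel₀ _ hx0']⟩)
          (by
            rw [𝔮.v_eq_one_iff (div_ne_zero hne (pow_ne_zero 2 hx0)),
              𝔮.ord_div hne (pow_ne_zero 2 hx0), h1, 𝔮.ord_pow, hd]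
            push_cast; ring)
        omega
    · rintro rfl
      obtain ⟨𝔔, h𝔔⟩ := hodd 𝔮 (by rw [hP1]; decide)
      exact ⟨𝔔, h𝔔⟩

/-- Characteristic two: the extension is ramified at the zero of the trace of `y`, if `x` is finite
there. -/
theorem exists_ramified_of_artinSchreier [PerfectField k] (h2 : Module.finrank K F = 2) (hσ : σ ≠ 1)
    (hx : Transcendental k x) (htop : IntermediateField.adjoin k {x} = ⊤)
    (hfix : ∀ z : F, IsAlgebraic k z → σ z = z) (htwo : (2 : k) = 0) {y : F} (hy : σ y ≠ y)
    {t₀ t₁ n₀ n₁ n₂ : k} (ht₁ : t₁ ≠ 0)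
    (heq : y ^ 2 = (algebraMap k F t₁ * algebraMap K F x + algebraMap k F t₀) * y +
      (algebraMap k F n₂ * algebraMap K F x ^ 2 + algebraMap k F n₁ * algebraMap K F x
        + algebraMap k F n₀)) :
    ∃ (𝔮 : Place k K) (𝔔 : Place k F), 𝔮.degree = 1 ∧ HasRamificationIndex 𝔔 𝔮 2 := by
  have hfd : FiniteDimensional K F := FiniteDimensional.of_finrank_pos (by omega)
  have hgal := isGalois_of_finrank_two h2 hσ
  have h2F : (2 : F) = 0 := by
    have := congrArg (algebraMap k F) htwo
    rwa [map_ofNat, map_zero] at this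
  have : CharP k 2 := CharTwo.of_one_ne_zero_of_two_eq_zero one_ne_zero htwo
  have hfixk : ∀ a : k, σ (algebraMap k F a) = algebraMap k F a := fun a => by
    rw [IsScalarTower.algebraMap_apply k K F, σ.commutes]
  -- `a` is the zero of the trace, and `c` a square root of the constant term of the equation at
  -- `x = a`, which exists since `k` is perfect
  obtain ⟨a, ha⟩ : ∃ a, t₁ * a = t₀ := ⟨t₀ / t₁, mul_div_cancel₀ _ ht₁⟩
  obtain ⟨c, hc⟩ : ∃ c : k, c ^ 2 = n₂ * a ^ 2 + n₁ * a + n₀ := by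
    obtain ⟨c, hc⟩ := surjective_frobenius k 2 (n₂ * a ^ 2 + n₁ * a + n₀)
    exact ⟨c, hc⟩
  have ha' : algebraMap k F t₁ * algebraMap k F a = algebraMap k F t₀ := by rw [← map_mul, ha]
  have hc' : algebraMap k F c ^ 2 = algebraMap k F n₂ * algebraMap k F a ^ 2
      + algebraMap k F n₁ * algebraMap k F a + algebraMap k F n₀ := by
    simp only [← map_mul, ← map_pow, ← map_add, hc]
  set X' := algebraMap K F x with hX'
  let A := algebraMap k F
  let Y := y + A c
  have hYne : σ Y ≠ Y := fun h => hy (by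
    have h' : σ (y + algebraMap k F c) = y + algebraMap k F c := h
    rw [map_add, hfixk] at h'
    exact add_right_cancel h')
  obtain ⟨P, hP, hP1⟩ := exists_place hx htop (irreducible_X_sub_C a)
  have haev : aeval x (X - C a) = x - algebraMap k K a := by simp
  have hne : aeval x (X - C a) ≠ 0 := by intro h0; rw [h0, P.ord_zero] at hP1; omega
  have hlt : P.v (aeval x (X - C a)) < 1 := (P.v_lt_one_iff hne).2 (by omega)
  have hdeg : P.degree = 1 := by
    rw [Place.degree_of_aeval_lt_one htop (irreducible_X_sub_C a) hP hlt, natDegree_X_sub_C]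
  rw [haev] at hne hlt hP1
  obtain ⟨𝔔, e, he⟩ := P.exists_liesOver (F := F)
  refine ⟨P, 𝔔, hdeg, ?_⟩
  have hπ : algebraMap K F (x - algebraMap k K a) = X' - A a := by
    rw [map_sub, ← IsScalarTower.algebraMap_apply]
  have hπ0 : X' - A a ≠ 0 := by rw [← hπ]; exact (_root_.map_ne_zero _).2 hne
  -- the equation of `Y`, whose constant term vanishes at `a`
  have hY : Y * (Y - A t₁ * (X' - A a)) = (X' - A a) * (A t₁ * A c + A n₁ + A n₂ * (X' + A a)) := by
    simp only [Y, A]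
    linear_combination heq + hc' - y * ha'
      + (algebraMap k F c * y + algebraMap k F t₁ * algebraMap k F a * y
        - algebraMap k F t₁ * algebraMap k F c * (X' - algebraMap k F a)
        + algebraMap k F n₂ * algebraMap k F a ^ 2 + algebraMap k F n₁ * algebraMap k F a
        + algebraMap k F n₀) * h2F
  have hXa : X' + A a = X' - A a := by
    simp only [A]
    linear_combination algebraMap k F a * h2F
  rw [hXa] at hY
  have hA0 : ∀ b : k, b ≠ 0 → 𝔔.v (A b) = 1 := fun b hb => 𝔔.trivial b hb
  have hπlt : 𝔔.v (X' - A a) < 1 := by rw [← hπ]; exact (he.v_lt_one_iff _).2 hlt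
  -- if the coefficient of `x - a` on the right-hand side vanished, then `Y / (x - a)` would be a
  -- constant that is not fixed
  by_cases hm : t₁ * c + n₁ = 0
  · exfalso
    have hmA : A t₁ * A c + A n₁ = 0 := by
      simp only [A]
      rw [← map_mul, ← map_add, hm, map_zero]
    rw [hmA, zero_add] at hY
    have hZ : (Y / (X' - A a)) ^ 2 = A t₁ * (Y / (X' - A a)) + A n₂ := by
      field_simp
      linear_combination hY
    have halg : IsAlgebraic k (Y / (X' - A a)) := by
      refine ⟨X ^ 2 - C t₁ * X - C n₂, fun h => ?_, ?_⟩
      · have := congrArg (fun q : k[X] => q.coeff 2) h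
        simp at this
      · simp only [map_sub, map_mul, map_pow, aeval_X, aeval_C]
        linear_combination hZ
    have h5 := hfix _ halg
    rw [map_div₀, ← hπ, σ.commutes, div_left_inj' (by rw [hπ]; exact hπ0)] at h5
    exact hYne h5
  · have hm1 : 𝔔.v (A t₁ * A c + A n₁) = 1 := by
      simp only [A]
      rw [← map_mul, ← map_add]
      exact 𝔔.trivial _ hm
    have hl : 𝔔.v (A t₁ * A c + A n₁ + A n₂ * (X' - A a)) = 1 := by
      have hlt' : 𝔔.v (A n₂ * (X' - A a)) < 1 := by
        rw [map_mul]
        exact (mul_le_of_le_one_left' (𝔔.v_algebraMap_le_one n₂)).trans_lt hπlt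
      rw [Valuation.map_add_eq_of_lt_left _ (by rw [hm1]; exact hlt'), hm1]
    have hYv := congrArg 𝔔.v hY
    rw [map_mul, map_mul, hl, mul_one] at hYv
    have htlt : 𝔔.v (A t₁ * (X' - A a)) < 1 := by rw [map_mul, hA0 t₁ ht₁, one_mul]; exact hπlt
    rcases lt_or_ge (𝔔.v Y) 1 with hYlt | hYge
    · -- both factors vanish at the place, so that the uniformizer of `P` has order at least two
      have hle := he.index_le_finrank
      rw [h2] at hle
      have h0 := he.1
      have hsub : 𝔔.v (Y - A t₁ * (X' - A a)) < 1 := 𝔔.v_sub_lt_one hYlt htlt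
      have hY0 : Y ≠ 0 := by
        intro h0
        exact hYne (by rw [h0, map_zero])
      have hY1 : Y - A t₁ * (X' - A a) ≠ 0 := by
        intro h0
        rw [h0, map_zero, mul_zero] at hYv
        exact (_root_.map_ne_zero 𝔔.v).2 hπ0 hYv.symm
      have hord : 𝔔.ord (Y * (Y - A t₁ * (X' - A a))) = 𝔔.ord (X' - A a) := by
        rw [Place.ord, Place.ord, map_mul, hYv]
      rw [𝔔.ord_mul hY0 hY1, ← hπ, he.ord, hP1] at hord
      rw [𝔔.v_lt_one_iff hY0] at hYlt
      rw [𝔔.v_lt_one_iff hY1, ← hπ] at hsub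
      have : e = 2 := by omega
      rwa [this] at he
    · exfalso
      rw [Valuation.map_sub_eq_of_lt_left _ (htlt.trans_le hYge)] at hYv
      exact absurd (hYv ▸ hπlt) (not_lt.2 (one_le_mul hYge hYge))

end Conics

/-! ### Existence of the divisor of `ϑ` -/

section Existence

open Polynomial

variable {k K F : Type*} [Field k] [Field K] [Field F] [Algebra k K] [Algebra k F] [Algebra K F]
  [IsScalarTower k K F] {σ : F ≃ₐ[K] F} {x : K}

/-- An element of `K` whose only pole in `F` is at infinity is a polynomial in `x`. -/
theorem exists_eq_aeval_of_pullback [FiniteDimensional K F] [Algebra.IsSeparable K F]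
    (hx : Transcendental k x) (htop : IntermediateField.adjoin k {x} = ⊤) {Q : Place k K}
    (hQ : ∀ P : Place k K, 1 < P.v x → P = Q) (hQx : 1 < Q.v x)
    {η : Divisor k F} (hη : IsPullback η Q) {n : ℕ} {c : K}
    (h : ∀ 𝔓 : Place k F, 𝔓.v (algebraMap K F c) ≤ WithZero.exp (n * η 𝔓)) :
    ∃ A : k[X], c = aeval x A ∧ A.natDegree ≤ n := by
  refine exists_eq_aeval_natDegree_le hx htop (fun P hP => ?_) (fun P hP => ?_)
  · obtain ⟨𝔓, e, he⟩ := P.exists_liesOver (F := F)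
    have h1 := h 𝔓
    rw [hη.2 𝔓 (fun ⟨d, hd⟩ => by
      have := he.place_eq hd
      subst this
      exact absurd hQx (not_lt.2 hP)), mul_zero, WithZero.exp_zero] at h1
    exact (he.v_le_one_iff c).1 h1
  · obtain rfl := hQ P hP
    obtain ⟨𝔓, e, he⟩ := P.exists_liesOver (F := F)
    by_cases hc : c = 0
    · simp [hc]
    have h1 := h 𝔓
    have hc' : algebraMap K F c ≠ 0 := by simpa using hc
    rw [hη.1 𝔓 e he, 𝔓.v_le_exp_iff hc', he.ord] at h1
    rw [P.v_le_exp_iff hc]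
    have h0 : (0 : ℤ) < e := by exact_mod_cast he.1
    nlinarith

/-- A conic over `k` has a ramified place of degree one, or a single ramified place, of degree
two. -/
theorem exists_ramified [PerfectField k] (h2 : Module.finrank K F = 2) (hσ : σ ≠ 1)
    (hx : Transcendental k x) (htop : IntermediateField.adjoin k {x} = ⊤)
    (hg : HasGenus (algebraicClosure k F) F 0) (hfix : ∀ z : F, IsAlgebraic k z → σ z = z) :
    (∃ (𝔮 : Place k K) (𝔔 : Place k F), 𝔮.degree = 1 ∧ HasRamificationIndex 𝔔 𝔮 2) ∨
      ∃ 𝔮 : Place k K, placesWithIndex k K F 2 = {𝔮} ∧ 𝔮.degree = 2 := by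
  have hfd : FiniteDimensional K F := FiniteDimensional.of_finrank_pos (by omega)
  have hgal := isGalois_of_finrank_two h2 hσ
  obtain ⟨Q, hQx, hQ1, hQ⟩ := exists_place_infinity hx htop
  have hx0 : x ≠ 0 := by rintro rfl; exact hx isAlgebraic_zero
  have hQlt : 1 < Q.v x := by rw [← not_le, Q.v_le_one_iff hx0]; omega
  obtain ⟨η, hη, hηd⟩ := exists_isPullback h2 hσ Q (Q.degree_pos hx htop)
  rw [hQ1] at hηd
  -- by Riemann–Roch, the functions with a pole at most at infinity do not all come from `K`
  classical
  obtain ⟨y, hy, hyσ⟩ : ∃ y ∈ riemannRochSpace η, σ y ≠ y := by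
    by_contra! hall
    have hle : riemannRochSpace η ≤ Submodule.span k
        (({1, algebraMap K F x} : Finset F) : Set F) := fun z hz => by
      obtain ⟨c, rfl⟩ := exists_eq_algebraMap_of_fixed h2 hσ (hall z hz)
      obtain ⟨A, rfl, hA⟩ := exists_eq_aeval_of_pullback hx htop hQ hQlt hη (n := 1)
        (fun 𝔓 => by simpa using hz 𝔓)
      obtain ⟨a₁, a₀, rfl⟩ := exists_eq_X_add_C_of_natDegree_le_one hA
      have : algebraMap K F (aeval x (C a₁ * X + C a₀)) = a₁ • algebraMap K F x + a₀ • 1 := by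
        simp only [map_add, map_mul, aeval_C, aeval_X, Algebra.smul_def, mul_one,
          ← IsScalarTower.algebraMap_apply]
      rw [this]
      exact add_mem (Submodule.smul_mem _ _ (Submodule.subset_span (by simp)))
        (Submodule.smul_mem _ _ (Submodule.subset_span (by simp)))
    have h1 := HasGenus.degree_add_le hg η
    rw [hηd, finrank_constants_of_fixed h2 hσ hx htop hfix] at h1
    have h3 := Submodule.finrank_mono hle
    have h4 := finrank_span_finset_le_card (R := k) ({1, algebraMap K F x} : Finset F)
    have h5 := Finset.card_le_two (a := (1 : F)) (b := algebraMap K F x)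
    have : Set.finrank k (({1, algebraMap K F x} : Finset F) : Set F) = Module.finrank k
      (Submodule.span k (({1, algebraMap K F x} : Finset F) : Set F)) := rfl
    omega
  -- the trace and the norm of `y` are polynomials in `x` of degree at most one and two
  obtain ⟨t, ht⟩ := exists_trace h2 hσ y
  obtain ⟨m, hm⟩ := exists_norm h2 hσ y
  have hyσ' : ∀ 𝔓 : Place k F, 𝔓.v (σ y) ≤ WithZero.exp (η 𝔓) := fun 𝔓 => by
    rw [← Place.conj_v h2 hσ, ← hη.conj_apply h2 hσ 𝔓]
    exact hy _
  obtain ⟨A, rfl, hA⟩ := exists_eq_aeval_of_pullback hx htop hQ hQlt hη (n := 1) (c := t)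
    (fun 𝔓 => by
      rw [ht, Nat.cast_one, one_mul]
      exact (𝔓.v.map_add _ _).trans (max_le (hy 𝔓) (hyσ' 𝔓)))
  obtain ⟨B, rfl, hB⟩ := exists_eq_aeval_of_pullback hx htop hQ hQlt hη (n := 2) (c := m)
    (fun 𝔓 => by
      rw [hm, map_mul, Nat.cast_ofNat, two_mul, WithZero.exp_add]
      exact mul_le_mul' (hy 𝔓) (hyσ' 𝔓))
  by_cases htwo : (2 : k) = 0
  · left
    have h2F : (2 : F) = 0 := by
      have := congrArg (algebraMap k F) htwo
      rwa [map_ofNat, map_zero] at this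
    obtain ⟨a₁, a₀, rfl⟩ := exists_eq_X_add_C_of_natDegree_le_one hA
    have hB' : B = C (B.coeff 2) * X ^ 2 + C (B.coeff 1) * X + C (B.coeff 0) := by
      conv_lhs => rw [B.as_sum_range_C_mul_X_pow' (n := 3) (by omega)]
      simp only [Finset.sum_range_succ, Finset.sum_range_zero]
      ring
    rw [hB'] at hm
    set b₀ := B.coeff 0
    set b₁ := B.coeff 1
    set b₂ := B.coeff 2
    simp only [map_add, map_mul, map_pow, aeval_C, aeval_X, ← IsScalarTower.algebraMap_apply]
      at hm ht
    -- if the trace is constant, its zero is at infinity, and `x⁻¹` takes the place of `x`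
    by_cases ha₁ : a₁ = 0
    · have hx0' : algebraMap K F x ≠ 0 := by simpa using hx0
      have ha₀ : a₀ ≠ 0 := by
        rintro rfl
        rw [ha₁] at ht
        simp only [map_zero, zero_mul, add_zero] at ht
        exact hyσ (by linear_combination -ht - y * h2F)
      rw [ha₁, map_zero, zero_mul, zero_add] at ht
      refine exists_ramified_of_artinSchreier h2 hσ (transcendental_inv hx)
        (adjoin_inv_eq_top htop) hfix htwo (y := y * algebraMap K F x⁻¹) (t₁ := a₀) (t₀ := 0)
        (n₀ := -b₂) (n₁ := -b₁) (n₂ := -b₀) ?_ ha₀ ?_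
      · rw [map_mul, σ.commutes]
        intro h
        refine hyσ (mul_right_cancel₀ ?_ h)
        simpa using hx0
      · simp only [map_inv₀, map_neg, map_zero, add_zero]
        field_simp
        linear_combination -y * ht + hm
    · exact exists_ramified_of_artinSchreier h2 hσ hx htop hfix htwo hyσ (t₀ := a₀) (n₀ := -b₀)
        (n₁ := -b₁) (n₂ := -b₂) ha₁ (by
          simp only [map_neg]
          linear_combination -y * ht + hm)
  -- the square of `y - σ(y)` is the discriminant
  · refine exists_ramified_of_sq h2 hσ hx htop hfix htwo (s := y - σ y)
      (sub_ne_zero.2 (Ne.symm hyσ)) (by rw [map_sub, conj_conj h2 hσ]; ring)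
      (p := A ^ 2 - C 4 * B) ?_ ?_
    · refine (natDegree_sub_le _ _).trans (max_le ?_ ?_)
      · exact natDegree_pow_le.trans (by omega)
      · exact (natDegree_C_mul_le _ _).trans hB
    · rw [map_sub, map_sub, map_mul, map_mul, map_pow, map_pow, ht, hm, aeval_C,
        ← IsScalarTower.algebraMap_apply, map_ofNat]
      ring

end Existence

section Theta

variable {k K F : Type*} [Field k] [Field K] [Field F] [Algebra k K] [Algebra k F] [Algebra K F]
  [IsScalarTower k K F] {σ : F ≃ₐ[K] F} {x : K} {T : Finset (Place k K)}
  {𝔓 : Place k K → Place k F}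

theorem exists_odd_degree (h : Odd (totalDegree T)) : ∃ 𝔭 ∈ T, Odd 𝔭.degree := by
  by_contra! hall
  refine Nat.not_even_iff_odd.2 h (Finset.even_sum _ fun 𝔭 h𝔭 => ?_)
  exact Nat.not_odd_iff_even.1 (hall 𝔭 h𝔭)

theorem degree_sum_single (h2 : Module.finrank K F = 2) (hσ : σ ≠ 1)
    (h𝔓 : ∀ 𝔭 ∈ T, LiesOver (𝔓 𝔭) 𝔭 ∧ (𝔓 𝔭).conj σ ≠ 𝔓 𝔭) :
    Divisor.degree (∑ 𝔭 ∈ T, Finsupp.single (𝔓 𝔭) 1 : Divisor k F) = totalDegree T := by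
  rw [Divisor.degree_sum, totalDegree, Nat.cast_sum]
  refine Finset.sum_congr rfl fun 𝔭 h𝔭 => ?_
  obtain ⟨⟨e, he⟩, hs⟩ := h𝔓 𝔭 h𝔭
  rw [Divisor.degree_single, he.degree_of_split h2 hσ hs, one_mul]

/-- There is a divisor of the required form. In the odd case it needs a ramified place of degree one
or the exceptional situation, which `exists_ramified` provides. -/
theorem exists_isThetaDivisor [PerfectField k] (h2 : Module.finrank K F = 2) (hσ : σ ≠ 1)
    (hx : Transcendental k x) (htop : IntermediateField.adjoin k {x} = ⊤)
    (hg : HasGenus (algebraicClosure k F) F 0)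
    (h𝔓 : ∀ 𝔭 ∈ T, LiesOver (𝔓 𝔭) 𝔭 ∧ (𝔓 𝔭).conj σ ≠ 𝔓 𝔭) :
    ∃ D, IsThetaDivisor T 𝔓 D := by
  obtain ⟨Q, hQx, hQ1, hQ⟩ := exists_place_infinity hx htop
  obtain ⟨η, hη, hηd⟩ := exists_isPullback h2 hσ Q (Q.degree_pos hx htop)
  rcases Nat.even_or_odd (totalDegree T) with ⟨e, he⟩ | hodd
  · exact ⟨_, .even e (by omega) Q hQ1 η hη⟩
  -- if there were more constants in `F`, all its places would have even degree, but those over `T`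
  -- do not
  have hfix : ∀ z : F, IsAlgebraic k z → σ z = z := by
    by_contra! hne
    obtain ⟨θ, hθ, hθσ⟩ := hne
    obtain ⟨𝔭, h𝔭, hd⟩ := exists_odd_degree hodd
    obtain ⟨⟨e, he⟩, hs⟩ := h𝔓 𝔭 h𝔭
    rw [← he.degree_of_split h2 hσ hs, degree_placeEquiv,
      finrank_constants_of_ne h2 hσ hx htop hθ hθσ] at hd
    exact Nat.not_even_iff_odd.2 hd (even_two_mul _)
  rcases exists_ramified h2 hσ hx htop hg hfix with ⟨𝔮, 𝔔, h𝔮, h𝔔⟩ | ⟨𝔮, hS, h𝔮⟩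
  · exact ⟨_, .odd hodd 𝔮 h𝔮 𝔔 h𝔔⟩
  · obtain ⟨𝔭, h𝔭, hd⟩ := exists_odd_degree hodd
    obtain ⟨m, hm⟩ := hodd
    obtain ⟨n, hn⟩ := hd
    exact ⟨_, .exceptional ⟨⟨m, hm⟩, 𝔮, hS, h𝔮⟩ 𝔭 h𝔭 (m - 3 * n - 1) (by omega) Q hQ1 η hη⟩

/-- The coefficients in the definition are chosen such that the degree is zero. -/
theorem IsThetaDivisor.degree (h2 : Module.finrank K F = 2) (hσ : σ ≠ 1)
    (h𝔓 : ∀ 𝔭 ∈ T, LiesOver (𝔓 𝔭) 𝔭 ∧ (𝔓 𝔭).conj σ ≠ 𝔓 𝔭) {D : Divisor k F}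
    (hD : IsThetaDivisor T 𝔓 D) : Divisor.degree D = 0 := by
  have hsum := degree_sum_single h2 hσ h𝔓
  cases hD with
  | even e he 𝔬 h𝔬 η hη =>
    rw [Divisor.degree_sub, Divisor.degree_zsmul, hsum, hη.degree h2 hσ (by omega), h𝔬, he]
    push_cast; ring
  | odd hodd 𝔮 h𝔮 𝔔 h𝔔 =>
    rw [Divisor.degree_sub, Divisor.degree_zsmul, hsum, Divisor.degree_single,
      h𝔔.degree_of_ramified h2, h𝔮]
    push_cast; ring
  | exceptional hexc 𝔭₁ h𝔭₁ e he 𝔬 h𝔬 η hη =>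
    obtain ⟨⟨d, hd⟩, hs⟩ := h𝔓 𝔭₁ h𝔭₁
    rw [Divisor.degree_sub, Divisor.degree_add, Divisor.degree_zsmul, Divisor.degree_zsmul, hsum,
      hη.degree h2 hσ (by omega), h𝔬, Divisor.degree_single, hd.degree_of_split h2 hσ hs]
    push_cast; linarith

theorem signDivisor_apply (h2 : Module.finrank K F = 2) (hσ : σ ≠ 1) (𝔔 : Place k F) :
    signDivisor σ T 𝔓 𝔔 = (∑ 𝔭 ∈ T, Finsupp.single (𝔓 𝔭) 1 : Divisor k F) (𝔔.conj σ)
      - (∑ 𝔭 ∈ T, Finsupp.single (𝔓 𝔭) 1 : Divisor k F) 𝔔 := by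
  rw [signDivisor, Finset.sum_sub_distrib, Finsupp.sub_apply]
  simp only [Finsupp.finsetSum_apply, single_conj_apply h2 hσ]

/-- The divisor `σ(D) - D` of `σ(ϑ) / ϑ`: the auxiliary terms in `D` are invariant, and what remains
is the sign divisor, up to a multiple of three in the exceptional case. -/
theorem IsThetaDivisor.conj_sub (h2 : Module.finrank K F = 2) (hσ : σ ≠ 1) {D : Divisor k F}
    (hD : IsThetaDivisor T 𝔓 D) :
    (¬ IsExceptional F T ∧ ∀ 𝔔, D (𝔔.conj σ) - D 𝔔 = signDivisor σ T 𝔓 𝔔) ∨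
    (IsExceptional F T ∧ ∃ 𝔭₁ ∈ T, ∀ 𝔔, D (𝔔.conj σ) - D 𝔔 = signDivisor σ T 𝔓 𝔔
      - 3 * ((Finsupp.single (𝔓 𝔭₁) 1 : Divisor k F) (𝔔.conj σ)
        - (Finsupp.single (𝔓 𝔭₁) 1 : Divisor k F) 𝔔)) := by
  cases hD with
  | even e he 𝔬 h𝔬 η hη =>
    refine Or.inl ⟨fun hexc => ?_, fun 𝔔 => ?_⟩
    · obtain ⟨m, hm⟩ := hexc.1
      omega
    · rw [signDivisor_apply h2 hσ]
      simp only [Finsupp.sub_apply, Finsupp.smul_apply, hη.conj_apply h2 hσ]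
      ring
  | odd hodd 𝔮 h𝔮 𝔔' h𝔔 =>
    refine Or.inl ⟨fun hexc => ?_, fun 𝔔 => ?_⟩
    · obtain ⟨_, 𝔮', hS, h𝔮'⟩ := hexc
      have hmem : 𝔮 ∈ placesWithIndex k K F 2 := ⟨𝔔', h𝔔⟩
      rw [hS, Set.mem_singleton_iff] at hmem
      subst hmem
      omega
    · rw [signDivisor_apply h2 hσ]
      simp only [Finsupp.sub_apply, Finsupp.smul_apply, ← single_conj_apply h2 hσ 𝔔',
        h𝔔.conj_eq_of_ramified h2 hσ]
      ring
  | exceptional hexc 𝔭₁ h𝔭₁ e he 𝔬 h𝔬 η hη =>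
    refine Or.inr ⟨hexc, 𝔭₁, h𝔭₁, fun 𝔔 => ?_⟩
    rw [signDivisor_apply h2 hσ]
    simp only [Finsupp.sub_apply, Finsupp.add_apply, Finsupp.smul_apply, hη.conj_apply h2 hσ,
      smul_eq_mul]
    ring

end Theta

/-! ### Cubic extensions of fields -/

section CubicFields

open Polynomial

variable {F N : Type*} [Field F] [Field N] [Algebra F N]

theorem adjoin_eq_top_of_finrank_three (h3 : Module.finrank F N = 3) {z : N}
    (hz : z ∉ Set.range (algebraMap F N)) : IntermediateField.adjoin F {z} = ⊤ := by
  have := IntermediateField.isSimpleOrder_of_finrank_prime F N (by rw [h3]; exact Nat.prime_three)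
  rcases eq_bot_or_eq_top (IntermediateField.adjoin F {z}) with h | h
  · rw [IntermediateField.adjoin_simple_eq_bot_iff] at h
    exact absurd (IntermediateField.mem_bot.1 h) hz
  · exact h

theorem natDegree_minpoly_of_finrank_three (h3 : Module.finrank F N = 3) {z : N}
    (hz : z ∉ Set.range (algebraMap F N)) : (minpoly F z).natDegree = 3 := by
  have hfd : FiniteDimensional F N := FiniteDimensional.of_finrank_pos (by omega)
  rw [← IntermediateField.adjoin.finrank (Algebra.IsIntegral.isIntegral z),
    adjoin_eq_top_of_finrank_three h3 hz, IntermediateField.finrank_top', h3]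

theorem minpoly_eq_of_finrank_three (h3 : Module.finrank F N = 3) {z : N}
    (hz : z ∉ Set.range (algebraMap F N)) {p : F[X]} (hp : p.Monic) (hd : p.natDegree ≤ 3)
    (h0 : aeval z p = 0) : minpoly F z = p := by
  have hfd : FiniteDimensional F N := FiniteDimensional.of_finrank_pos (by omega)
  refine (eq_of_monic_of_dvd_of_natDegree_le (minpoly.monic (Algebra.IsIntegral.isIntegral z)) hp
    (minpoly.dvd F z h0) ?_).symm
  rwa [natDegree_minpoly_of_finrank_three h3 hz]

theorem notMem_range_of_adjoin_eq_top (h3 : Module.finrank F N = 3) {z : N}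
    (hz : IntermediateField.adjoin F {z} = ⊤) : z ∉ Set.range (algebraMap F N) := by
  intro h
  have : IntermediateField.adjoin F {z} = ⊥ :=
    IntermediateField.adjoin_simple_eq_bot_iff.2 (IntermediateField.mem_bot.2 h)
  rw [hz] at this
  have h1 := IntermediateField.finrank_top' (F := F) (E := N)
  rw [this, IntermediateField.finrank_bot, h3] at h1
  omega

theorem coordinates_eq_zero_of_natDegree {z : N} (hz : (minpoly F z).natDegree = 3) {a b c : F}
    (h : algebraMap F N a + algebraMap F N b * z + algebraMap F N c * z ^ 2 = 0) :
    a = 0 ∧ b = 0 ∧ c = 0 := by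
  have hp : (C c * X ^ 2 + C b * X + C a : F[X]) = 0 := by
    by_contra hne
    have h1 := minpoly.degree_le_of_ne_zero F z hne (by
      simp only [map_add, map_mul, map_pow, aeval_C, aeval_X]
      rw [← h]; ring)
    have h4 := natDegree_le_natDegree h1
    have h5 := natDegree_quadratic_le (a := c) (b := b) (c := a)
    omega
  refine ⟨?_, ?_, ?_⟩
  · simpa using congrArg (coeff · 0) hp
  · simpa [coeff_X] using congrArg (coeff · 1) hp
  · simpa [coeff_X, coeff_C] using congrArg (coeff · 2) hp

theorem coordinates_eq_zero (h3 : Module.finrank F N = 3) {z : N}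
    (hz : z ∉ Set.range (algebraMap F N)) {a b c : F}
    (h : algebraMap F N a + algebraMap F N b * z + algebraMap F N c * z ^ 2 = 0) :
    a = 0 ∧ b = 0 ∧ c = 0 :=
  coordinates_eq_zero_of_natDegree (natDegree_minpoly_of_finrank_three h3 hz) h

theorem exists_coordinates (h3 : Module.finrank F N = 3) {z : N}
    (hz : z ∉ Set.range (algebraMap F N)) (y : N) : ∃ a b c : F,
      y = algebraMap F N a + algebraMap F N b * z + algebraMap F N c * z ^ 2 := by
  have hfd : FiniteDimensional F N := FiniteDimensional.of_finrank_pos (by omega)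
  have hli : LinearIndependent F ![1, z, z ^ 2] := by
    rw [Fintype.linearIndependent_iff]
    intro g hg
    simp only [Fin.sum_univ_three, Matrix.cons_val_zero, Matrix.cons_val_one, Matrix.cons_val_two,
      Matrix.head_cons, Matrix.tail_cons, Algebra.smul_def, mul_one] at hg
    obtain ⟨h0, h1, h2⟩ := coordinates_eq_zero h3 hz hg
    intro i
    fin_cases i
    exacts [h0, h1, h2]
  have htop := hli.span_eq_top_of_card_eq_finrank' (by rw [Fintype.card_fin, h3])
  have hy : y ∈ Submodule.span F (Set.range ![1, z, z ^ 2]) := htop ▸ Submodule.mem_top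
  obtain ⟨g, hg⟩ := (Submodule.mem_span_range_iff_exists_fun F).1 hy
  refine ⟨g 0, g 1, g 2, ?_⟩
  rw [← hg]
  simp [Fin.sum_univ_three, Algebra.smul_def]

/-- The coordinates of a root of `X³ - 3 a X - b` in terms of a cube root `v`. -/
theorem kummer_coordinates (h3 : Module.finrank F N = 3) (hF : (3 : F) ≠ 0) {v y : N}
    {γ a b c₀ c₁ c₂ : F} (hv : v ^ 3 = algebraMap F N γ) (hyK : y ∉ Set.range (algebraMap F N))
    (hy : y ^ 3 = 3 * algebraMap F N a * y + algebraMap F N b)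
    (h : y = algebraMap F N c₀ + algebraMap F N c₁ * v + algebraMap F N c₂ * v ^ 2) :
    c₀ = 0 ∧ c₁ * c₂ * γ = a ∧ c₁ ^ 3 * γ + c₂ ^ 3 * γ ^ 2 = b := by
  obtain ⟨h0, h1, h2⟩ := coordinates_eq_zero h3 hyK (a := -c₀ ^ 3 + b + 3 * (c₁ * c₂ * γ) * c₀
      - (c₁ ^ 3 * γ + c₂ ^ 3 * γ ^ 2)) (b := 3 * c₀ ^ 2 + 3 * a - 3 * (c₁ * c₂ * γ))
      (c := -(3 * c₀)) (by
    have hz : (y - algebraMap F N c₀) ^ 3 = 3 * algebraMap F N (c₁ * c₂ * γ)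
        * (y - algebraMap F N c₀) + algebraMap F N (c₁ ^ 3 * γ + c₂ ^ 3 * γ ^ 2) := by
      simp only [map_add, map_mul, map_pow, ← hv]
      rw [h]
      ring
    simp only [map_add, map_sub, map_mul, map_pow, map_neg, map_ofNat] at hz ⊢
    linear_combination hz - hy)
  have hc0 : c₀ = 0 := by simpa [hF] using h2
  subst hc0
  have h1' : 3 * (c₁ * c₂ * γ - a) = 0 := by linear_combination -h1
  refine ⟨rfl, ?_, by linear_combination -h0⟩
  simpa [hF, sub_eq_zero] using h1'

theorem cubicPoly_monic (β : F) : (cubicPoly β).Monic := by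
  have : cubicPoly β = X ^ 3 + (-(C 3 * X) - C β) := by
    rw [cubicPoly, map_ofNat]; ring
  rw [this]
  refine monic_X_pow_add ?_
  refine (degree_sub_le _ _).trans_lt (max_lt ?_ ?_)
  · rw [degree_neg]
    exact (degree_C_mul_X_le _).trans_lt (by decide)
  · exact degree_C_le.trans_lt (by decide)

theorem natDegree_cubicPoly (β : F) : (cubicPoly β).natDegree = 3 := by
  rw [cubicPoly]
  have : (3 : F[X]) = C 3 := by rw [map_ofNat]
  rw [this]
  compute_degree!

theorem aeval_cubicPoly {A : Type*} [CommRing A] [Algebra F A] (β : F) (y : A) :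
    aeval y (cubicPoly β) = y ^ 3 - 3 * y - algebraMap F A β := by
  have : (3 : F[X]) = C 3 := by rw [map_ofNat]
  rw [cubicPoly, this]
  simp only [map_sub, map_mul, map_pow, aeval_X, aeval_C, map_ofNat]

theorem IsDefinedBy.finrank {β : F} (h : IsDefinedBy N β) : Module.finrank F N = 3 := by
  obtain ⟨y, hy, hp⟩ := h
  have hint : IsIntegral F y := by
    by_contra hint
    have := minpoly.eq_zero hint
    rw [hp] at this
    exact (cubicPoly_monic β).ne_zero this
  rw [← IntermediateField.finrank_top', ← hy, IntermediateField.adjoin.finrank hint, hp,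
    natDegree_cubicPoly]

theorem isDefinedBy_of_root (h3 : Module.finrank F N = 3) {y : N}
    (hy : y ∉ Set.range (algebraMap F N)) {β : F}
    (h : y ^ 3 = 3 * y + algebraMap F N β) : IsDefinedBy N β :=
  ⟨y, adjoin_eq_top_of_finrank_three h3 hy, minpoly_eq_of_finrank_three h3 hy (cubicPoly_monic β)
    (natDegree_cubicPoly β).le (by rw [aeval_cubicPoly, h]; ring)⟩

theorem IsDefinedBy.exists_root {β : F} (h : IsDefinedBy N β) :
    ∃ y : N, y ∉ Set.range (algebraMap F N) ∧ y ^ 3 = 3 * y + algebraMap F N β := by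
  have h3 := h.finrank
  obtain ⟨y, hy, hp⟩ := h
  refine ⟨y, notMem_range_of_adjoin_eq_top h3 hy, ?_⟩
  have := minpoly.aeval F y
  rw [hp, aeval_cubicPoly] at this
  linear_combination this

theorem IsDefinedBy.isSeparable {β : F} (hF : (3 : F) ≠ 0) (h : IsDefinedBy N β) :
    Algebra.IsSeparable F N := by
  have h3 := h.finrank
  have hfd : FiniteDimensional F N := FiniteDimensional.of_finrank_pos (by omega)
  obtain ⟨y, hy, hp⟩ := h
  have hirr := minpoly.irreducible (Algebra.IsIntegral.isIntegral (R := F) y)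
  have hsep : IsSeparable F y := by
    refine (separable_iff_derivative_ne_zero hirr).2 fun h0 => ?_
    have h1 := congrArg (coeff · 2) h0
    rw [hp, cubicPoly] at h1
    have : (3 : F[X]) = C 3 := by rw [map_ofNat]
    simp only [this, derivative_sub, derivative_mul, derivative_X_pow, derivative_C, derivative_X,
      coeff_sub, coeff_zero] at h1
    simp at h1
    exact hF h1
  have := IntermediateField.isSeparable_adjoin_simple_iff_isSeparable F N |>.2 hsep
  rw [hy] at this
  exact AlgEquiv.Algebra.isSeparable IntermediateField.topEquiv

/-- A cube root of `f` in a field containing a root of `X³ - 3 X - (f + f⁻¹)`. -/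
theorem exists_cube_root {f : F} (hf : f ≠ 0) {y : N} (hy : y ∉ Set.range (algebraMap F N))
    (h : y ^ 3 = 3 * y + algebraMap F N (f + f⁻¹)) :
    ∃ w : N, w ≠ 0 ∧ w ^ 3 = algebraMap F N f ∧ w + w⁻¹ = y := by
  have hy1 : y ^ 2 - 1 ≠ 0 := by
    intro h1
    have h2 : (y - 1) * (y + 1) = 0 := by linear_combination h1
    rcases mul_eq_zero.1 h2 with h2 | h2
    · exact hy ⟨1, by rw [map_one]; linear_combination -h2⟩
    · exact hy ⟨-1, by rw [map_neg, map_one]; linear_combination -h2⟩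
  rw [map_add, map_inv₀] at h
  set A := algebraMap F N f with hA
  have hA0 : A ≠ 0 := by simpa [hA] using hf
  -- `w` is determined by `w + w⁻¹ = y` and `w³ = f`: these give `w² = y w - 1`, hence
  -- `f = w³ = (y² - 1) w - y`
  obtain ⟨w, hw⟩ : ∃ w, w * (y ^ 2 - 1) = A + y := ⟨_, div_mul_cancel₀ _ hy1⟩
  have hquad : w ^ 2 - y * w + 1 = 0 := by
    have : (w ^ 2 - y * w + 1) * (y ^ 2 - 1) ^ 2 = 0 := by
      have h' : A * (y ^ 3 - 3 * y) = A ^ 2 + 1 := by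
        rw [h]; field_simp; ring
      linear_combination (w * (y ^ 2 - 1) + A + y - y * (y ^ 2 - 1)) * hw - h'
    exact (mul_eq_zero.1 this).resolve_right (pow_ne_zero 2 hy1)
  have hw0 : w ≠ 0 := by
    rintro rfl
    simp at hquad
  refine ⟨w, hw0, by linear_combination (w + y) * hquad + hw, ?_⟩
  field_simp
  linear_combination hquad

end CubicFields

/-! ### The compositum of a cubic and a quadratic extension -/

section Compositum

variable {k : Type u} {K : Type v} {F : Type w} [Field k] [Field K] [Field F]
  [Algebra k K] [Algebra k F] [Algebra K F] [IsScalarTower k K F]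

/-- The compositum `N = F M` of a quadratic extension `F / K` and a cubic extension `M / K`, and the
extension to `N` of an automorphism of `F / K`. -/
theorem exists_compositum (h2 : Module.finrank K F = 2) (σ : F ≃ₐ[K] F) {M : Type v} [Field M]
    [Algebra k M] [Algebra K M] [IsScalarTower k K M] (h3 : Module.finrank K M = 3) :
    ∃ (N : Type max w v) (_ : Field N) (_ : Algebra k N) (_ : Algebra K N) (_ : Algebra F N)
      (_ : Algebra M N) (_ : IsScalarTower k F N) (_ : IsScalarTower k M N)
      (_ : IsScalarTower K F N) (_ : IsScalarTower K M N) (_ : IsScalarTower k K N),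
      Module.finrank F N = 3 ∧ Module.finrank M N = 2 ∧
      (∃ φ : F ⊗[K] M ≃ₐ[F] N, ∀ m, φ (1 ⊗ₜ m) = algebraMap M N m) ∧
      ∃ τ : N ≃ₐ[M] N, ∀ z, τ (algebraMap F N z) = algebraMap F N (σ z) := by
  have hfdF : FiniteDimensional K F := FiniteDimensional.of_finrank_pos (by omega)
  have hfdM : FiniteDimensional K M := FiniteDimensional.of_finrank_pos (by omega)
  -- a residue field of the tensor product, which will turn out to be the tensor product itself
  obtain ⟨N, _, q, hsurj⟩ : ∃ (N : Type max w v) (_ : Field N) (q : F ⊗[K] M →+* N),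
      Function.Surjective q := by
    obtain ⟨I, hI⟩ := Ideal.exists_maximal (F ⊗[K] M)
    exact ⟨_, Ideal.Quotient.field I, Ideal.Quotient.mk I, Ideal.Quotient.mk_surjective⟩
  let ψF : F →+* N := q.comp Algebra.TensorProduct.includeLeftRingHom
  let ψM : M →+* N := q.comp
    (Algebra.TensorProduct.includeRight : M →ₐ[K] F ⊗[K] M).toRingHom
  have hψ : ∀ c : K, ψF (algebraMap K F c) = ψM (algebraMap K M c) := fun c =>
    congrArg q
      ((Algebra.TensorProduct.includeRight : M →ₐ[K] F ⊗[K] M).commutes c).symm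
  let _ : Algebra F N := ψF.toAlgebra
  let _ : Algebra M N := ψM.toAlgebra
  let _ : Algebra K N := (ψF.comp (algebraMap K F)).toAlgebra
  let _ : Algebra k N := (ψF.comp (algebraMap k F)).toAlgebra
  have t1 : IsScalarTower k F N := IsScalarTower.of_algebraMap_eq fun _ => rfl
  have t2 : IsScalarTower K F N := IsScalarTower.of_algebraMap_eq fun _ => rfl
  have t3 : IsScalarTower K M N := IsScalarTower.of_algebraMap_eq hψ
  have t4 : IsScalarTower k M N := IsScalarTower.of_algebraMap_eq fun c => by
    change ψF (algebraMap k F c) = ψM (algebraMap k M c)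
    rw [IsScalarTower.algebraMap_apply k K F, hψ, ← IsScalarTower.algebraMap_apply]
  have t5 : IsScalarTower k K N := IsScalarTower.of_algebraMap_eq fun c => by
    change ψF (algebraMap k F c) = ψF (algebraMap K F (algebraMap k K c))
    rw [← IsScalarTower.algebraMap_apply]
  let φ : F ⊗[K] M →ₐ[F] N := { q with commutes' := fun _ => rfl }
  have hF3 : Module.finrank F (F ⊗[K] M) = 3 := by rw [Module.finrank_baseChange, h3]
  have hfd : FiniteDimensional F N := Module.Finite.of_surjective φ.toLinearMap hsurj
  have hle : Module.finrank F N ≤ 3 := by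
    rw [← hF3]
    exact LinearMap.finrank_le_finrank_of_surjective (f := φ.toLinearMap) hsurj
  have hpos : 0 < Module.finrank F N := Module.finrank_pos
  -- the degrees two and three are coprime
  have hmul : 2 * Module.finrank F N = 3 * Module.finrank M N := by
    rw [← h2, ← h3, Module.finrank_mul_finrank, Module.finrank_mul_finrank]
  have hN3 : Module.finrank F N = 3 := by omega
  have hinj : Function.Injective φ := by
    have := (LinearMap.injective_iff_surjective_of_finrank_eq_finrank (f := φ.toLinearMap)
      (by rw [hF3, hN3])).2 hsurj
    exact this
  let φ' : F ⊗[K] M ≃ₐ[F] N := AlgEquiv.ofBijective φ ⟨hinj, hsurj⟩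
  have hφM : ∀ m, φ' (1 ⊗ₜ m) = algebraMap M N m := fun _ => rfl
  have hφF : ∀ z, φ' (z ⊗ₜ 1) = algebraMap F N z := fun _ => rfl
  -- the automorphism acts on the first factor
  let θ : F ⊗[K] M ≃ₐ[K] F ⊗[K] M := Algebra.TensorProduct.congr σ AlgEquiv.refl
  refine ⟨N, inferInstance, inferInstance, inferInstance, inferInstance, inferInstance, t1, t4, t2,
    t3, t5, hN3, by omega, ⟨φ', hφM⟩, ?_⟩
  refine ⟨AlgEquiv.ofRingEquiv (f := φ'.symm.toRingEquiv.trans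
    (θ.toRingEquiv.trans φ'.toRingEquiv)) fun m => ?_, fun z => ?_⟩
  · change φ' (θ (φ'.symm (algebraMap M N m))) = _
    rw [← hφM, AlgEquiv.symm_apply_apply]
    change φ' ((σ 1) ⊗ₜ m) = _
    rw [map_one]
  · change φ' (θ (φ'.symm (algebraMap F N z))) = _
    rw [← hφF, AlgEquiv.symm_apply_apply]
    rfl

end Compositum

/-! ### Ramification in Kummer extensions and constant extensions -/

section Ramification

open Polynomial

variable {k K F : Type*} [Field k] [Field K] [Field F] [Algebra k K] [Algebra k F] [Algebra K F]

theorem Place.v_three (P : Place k K) (h3 : (3 : k) ≠ 0) : P.v 3 = 1 := by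
  have := P.trivial 3 h3
  rwa [map_ofNat] at this

theorem three_ne_zero_of_algebra (h3 : (3 : k) ≠ 0) : (3 : F) ≠ 0 := by
  have := (_root_.map_ne_zero (algebraMap k F)).2 h3
  rwa [map_ofNat] at this

/-- Adjoining a cube root of a unit is unramified. -/
theorem HasRamificationIndex.eq_one_of_cube (h3 : (3 : k) ≠ 0) (hdeg : Module.finrank K F = 3)
    {w : F} (hw : w ∉ Set.range (algebraMap K F)) {f : K} (hf : w ^ 3 = algebraMap K F f)
    {𝔓 : Place k F} {𝔭 : Place k K} {e : ℕ} (he : HasRamificationIndex 𝔓 𝔭 e)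
    (h0 : 𝔭.v f = 1) : e = 1 := by
  have hfd : FiniteDimensional K F := FiniteDimensional.of_finrank_pos (by omega)
  have hwv : 𝔓.v w = 1 := by
    have := congrArg 𝔓.v hf
    rw [map_pow, (he.v_eq_one_iff f).2 h0] at this
    exact (pow_eq_one_iff_of_nonneg zero_le three_ne_zero).1 this
  refine he.eq_one_of_separable w (adjoin_eq_top_of_finrank_three hdeg hw) (X ^ 3 - C f)
    (monic_X_pow_sub_C f three_ne_zero) (fun i => ?_) (by simp [hf]) ?_
  · rw [coeff_sub, coeff_X_pow, coeff_C]
    refine 𝔭.v_sub_le_one ?_ ?_ <;> split_ifs <;> simp [h0]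
  · have h3F := 𝔓.v_three h3
    simp only [map_sub, derivative_X_pow, derivative_C, sub_zero, aeval_X,
      Nat.cast_ofNat, map_mul, hwv, map_ofNat, h3F, mul_one, Nat.reduceSub, map_pow, one_pow]

/-- Constant extensions are unramified. -/
theorem HasRamificationIndex.eq_one_of_constant [PerfectField k] [IsScalarTower k K F]
    [FiniteDimensional K F]
    {θ : F} (hθ : IsAlgebraic k θ) (htop : IntermediateField.adjoin K {θ} = ⊤)
    {𝔓 : Place k F} {𝔭 : Place k K} {e : ℕ} (he : HasRamificationIndex 𝔓 𝔭 e) : e = 1 := by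
  have hint := hθ.isIntegral
  refine he.eq_one_of_separable θ htop ((minpoly k θ).map (algebraMap k K))
    ((minpoly.monic hint).map _) (fun i => ?_) (by simp) ?_
  · rw [coeff_map]
    exact 𝔭.v_algebraMap_le_one _
  · rw [derivative_map, aeval_map_algebraMap]
    have halg : IsAlgebraic k (aeval θ (derivative (minpoly k θ))) := by
      have h1 := aeval_algHom_apply (algebraicClosure k F).val
        ⟨θ, mem_algebraicClosure_iff.2 hθ⟩ (derivative (minpoly k θ))
      change aeval θ (derivative (minpoly k θ)) = _ at h1
      rw [h1]
      exact mem_algebraicClosure_iff.1 (Subtype.property _)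
    refine 𝔓.v_eq_one_of_isAlgebraic ?_ halg
    have hirr := minpoly.irreducible hint
    exact (PerfectField.separable_of_irreducible hirr).aeval_derivative_ne_zero
      (minpoly.aeval k θ)

/-- The order of a root of `X³ - 3 X - β` at a pole of `β`. -/
theorem Place.three_mul_ord_of_root (P : Place k F) {y β : F} (h : y ^ 3 = 3 * y + β)
    (hβ : P.ord β < 0) : 3 * P.ord y = P.ord β := by
  have hβ0 : β ≠ 0 := by rintro rfl; simp at hβ
  have hβ1 : 1 < P.v β := by rw [← not_le, P.v_le_one_iff hβ0]; omega
  have h3 : P.v 3 ≤ 1 := by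
    have := P.v_algebraMap_le_one 3
    rwa [map_ofNat] at this
  have hy : 1 < P.v y := by
    by_contra! hy
    have : β = y ^ 3 - 3 * y := by rw [h]; ring
    refine absurd hβ1 (not_lt.2 ?_)
    rw [this]
    refine P.v_sub_le_one ?_ (P.v_mul_le_one h3 hy)
    rw [map_pow]
    exact pow_le_one₀ zero_le hy
  have hlt : P.v (3 * y) < P.v (y ^ 3) := by
    rw [map_mul, map_pow]
    calc P.v 3 * P.v y ≤ P.v y := mul_le_of_le_one_left' h3
      _ = P.v y ^ 1 := (pow_one _).symm
      _ < P.v y ^ 3 := pow_lt_pow_right₀ hy (by omega)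
  have hv : P.v β = P.v (y ^ 3) := by
    have : β = y ^ 3 - 3 * y := by rw [h]; ring
    rw [this, Valuation.map_sub_eq_of_lt_left _ hlt]
  have : P.ord β = P.ord (y ^ 3) := by rw [Place.ord, Place.ord, hv]
  rw [this, P.ord_pow]; norm_num

/-- A root of `X³ - 3 X - β` in `K` would have a third of the order of `β`. -/
theorem irreducible_cubicPoly (P : Place k K) {β : K} (hβ : P.ord β < 0) (h3 : ¬ 3 ∣ P.ord β) :
    Irreducible (cubicPoly β) := by
  refine irreducible_of_degree_le_three_of_not_isRoot
    (by rw [natDegree_cubicPoly]; decide) fun c hc => h3 ⟨P.ord c, ?_⟩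
  have h1 : aeval c (cubicPoly β) = 0 := by rwa [coe_aeval_eq_eval]
  rw [aeval_cubicPoly] at h1
  exact (P.three_mul_ord_of_root (β := β) (by
    have : algebraMap K K β = β := rfl
    rw [this] at h1
    linear_combination h1) hβ).symm

/-- A pole of `β` of order prime to three is totally ramified: the order of a root at a place above
is `e / 3` times that of `β`. -/
theorem HasRamificationIndex.eq_three_of_root [FiniteDimensional K F]
    (hdeg : Module.finrank K F = 3) {y : F} {β : K} (h : y ^ 3 = 3 * y + algebraMap K F β)
    {𝔓 : Place k F} {𝔭 : Place k K} {e : ℕ} (he : HasRamificationIndex 𝔓 𝔭 e)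
    (hβ : 𝔭.ord β < 0) (h3 : ¬ 3 ∣ 𝔭.ord β) : e = 3 := by
  have hle := he.index_le_finrank
  have h0 := he.1
  have hneg : 𝔓.ord (algebraMap K F β) < 0 := by rw [he.ord]; nlinarith
  have h4 := 𝔓.three_mul_ord_of_root h hneg
  rw [he.ord] at h4
  have : (3 : ℤ) ∣ e := by
    have h5 : (3 : ℤ) ∣ e * 𝔭.ord β := ⟨_, h4.symm⟩
    exact (Int.prime_three.dvd_or_dvd h5).resolve_right h3
  omega

/-- At a zero or a pole of `z`, one of the terms of `z + z⁻¹` dominates. -/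
theorem Place.ord_add_inv (P : Place k F) {z : F} (hz : z ≠ 0) (h : P.ord z ≠ 0) :
    P.ord (z + z⁻¹) = -|P.ord z| := by
  have hlt : ∀ y : F, y ≠ 0 → 0 < P.ord y → P.ord (y + y⁻¹) = -P.ord y := fun y hy h => by
    have h1 : P.v y < P.v y⁻¹ :=
      ((P.v_lt_one_iff hy).2 h).trans (by
        rw [map_inv₀, one_lt_inv₀ (zero_lt_iff.2 ((Valuation.ne_zero_iff _).2 hy))]
        exact (P.v_lt_one_iff hy).2 h)
    rw [Place.ord, Valuation.map_add_eq_of_lt_right _ h1, ← P.ord_inv, Place.ord]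
  rcases lt_or_gt_of_ne h with h' | h'
  · rw [abs_of_neg h', ← P.ord_inv]
    have := hlt z⁻¹ (inv_ne_zero hz) (by rw [P.ord_inv]; omega)
    rw [inv_inv, add_comm] at this
    rw [this, P.ord_inv]
  · rw [abs_of_pos h', hlt z hz h']

theorem Place.v_add_inv_le_one (P : Place k F) {z : F} (hz : z ≠ 0) (h : P.ord z = 0) :
    P.v (z + z⁻¹) ≤ 1 := by
  have h1 := (P.v_eq_one_iff hz).2 h
  exact P.v_add_le_one h1.le (by rw [map_inv₀, h1, inv_one])

end Ramification

/-! ### Kummer generators -/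

section Kummer

variable {k K F : Type*} [Field k] [Field K] [Field F] [Algebra k K] [Algebra k F] [Algebra K F]
  [IsScalarTower k K F] {σ : F ≃ₐ[K] F} {T : Finset (Place k K)} {𝔓 : Place k K → Place k F}

/-- The values of the sign divisor. -/
theorem signDivisor_apply_of_mem (h2 : Module.finrank K F = 2) (hσ : σ ≠ 1)
    (h𝔓 : ∀ 𝔭 ∈ T, LiesOver (𝔓 𝔭) 𝔭 ∧ (𝔓 𝔭).conj σ ≠ 𝔓 𝔭) {𝔭 : Place k K} (h𝔭 : 𝔭 ∈ T) :
    signDivisor σ T 𝔓 (𝔓 𝔭) = -1 ∧ signDivisor σ T 𝔓 ((𝔓 𝔭).conj σ) = 1 := by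
  classical
  have h1 : (∑ 𝔮 ∈ T, Finsupp.single (𝔓 𝔮) 1 : Divisor k F) (𝔓 𝔭) = 1 := by
    rw [Finsupp.finsetSum_apply, Finset.sum_eq_single_of_mem 𝔭 h𝔭, Finsupp.single_eq_same]
    intro 𝔮 h𝔮 hne
    rw [Finsupp.single_apply, if_neg]
    intro h
    exact hne (LiesOver.place_eq (h𝔓 𝔮 h𝔮).1 (h ▸ (h𝔓 𝔭 h𝔭).1))
  have h0 : (∑ 𝔮 ∈ T, Finsupp.single (𝔓 𝔮) 1 : Divisor k F) ((𝔓 𝔭).conj σ) = 0 := by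
    rw [Finsupp.finsetSum_apply]
    refine Finset.sum_eq_zero fun 𝔮 h𝔮 => ?_
    rw [Finsupp.single_apply, if_neg]
    intro h
    obtain rfl := LiesOver.place_eq (h𝔓 𝔮 h𝔮).1 (h ▸ (h𝔓 𝔭 h𝔭).1.conj)
    exact (h𝔓 𝔮 h𝔮).2 h.symm
  rw [signDivisor_apply h2 hσ, signDivisor_apply h2 hσ, Place.conj_conj h2 hσ, h0, h1]
  norm_num

theorem signDivisor_apply_of_notMem (h2 : Module.finrank K F = 2) (hσ : σ ≠ 1)
    (h𝔓 : ∀ 𝔭 ∈ T, LiesOver (𝔓 𝔭) 𝔭 ∧ (𝔓 𝔭).conj σ ≠ 𝔓 𝔭) {𝔭 : Place k K} (h𝔭 : 𝔭 ∉ T)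
    {𝔔 : Place k F} (h𝔔 : LiesOver 𝔔 𝔭) : signDivisor σ T 𝔓 𝔔 = 0 := by
  classical
  have h0 : ∀ 𝔔 : Place k F, LiesOver 𝔔 𝔭 →
      (∑ 𝔮 ∈ T, Finsupp.single (𝔓 𝔮) 1 : Divisor k F) 𝔔 = 0 := fun 𝔔 h𝔔 => by
    rw [Finsupp.finsetSum_apply]
    refine Finset.sum_eq_zero fun 𝔮 h𝔮 => ?_
    rw [Finsupp.single_apply, if_neg]
    intro h
    subst h
    exact h𝔭 (LiesOver.place_eq (h𝔓 𝔮 h𝔮).1 h𝔔 ▸ h𝔮)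
  rw [signDivisor_apply h2 hσ, h0 𝔔 h𝔔, h0 _ h𝔔.conj, sub_zero]

variable (σ T 𝔓) in
/-- A function `f` of norm one whose divisor is the sign divisor modulo three, and is supported over
`T`. The norm condition makes the extension of `F` by a cube root of `f` descend to a cubic
extension of `K`, and the condition on the divisor determines its ramification and the signs. -/
structure IsKummerGenerator (f : F) : Prop where
  mul_conj : f * σ f = 1
  ord_modEq : ∀ 𝔔 : Place k F, 𝔔.ord f ≡ signDivisor σ T 𝔓 𝔔 [ZMOD 3]
  ord_eq_zero : ∀ (𝔔 : Place k F) (𝔭 : Place k K), LiesOver 𝔔 𝔭 → 𝔭 ∉ T → 𝔔.ord f = 0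

theorem IsKummerGenerator.ne_zero {f : F} (hf : IsKummerGenerator σ T 𝔓 f) : f ≠ 0 :=
  left_ne_zero_of_mul (hf.mul_conj ▸ one_ne_zero)

theorem IsKummerGenerator.conj_eq {f : F} (hf : IsKummerGenerator σ T 𝔓 f) : σ f = f⁻¹ :=
  eq_inv_of_mul_eq_one_right hf.mul_conj

theorem IsKummerGenerator.mul_normOne {f : F} (hf : IsKummerGenerator σ T 𝔓 f) {u : F}
    (hu : u ∈ normOne k σ) : IsKummerGenerator σ T 𝔓 (u * f) := by
  have hu0 : u ≠ 0 := left_ne_zero_of_mul (hu.2 ▸ one_ne_zero)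
  have hord : ∀ 𝔔 : Place k F, 𝔔.ord (u * f) = 𝔔.ord f := fun 𝔔 => by
    rw [𝔔.ord_mul hu0 hf.ne_zero, (𝔔.v_eq_one_iff hu0).1
      (𝔔.v_eq_one_of_isAlgebraic hu0 (mem_algebraicClosure_iff.1 hu.1)), zero_add]
  refine ⟨?_, fun 𝔔 => ?_, fun 𝔔 𝔭 h h' => ?_⟩
  · rw [map_mul]
    linear_combination u * σ u * hf.mul_conj + hu.2
  · rw [hord]; exact hf.ord_modEq 𝔔
  · rw [hord]; exact hf.ord_eq_zero 𝔔 𝔭 h h'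

theorem IsKummerGenerator.exists_sum (h2 : Module.finrank K F = 2) (hσ : σ ≠ 1) {f : F}
    (hf : IsKummerGenerator σ T 𝔓 f) : ∃ β : K, algebraMap K F β = f + f⁻¹ := by
  refine exists_eq_algebraMap_of_fixed h2 hσ ?_
  rw [map_add, map_inv₀, hf.conj_eq, inv_inv, add_comm]

/-- At the places in `T`, the sum `f + f⁻¹` has a pole of the order of that of `f` or `f⁻¹`. -/
theorem IsKummerGenerator.ord_of_mem (h2 : Module.finrank K F = 2) (hσ : σ ≠ 1)
    (h𝔓 : ∀ 𝔭 ∈ T, LiesOver (𝔓 𝔭) 𝔭 ∧ (𝔓 𝔭).conj σ ≠ 𝔓 𝔭) {f : F}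
    (hf : IsKummerGenerator σ T 𝔓 f) {β : K} (hβ : algebraMap K F β = f + f⁻¹)
    {𝔭 : Place k K} (h𝔭 : 𝔭 ∈ T) :
    𝔭.ord β = -|(𝔓 𝔭).ord f| ∧ 𝔭.ord β < 0 ∧ ¬ 3 ∣ 𝔭.ord β := by
  obtain ⟨⟨e, he⟩, hs⟩ := h𝔓 𝔭 h𝔭
  have h1 := hf.ord_modEq (𝔓 𝔭)
  rw [(signDivisor_apply_of_mem h2 hσ h𝔓 h𝔭).1] at h1
  obtain rfl := he.eq_one_of_split h2 hσ hs
  have h3 : ¬ (3 : ℤ) ∣ (𝔓 𝔭).ord f := fun h => by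
    rw [Int.ModEq] at h1; omega
  have h0 : (𝔓 𝔭).ord f ≠ 0 := fun h => h3 (h ▸ dvd_zero 3)
  have h4 := (𝔓 𝔭).ord_add_inv hf.ne_zero h0
  rw [← hβ, he.ord, Nat.cast_one, one_mul] at h4
  refine ⟨h4, by rw [h4]; have := abs_pos.2 h0; omega, ?_⟩
  rwa [h4, dvd_neg, dvd_abs]

theorem IsKummerGenerator.v_le_one_of_notMem (h2 : Module.finrank K F = 2) (hσ : σ ≠ 1) {f : F}
    (hf : IsKummerGenerator σ T 𝔓 f) {β : K} (hβ : algebraMap K F β = f + f⁻¹)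
    {𝔭 : Place k K} (h𝔭 : 𝔭 ∉ T) : 𝔭.v β ≤ 1 := by
  have hfd : FiniteDimensional K F := FiniteDimensional.of_finrank_pos (by omega)
  have hgal := isGalois_of_finrank_two h2 hσ
  obtain ⟨𝔔, e, he⟩ := 𝔭.exists_liesOver (F := F)
  rw [← he.v_le_one_iff, hβ]
  exact 𝔔.v_add_inv_le_one hf.ne_zero (hf.ord_eq_zero 𝔔 𝔭 ⟨e, he⟩ h𝔭)

theorem IsKummerGenerator.ord_lt_zero_iff (h2 : Module.finrank K F = 2) (hσ : σ ≠ 1)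
    (h𝔓 : ∀ 𝔭 ∈ T, LiesOver (𝔓 𝔭) 𝔭 ∧ (𝔓 𝔭).conj σ ≠ 𝔓 𝔭) {f : F}
    (hf : IsKummerGenerator σ T 𝔓 f) {β : K} (hβ : algebraMap K F β = f + f⁻¹)
    (𝔭 : Place k K) : 𝔭.ord β < 0 ↔ 𝔭 ∈ T := by
  refine ⟨fun h => ?_, fun h => (hf.ord_of_mem h2 hσ h𝔓 hβ h).2.1⟩
  by_contra hT
  have h1 := hf.v_le_one_of_notMem h2 hσ hβ hT
  have hβ0 : β ≠ 0 := by rintro rfl; simp at h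
  rw [𝔭.v_le_one_iff hβ0] at h1
  omega

theorem IsKummerGenerator.irreducible (h2 : Module.finrank K F = 2) (hσ : σ ≠ 1)
    (hT : T.Nonempty) (h𝔓 : ∀ 𝔭 ∈ T, LiesOver (𝔓 𝔭) 𝔭 ∧ (𝔓 𝔭).conj σ ≠ 𝔓 𝔭) {f : F}
    (hf : IsKummerGenerator σ T 𝔓 f) {β : K} (hβ : algebraMap K F β = f + f⁻¹) :
    Irreducible (cubicPoly β) := by
  obtain ⟨𝔭, h𝔭⟩ := hT
  obtain ⟨-, h1, h3⟩ := hf.ord_of_mem h2 hσ h𝔓 hβ h𝔭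
  exact irreducible_cubicPoly 𝔭 h1 h3

/-- A Kummer generator does not lie in `K`: its conjugate `f⁻¹` has a different order at the places
over `T`. -/
theorem IsKummerGenerator.conj_ne (h2 : Module.finrank K F = 2) (hσ : σ ≠ 1)
    (hT : T.Nonempty) (h𝔓 : ∀ 𝔭 ∈ T, LiesOver (𝔓 𝔭) 𝔭 ∧ (𝔓 𝔭).conj σ ≠ 𝔓 𝔭) {f : F}
    (hf : IsKummerGenerator σ T 𝔓 f) : σ f ≠ f := by
  obtain ⟨𝔭, h𝔭⟩ := hT
  intro h
  have h1 := hf.ord_modEq (𝔓 𝔭)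
  rw [(signDivisor_apply_of_mem h2 hσ h𝔓 h𝔭).1] at h1
  have h4 := congrArg (𝔓 𝔭).ord h
  rw [hf.conj_eq, Place.ord_inv] at h4
  rw [Int.ModEq] at h1
  omega

end Kummer

/-! ### Ramification in the cubic extension -/

section Diamond

open Polynomial

variable {k K F M N : Type*} [Field k] [Field K] [Field F] [Field M] [Field N]
  [Algebra k K] [Algebra k F] [Algebra k M] [Algebra k N]
  [Algebra K F] [Algebra K M] [Algebra K N] [Algebra F N] [Algebra M N]
  [IsScalarTower k K F] [IsScalarTower k K M] [IsScalarTower k F N] [IsScalarTower k M N]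
  [IsScalarTower K F N] [IsScalarTower K M N]
  {σ : F ≃ₐ[K] F} {τ : N ≃ₐ[M] N} {T : Finset (Place k K)} {𝔓 : Place k K → Place k F}

theorem ne_one_of_extends (hσ : σ ≠ 1) (hτ : ∀ z, τ (algebraMap F N z) = algebraMap F N (σ z)) :
    τ ≠ 1 := by
  rintro rfl
  obtain ⟨ω, hω⟩ := exists_apply_ne hσ
  exact hω ((algebraMap F N).injective (hτ ω)).symm

theorem algebraMap_notMem_range (h2 : Module.finrank K F = 2) (hM : Module.finrank K M = 3) {y : M}
    (hy : y ∉ Set.range (algebraMap K M)) : algebraMap M N y ∉ Set.range (algebraMap F N) := by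
  have hfd : FiniteDimensional K F := FiniteDimensional.of_finrank_pos (by omega)
  rintro ⟨z, hz⟩
  have h1 := natDegree_minpoly_of_finrank_three hM hy
  rw [← minpoly.algebraMap_eq (algebraMap M N).injective, ← hz,
    minpoly.algebraMap_eq (algebraMap F N).injective] at h1
  have := minpoly.natDegree_le (A := K) z
  omega

/-- The cube root `w` of `f` in `N = F M` with `w + w⁻¹` in `M`. The conjugation `τ` of `N / M`
fixes `w + w⁻¹` and does not fix `w³`, hence inverts `w`. -/
theorem exists_cube_root_of_isDefinedBy (h2 : Module.finrank K F = 2)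
    (hτ : ∀ z, τ (algebraMap F N z) = algebraMap F N (σ z)) {f : F} (hf : f * σ f = 1)
    (hne : σ f ≠ f) {β : K} (hβ : algebraMap K F β = f + f⁻¹) (hL : IsDefinedBy M β) :
    ∃ (w : N) (y : M), y ∉ Set.range (algebraMap K M) ∧ y ^ 3 = 3 * y + algebraMap K M β ∧
      w ≠ 0 ∧ w ^ 3 = algebraMap F N f ∧ w + w⁻¹ = algebraMap M N y ∧
      w ∉ Set.range (algebraMap F N) ∧ τ w = w⁻¹ := by
  have hf0 : f ≠ 0 := left_ne_zero_of_mul (hf ▸ one_ne_zero)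
  obtain ⟨y, hy, hroot⟩ := hL.exists_root
  have hyF : algebraMap M N y ∉ Set.range (algebraMap F N) :=
    algebraMap_notMem_range h2 hL.finrank hy
  have h1 := congrArg (algebraMap M N) hroot
  rw [map_pow, map_add, map_mul, map_ofNat, ← IsScalarTower.algebraMap_apply,
    IsScalarTower.algebraMap_apply K F N, hβ] at h1
  obtain ⟨w, hw0, hw, hwy⟩ := exists_cube_root hf0 hyF h1
  refine ⟨w, y, hy, hroot, hw0, hw, hwy, ?_, ?_⟩
  · rintro ⟨z, rfl⟩
    exact hyF ⟨z + z⁻¹, by rw [map_add, map_inv₀, hwy]⟩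
  · have h3 : τ w + (τ w)⁻¹ = w + w⁻¹ := by
      rw [← map_inv₀, ← map_add, hwy, τ.commutes]
    have hτw : τ w ≠ 0 := by simpa using hw0
    have h4 : (τ w - w) * (τ w - w⁻¹) = 0 := by
      field_simp at h3 ⊢
      linear_combination h3
    rcases mul_eq_zero.1 h4 with h5 | h5
    · exfalso
      have h6 := congrArg τ hw
      rw [map_pow, sub_eq_zero.1 h5, hw, hτ] at h6
      exact hne ((algebraMap F N).injective h6).symm
    · exact sub_eq_zero.1 h5

/-- Below a place `𝔑` of `N` over `𝔏`, the ramification indices along the paths through `M` and `F`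
multiply to the same number. -/
theorem exists_index_diamond [FiniteDimensional M N] [Algebra.IsSeparable M N]
    [Algebra.IsAlgebraic F N] [Algebra.IsAlgebraic K F] {𝔏 : Place k M} {𝔭 : Place k K} {e : ℕ}
    (h : HasRamificationIndex 𝔏 𝔭 e) :
    ∃ (𝔑 : Place k N) (𝔔 : Place k F) (a b d : ℕ), HasRamificationIndex 𝔑 𝔏 a ∧
      HasRamificationIndex 𝔑 𝔔 b ∧ HasRamificationIndex 𝔔 𝔭 d ∧ e * a = d * b := by
  obtain ⟨𝔑, a, ha⟩ := 𝔏.exists_liesOver (F := N)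
  obtain ⟨𝔔, b, hb⟩ := 𝔑.exists_restriction (K := F)
  obtain ⟨𝔮, d, hd⟩ := 𝔔.exists_restriction (K := K)
  obtain rfl := (ha.trans h).place_eq (hb.trans hd)
  exact ⟨𝔑, 𝔔, a, b, d, ha, hb, hd, (ha.trans h).index_eq (hb.trans hd)⟩

/-- Some place over `𝔔` does not have `w² ≡ 1`: otherwise `(w² - 1) / π` would be integral for a
uniformizer `π`, but its trace is `-3 / π`, since the trace of `w²` vanishes. -/
theorem exists_not_v_sub_lt [FiniteDimensional F N] [Algebra.IsSeparable F N] (h3 : (3 : k) ≠ 0)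
    (hN : Module.finrank F N = 3) {w : N} (hw : w ∉ Set.range (algebraMap F N)) {f : F}
    (hwf : w ^ 3 = algebraMap F N f) (𝔔 : Place k F) (hf : 𝔔.v f = 1) :
    ∃ 𝔑 : Place k N, HasRamificationIndex 𝔑 𝔔 1 ∧ ¬ 𝔑.v (w ^ 2 - 1) < 1 := by
  by_contra! hall
  have hf0 : f ≠ 0 := by rintro rfl; simp at hf
  have hw0 : w ≠ 0 := by rintro rfl; exact hw ⟨0, map_zero _⟩
  obtain ⟨t, ht0, ht⟩ := 𝔔.exists_uniformizer
  have ht0' : algebraMap F N t ≠ 0 := by simpa using ht0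
  have hint : IsIntegral 𝔔.ring ((w ^ 2 - 1) * algebraMap F N t⁻¹) := by
    refine 𝔔.isIntegral_of_forall _ ?_
    rintro 𝔑 ⟨e, he⟩
    obtain rfl := he.eq_one_of_cube h3 hN hw hwf hf
    have hlt := hall 𝔑 he
    by_cases h0 : w ^ 2 - 1 = 0
    · simp [h0]
    have hti : algebraMap F N t⁻¹ ≠ 0 := by simpa using ht0
    rw [𝔑.v_le_one_iff (mul_ne_zero h0 hti), 𝔑.ord_mul h0 hti, he.ord, 𝔔.ord_inv, ht]
    rw [𝔑.v_lt_one_iff h0] at hlt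
    omega
  have htr := Algebra.isIntegral_trace (L := F) hint
  have hw2 : w ^ 2 ∉ Set.range (algebraMap F N) := by
    rintro ⟨z, hz⟩
    refine hw ⟨f / z, ?_⟩
    rw [map_div₀, hz, ← hwf]
    field_simp
  have hmin : minpoly F (w ^ 2) = X ^ 3 - C (f ^ 2) :=
    minpoly_eq_of_finrank_three hN hw2 (monic_X_pow_sub_C _ three_ne_zero)
      (natDegree_X_pow_sub_C).le (by
        simp only [map_sub, map_pow, aeval_X, aeval_C, ← hwf]; ring)
  have htr2 : Algebra.trace F N (w ^ 2) = 0 := by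
    rw [trace_eq_finrank_mul_minpoly_nextCoeff, hmin,
      nextCoeff_of_natDegree_pos (by rw [natDegree_X_pow_sub_C]; omega), natDegree_X_pow_sub_C]
    rw [coeff_sub, coeff_X_pow, coeff_C]
    simp
  have htr3 : Algebra.trace F N ((w ^ 2 - 1) * algebraMap F N t⁻¹) = -3 * t⁻¹ := by
    rw [mul_comm, ← Algebra.smul_def, map_smul, map_sub, htr2]
    have := Algebra.trace_algebraMap (R := F) (S := N) (1 : F)
    rw [map_one, hN] at this
    rw [this]
    simp; ring
  rw [htr3] at htr
  have h5 := 𝔔.v_isIntegral_le_one (z := -3 * t⁻¹) (by simpa using htr)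
  rw [map_mul, Valuation.map_neg, 𝔔.v_three h3, one_mul, 𝔔.v_le_one_iff (inv_ne_zero ht0),
    𝔔.ord_inv, ht] at h5
  omega

variable (h3 : (3 : k) ≠ 0) (h2 : Module.finrank K F = 2) (hσ : σ ≠ 1)
  (h𝔓 : ∀ 𝔭 ∈ T, LiesOver (𝔓 𝔭) 𝔭 ∧ (𝔓 𝔭).conj σ ≠ 𝔓 𝔭) (hT : T.Nonempty)
  (hN : Module.finrank F N = 3) (hMN : Module.finrank M N = 2)
  (hτ : ∀ z, τ (algebraMap F N z) = algebraMap F N (σ z)) {f : F}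
  (hf : IsKummerGenerator σ T 𝔓 f) {β : K} (hβ : algebraMap K F β = f + f⁻¹)
  (hL : IsDefinedBy M β)

include h3 h2 hσ h𝔓 hT hN hMN hτ hf hβ hL

theorem index_eq_three_of_mem {𝔏 : Place k M} {𝔭 : Place k K} {e : ℕ}
    (he : HasRamificationIndex 𝔏 𝔭 e) (h𝔭 : 𝔭 ∈ T) : e = 3 := by
  have hM := hL.finrank
  have hfd : FiniteDimensional K M := FiniteDimensional.of_finrank_pos (by omega)
  obtain ⟨y, -, hy⟩ := hL.exists_root
  obtain ⟨-, h4, h5⟩ := hf.ord_of_mem h2 hσ h𝔓 hβ h𝔭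
  exact he.eq_three_of_root hM hy h4 h5

/-- Outside `T` the cube root is unramified over `F`, so that ramification comes from `F / K`. -/
theorem index_of_notMem {𝔏 : Place k M} {𝔭 : Place k K} {e : ℕ}
    (he : HasRamificationIndex 𝔏 𝔭 e) (h𝔭 : 𝔭 ∉ T) :
    e = 1 ∨ e = 2 ∧ 𝔭 ∈ placesWithIndex k K F 2 := by
  have hfdF : FiniteDimensional K F := FiniteDimensional.of_finrank_pos (by omega)
  have hfdN : FiniteDimensional F N := FiniteDimensional.of_finrank_pos (by omega)
  have hfdMN : FiniteDimensional M N := FiniteDimensional.of_finrank_pos (by omega)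
  have hgal := isGalois_of_finrank_two hMN (ne_one_of_extends hσ hτ)
  obtain ⟨w, y, -, -, hw0, hwf, hwy, hw, hτw⟩ := exists_cube_root_of_isDefinedBy h2 hτ hf.mul_conj
    (hf.conj_ne h2 hσ hT h𝔓) hβ hL
  obtain ⟨𝔑, 𝔔, a, b, d, ha, hb, hd, hab⟩ := exists_index_diamond (F := F) (N := N) he
  have hfv : 𝔔.v f = 1 := (𝔔.v_eq_one_iff hf.ne_zero).2 (hf.ord_eq_zero 𝔔 𝔭 ⟨d, hd⟩ h𝔭)
  obtain rfl := hb.eq_one_of_cube h3 hN hw hwf hfv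
  have hd2 := hd.index_le_finrank
  have h0 := ha.1
  have h1 := he.1
  rw [h2] at hd2
  rw [mul_one] at hab
  have hle : e ≤ 2 := by nlinarith
  interval_cases e
  · exact Or.inl rfl
  · have : d = 2 := by omega
    subst this
    exact Or.inr ⟨rfl, 𝔔, hd⟩

theorem notMem_of_ramified {𝔔 : Place k F} {𝔭 : Place k K} (h : HasRamificationIndex 𝔔 𝔭 2) :
    𝔭 ∉ T := by
  intro h𝔭
  obtain ⟨hover, hs⟩ := h𝔓 𝔭 h𝔭
  rcases LiesOver.eq_or_eq_conj h2 hσ ⟨2, h⟩ hover with h' | h'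
  · exact hs (by rw [h', h.conj_eq_of_ramified h2 hσ])
  · exact hs (by rw [h', Place.conj_conj h2 hσ, h.conj_eq_of_ramified h2 hσ])

/-- Over a ramified place of `F` some place of `M` has index two: at a place of `N` where `w²` is
not near one, `N / M` is unramified, since `τ` inverts `w`, but acts trivially on the residue field
at a ramified place. -/
theorem exists_index_two {𝔔 : Place k F} {𝔭 : Place k K} (h : HasRamificationIndex 𝔔 𝔭 2) :
    ∃ 𝔏 : Place k M, HasRamificationIndex 𝔏 𝔭 2 := by
  have hfdF : FiniteDimensional K F := FiniteDimensional.of_finrank_pos (by omega)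
  have hfdN : FiniteDimensional F N := FiniteDimensional.of_finrank_pos (by omega)
  have hfdMN : FiniteDimensional M N := FiniteDimensional.of_finrank_pos (by omega)
  have hM := hL.finrank
  have hfdM : FiniteDimensional K M := FiniteDimensional.of_finrank_pos (by omega)
  have h𝔭 : 𝔭 ∉ T := notMem_of_ramified h3 h2 hσ h𝔓 hT hN hMN hτ hf hβ hL h
  obtain ⟨w, y, hy, -, hw0, hwf, hwy, hw, hτw⟩ := exists_cube_root_of_isDefinedBy h2 hτ hf.mul_conj
    (hf.conj_ne h2 hσ hT h𝔓) hβ hL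
  have hsep : Algebra.IsSeparable F N := by
    refine IsDefinedBy.isSeparable (three_ne_zero_of_algebra h3) (β := algebraMap K F β)
      (isDefinedBy_of_root hN (y := algebraMap M N y) (algebraMap_notMem_range h2 hM hy) ?_)
    rw [hβ, map_add, map_inv₀, ← hwf, ← hwy]
    field_simp
    ring
  have hfv : 𝔔.v f = 1 := (𝔔.v_eq_one_iff hf.ne_zero).2 (hf.ord_eq_zero 𝔔 𝔭 ⟨2, h⟩ h𝔭)
  obtain ⟨𝔑, h𝔑, hnot⟩ := exists_not_v_sub_lt h3 hN hw hwf 𝔔 hfv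
  obtain ⟨𝔏, a, ha⟩ := 𝔑.exists_restriction (K := M)
  obtain ⟨𝔮, e, he⟩ := 𝔏.exists_restriction (K := K)
  obtain rfl := (ha.trans he).place_eq (h𝔑.trans h)
  have hae : e * a = 2 * 1 := (ha.trans he).index_eq (h𝔑.trans h)
  have ha2 := ha.index_le_finrank
  rw [hMN] at ha2
  have ha0 := ha.1
  have ha1 : a = 1 ∨ a = 2 := by omega
  rcases ha1 with rfl | rfl
  · have : e = 2 := by omega
    subst this
    exact ⟨𝔏, he⟩
  · -- if `N / M` were ramified, then `w⁻¹ = τ(w) ≡ w`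
    exfalso
    have hwv : 𝔑.v w = 1 := by
      have := congrArg 𝔑.v hwf
      rw [map_pow, (h𝔑.v_eq_one_iff f).2 hfv] at this
      exact (pow_eq_one_iff_of_nonneg zero_le three_ne_zero).1 this
    have h6 := ha.v_conj_sub_lt_of_ramified hMN (ne_one_of_extends hσ hτ) hwv.le
    rw [hτw] at h6
    refine hnot ?_
    have h7 : w ^ 2 - 1 = -(w * (w⁻¹ - w)) := by field_simp; ring
    rw [h7, Valuation.map_neg, map_mul, hwv, one_mul]
    exact h6

end Diamond

/-! ### The purely cubic closure -/

section Generators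

open Polynomial

variable {K F A : Type*} [Field K] [Field F] [Algebra K F] [CommRing A] [Algebra K A]

/-- The extension `K(θ)` maps to every algebra with a root of the minimal polynomial of `θ`. -/
theorem exists_algHom_of_root {θ : F} (hint : IsIntegral K θ)
    (htop : IntermediateField.adjoin K {θ} = ⊤) {a : A} (ha : aeval a (minpoly K θ) = 0) :
    ∃ φ : F →ₐ[K] A, φ θ = a := by
  let pb := IntermediateField.adjoin.powerBasis hint
  have hgen : minpoly K pb.gen = minpoly K θ := by
    rw [IntermediateField.adjoin.powerBasis_gen, IntermediateField.minpoly_gen]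
  let φ₀ : IntermediateField.adjoin K {θ} →ₐ[K] A := pb.lift a (by rw [hgen, ha])
  let ε : IntermediateField.adjoin K {θ} ≃ₐ[K] F :=
    (IntermediateField.equivOfEq htop).trans IntermediateField.topEquiv
  refine ⟨φ₀.comp ε.symm.toAlgHom, ?_⟩
  have h1 : ε pb.gen = θ := by
    rw [IntermediateField.adjoin.powerBasis_gen]
    rfl
  change φ₀ (ε.symm θ) = a
  rw [ε.symm_apply_eq.2 h1.symm]
  exact pb.lift_gen a _

theorem minpoly_eq_of_finrank_two (h2 : Module.finrank K F = 2) {z : F}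
    (hz : z ∉ Set.range (algebraMap K F)) {p : K[X]} (hp : p.Monic) (hd : p.natDegree ≤ 2)
    (h0 : aeval z p = 0) : minpoly K z = p := by
  have hfd : FiniteDimensional K F := FiniteDimensional.of_finrank_pos (by omega)
  have hint := Algebra.IsIntegral.isIntegral (R := K) z
  refine (eq_of_monic_of_dvd_of_natDegree_le (minpoly.monic hint) hp (minpoly.dvd K z h0) ?_).symm
  rwa [← IntermediateField.adjoin.finrank hint, adjoin_eq_top_of_finrank_two h2 hz,
    IntermediateField.finrank_top', h2]

theorem quadratic_monic (a b : K) : (X ^ 2 + (C a * X + C b) : K[X]).Monic :=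
  monic_X_pow_add ((degree_linear_le).trans_lt (by decide))

theorem natDegree_quadratic_le_two (a b : K) : (X ^ 2 + (C a * X + C b) : K[X]).natDegree ≤ 2 := by
  compute_degree

end Generators

section Closure

open Polynomial

/-- If a root of `X³ - 3 X - β` is a combination `c₁ v + c₂ v²` of powers of a cube root of `γ`,
then `c₁³ γ` is a root of `X² - β X + 1`. -/
theorem exists_quadratic_root {E N : Type*} [Field E] [Field N] [Algebra E N]
    (h3 : Module.finrank E N = 3) (hE : (3 : E) ≠ 0) {v y : N} {γ β : E}
    (hvE : v ∉ Set.range (algebraMap E N)) (hv : v ^ 3 = algebraMap E N γ)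
    (hyE : y ∉ Set.range (algebraMap E N)) (hy : y ^ 3 = 3 * y + algebraMap E N β) :
    ∃ A : E, A ^ 2 - β * A + 1 = 0 := by
  obtain ⟨c₀, c₁, c₂, h⟩ := exists_coordinates h3 hvE y
  obtain ⟨-, h1, h2⟩ := kummer_coordinates (a := 1) (b := β) h3 hE hv hyE
    (by rw [hy, map_one]; ring) h
  refine ⟨c₁ ^ 3 * γ, ?_⟩
  rw [← h2]
  linear_combination -((c₁ * c₂ * γ) ^ 2 + c₁ * c₂ * γ + 1) * h1

theorem exists_quadratic_root_of_isField {E N : Type*} [Field E] [CommRing N] [Algebra E N]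
    (hN : IsField N)
    (h3 : Module.finrank E N = 3) (hE : (3 : E) ≠ 0) {v y : N} {γ β : E}
    (hvE : v ∉ Set.range (algebraMap E N)) (hv : v ^ 3 = algebraMap E N γ)
    (hyE : y ∉ Set.range (algebraMap E N)) (hy : y ^ 3 = 3 * y + algebraMap E N β) :
    ∃ A : E, A ^ 2 - β * A + 1 = 0 := by
  let _ := hN.toField
  exact exists_quadratic_root h3 hE hvE hv hyE hy

/-- An element outside `K` stays outside the base ring after base change: a linear form that
vanishes on `K` separates it. -/
theorem one_tmul_notMem_range {K E M : Type*} [Field K] [Field E] [Field M] [Algebra K E]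
    [Algebra K M] {y : M} (hy : y ∉ Set.range (algebraMap K M)) :
    (1 ⊗ₜ[K] y : E ⊗[K] M) ∉ Set.range (algebraMap E (E ⊗[K] M)) := by
  rintro ⟨c, hc⟩
  have hy' : y ∉ Submodule.span K {(1 : M)} := by
    rw [Submodule.mem_span_singleton]
    rintro ⟨a, ha⟩
    exact hy ⟨a, by rw [Algebra.algebraMap_eq_smul_one, ha]⟩
  obtain ⟨g, hg, hg'⟩ := Submodule.exists_dual_map_eq_bot_of_notMem hy' inferInstance
  have hg1 : g 1 = 0 := by
    have : g 1 ∈ (Submodule.span K {(1 : M)}).map g :=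
      Submodule.mem_map_of_mem (Submodule.mem_span_singleton_self _)
    rwa [hg', Submodule.mem_bot] at this
  have h1 := congrArg (fun z => TensorProduct.rid K E (g.lTensor E z)) hc
  rw [Algebra.TensorProduct.algebraMap_apply] at h1
  simp [hg1] at h1
  exact hg ((smul_eq_zero.1 h1.symm).resolve_right one_ne_zero)

variable {k : Type u} {K : Type v} {F : Type w} [Field k] [Field K] [Field F]
  [Algebra k K] [Algebra k F] [Algebra K F] [IsScalarTower k K F] {σ : F ≃ₐ[K] F}

/-- Every field over which the cubic extension becomes purely cubic contains `F`, which is generated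
by a root `f` of `X² - β X + 1`. -/
theorem nonempty_algHom_of_isPurelyCubic (h2 : Module.finrank K F = 2) {f : F} (hK : (3 : K) ≠ 0)
    (hf : f * σ f = 1) (hne : σ f ≠ f) {β : K} (hβ : algebraMap K F β = f + f⁻¹)
    {M : Type*} [Field M] [Algebra K M] (hL : IsDefinedBy M β) {E : Type*} [Field E] [Algebra K E]
    (h : IsPurelyCubic E (E ⊗[K] M)) : Nonempty (F →ₐ[K] E) := by
  have hfd : FiniteDimensional K F := FiniteDimensional.of_finrank_pos (by omega)
  have hf0 : f ≠ 0 := left_ne_zero_of_mul (hf ▸ one_ne_zero)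
  obtain ⟨hN, v, -, γ, hv⟩ := h
  obtain ⟨y, hyK, hy⟩ := hL.exists_root
  have hroot := minpoly.aeval E v
  rw [hv, map_sub, map_pow, aeval_X, aeval_C, sub_eq_zero] at hroot
  have hE : (3 : E) ≠ 0 := by
    have := (_root_.map_ne_zero (algebraMap K E)).2 hK
    rwa [map_ofNat] at this
  obtain ⟨A, hA⟩ := exists_quadratic_root_of_isField (y := 1 ⊗ₜ y) (β := algebraMap K E β) hN
    (by rw [Module.finrank_baseChange, hL.finrank]) hE
    (by
      rintro ⟨c, rfl⟩
      have : Nontrivial (E ⊗[K] M) := hN.nontrivial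
      have h1 : minpoly E (algebraMap E (E ⊗[K] M) c) = X - C c := by
        let _ := hN.toField
        exact minpoly.eq_X_sub_C _ c
      have h5 := congrArg natDegree (h1.symm.trans hv)
      rw [natDegree_X_sub_C, natDegree_X_pow_sub_C] at h5
      omega)
    hroot (one_tmul_notMem_range hyK) (by
      have h4 := congrArg (Algebra.TensorProduct.includeRight : M →ₐ[K] E ⊗[K] M) hy
      rw [map_pow, map_add, map_mul, map_ofNat, AlgHom.commutes] at h4
      rw [← IsScalarTower.algebraMap_apply]
      exact h4)
  have hfK := notMem_range_of_apply_ne hne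
  obtain ⟨φ, -⟩ := exists_algHom_of_root (K := K) (θ := f) (a := A)
    (Algebra.IsIntegral.isIntegral f) (adjoin_eq_top_of_finrank_two h2 hfK) (by
      rw [minpoly_eq_of_finrank_two h2 hfK (quadratic_monic (-β) 1)
        (natDegree_quadratic_le_two _ _) (by
          simp only [map_add, map_mul, map_pow, aeval_X, aeval_C, map_neg, hβ, map_one]
          field_simp
          ring)]
      simp only [map_add, map_mul, map_pow, aeval_X, aeval_C, map_neg, map_one]
      linear_combination hA)
  exact ⟨φ⟩

theorem isPurelyCubic_of_algEquiv {B N : Type*} [CommRing B] [Algebra F B] [Field N] [Algebra F N]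
    (φ : B ≃ₐ[F] N) (hN : Module.finrank F N = 3) {w : N} (hw : w ∉ Set.range (algebraMap F N))
    {f : F} (hwf : w ^ 3 = algebraMap F N f) :
    IsPurelyCubic F B ∧ Algebra.adjoin F {φ.symm w} = ⊤ := by
  have hfd : FiniteDimensional F N := FiniteDimensional.of_finrank_pos (by omega)
  have htop : Algebra.adjoin F {φ.symm w} = ⊤ := by
    have h1 := Algebra.adjoin_eq_top_of_primitive_element (Algebra.IsAlgebraic.isAlgebraic w)
      (adjoin_eq_top_of_finrank_three hN hw)
    have h4 := AlgHom.map_adjoin φ.symm.toAlgHom {w}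
    rw [h1, Set.image_singleton, Algebra.map_top, (AlgHom.range_eq_top _).2 φ.symm.surjective] at h4
    exact h4.symm
  refine ⟨⟨φ.toMulEquiv.isField (Field.toIsField N), φ.symm w, htop, f, ?_⟩, htop⟩
  rw [minpoly.algEquiv_eq]
  exact minpoly_eq_of_finrank_three hN hw (monic_X_pow_sub_C _ three_ne_zero)
    (natDegree_X_pow_sub_C).le (by simp [hwf])

variable {x : K} {T : Finset (Place k K)} {𝔓 : Place k K → Place k F}

/-- A Kummer generator defines a cubic extension that corresponds to the data. -/
theorem IsKummerGenerator.corresponds [PerfectField k] (h3 : (3 : k) ≠ 0)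
    (h2 : Module.finrank K F = 2) (hσ : σ ≠ 1) (hT : T.Nonempty)
    (h𝔓 : ∀ 𝔭 ∈ T, LiesOver (𝔓 𝔭) 𝔭 ∧ (𝔓 𝔭).conj σ ≠ 𝔓 𝔭) {f : F}
    (hf : IsKummerGenerator σ T 𝔓 f) {β : K} (hβ : algebraMap K F β = f + f⁻¹)
    {M : Type v} [Field M] [Algebra k M] [Algebra K M] [IsScalarTower k K M]
    (hL : IsDefinedBy M β) : Corresponds σ T 𝔓 M := by
  have hM := hL.finrank
  have hfdM : FiniteDimensional K M := FiniteDimensional.of_finrank_pos (by omega)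
  have hK3 : (3 : K) ≠ 0 := three_ne_zero_of_algebra h3
  have hsep := hL.isSeparable hK3
  obtain ⟨N, _, _, _, _, _, _, _, _, _, _, hN, hMN, ⟨φ, hφ⟩, τ, hτ⟩ :=
    exists_compositum (k := k) h2 σ (M := M) hM
  have hne := hf.conj_ne h2 hσ hT h𝔓
  obtain ⟨w, y, hy, -, hw0, hwf, hwy, hw, hτw⟩ := exists_cube_root_of_isDefinedBy (K := K) (M := M)
    (N := N) h2 hτ hf.mul_conj hne hβ hL
  obtain ⟨hpc, htop⟩ := isPurelyCubic_of_algEquiv φ hN hw hwf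
  have hthree : ∀ {𝔏 : Place k M} {𝔭 : Place k K} {e : ℕ}, HasRamificationIndex 𝔏 𝔭 e → 𝔭 ∈ T →
      e = 3 := fun he h𝔭 => index_eq_three_of_mem h3 h2 hσ h𝔓 hT hN hMN hτ hf hβ hL he h𝔭
  have hindex : ∀ {𝔏 : Place k M} {𝔭 : Place k K} {e : ℕ}, HasRamificationIndex 𝔏 𝔭 e → 𝔭 ∉ T →
      e = 1 ∨ e = 2 ∧ 𝔭 ∈ placesWithIndex k K F 2 := fun he h𝔭 =>
    index_of_notMem h3 h2 hσ h𝔓 hT hN hMN hτ hf hβ hL he h𝔭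
  refine ⟨⟨hM, hsep, ?_⟩, ⟨hpc, fun E _ _ hE => ?_⟩, ?_, ?_, ?_⟩
  · rintro ⟨ℓ, hℓ, hℓtop⟩
    -- a constant extension is unramified, but the places in `T` are totally ramified
    have hfdℓ : FiniteDimensional k ℓ := FiniteDimensional.of_finrank_pos (by omega)
    obtain ⟨θ, hθ, hθK⟩ : ∃ θ ∈ ℓ, θ ∉ Set.range (algebraMap K M) := by
      by_contra! hall
      have hbot : IntermediateField.adjoin K (ℓ : Set M) ≤ ⊥ :=
        IntermediateField.adjoin_le_iff.2 fun θ hθ => IntermediateField.mem_bot.2 (hall θ hθ)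
      rw [hℓtop] at hbot
      exact hy (IntermediateField.mem_bot.1 (hbot IntermediateField.mem_top))
    obtain ⟨𝔭, h𝔭⟩ := hT
    obtain ⟨𝔏, e, he⟩ := 𝔭.exists_liesOver (F := M)
    have halg : IsAlgebraic k θ :=
      (isAlgebraic_algebraMap_iff (A := M) (a := (⟨θ, hθ⟩ : ℓ))
        (FaithfulSMul.algebraMap_injective ℓ M)).2 (Algebra.IsAlgebraic.isAlgebraic _)
    have h1 := he.eq_one_of_constant halg (adjoin_eq_top_of_finrank_three hM hθK)
    have h4 := hthree he h𝔭
    omega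
  · exact nonempty_algHom_of_isPurelyCubic h2 hK3 hf.mul_conj hne hβ hL hE
  · ext 𝔭
    constructor
    · rintro ⟨𝔏, h⟩
      by_contra h𝔭
      rcases hindex h h𝔭 with h | h <;> omega
    · intro h𝔭
      obtain ⟨𝔏, e, he⟩ := 𝔭.exists_liesOver (F := M)
      obtain rfl := hthree he h𝔭
      exact ⟨𝔏, he⟩
  · ext 𝔭
    constructor
    · rintro ⟨𝔏, h⟩
      by_cases h𝔭 : 𝔭 ∈ T
      · have := hthree h h𝔭
        omega
      · rcases hindex h h𝔭 with h | h
        · omega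
        · exact h.2
    · rintro ⟨𝔔, h⟩
      exact exists_index_two h3 h2 hσ h𝔓 hT hN hMN hτ hf hβ hL h
  · refine ⟨φ.symm w, f, hf.ne_zero, htop, ?_, hf.ord_modEq⟩
    rw [← map_pow, hwf, AlgEquiv.commutes]

end Closure

/-! ### Functions that are cubes up to constants -/

section Cubes

variable {k K F : Type*} [Field k] [Field K] [Field F] [Algebra k K] [Algebra k F] [Algebra K F]
  [IsScalarTower k K F] {σ : F ≃ₐ[K] F} {x : K}

/-- In genus zero a function whose divisor is divisible by three is a constant times a cube. -/
theorem exists_constant_mul_cube (h2 : Module.finrank K F = 2) (hσ : σ ≠ 1)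
    (hx : Transcendental k x) (htop : IntermediateField.adjoin k {x} = ⊤)
    (hg : HasGenus (algebraicClosure k F) F 0) {h : F} (h0 : h ≠ 0)
    (hord : ∀ 𝔔 : Place k F, 3 ∣ 𝔔.ord h) :
    ∃ u z : F, u ≠ 0 ∧ z ≠ 0 ∧ IsAlgebraic k u ∧ h = u * z ^ 3 := by
  obtain ⟨D, hD, hD0⟩ := exists_isDivisorOf h2 hσ hx htop h0
  let E : Divisor k F := D.mapRange (fun n => n / 3) (by norm_num)
  have hE : D = (3 : ℤ) • E := by
    ext 𝔔
    have : 3 ∣ D 𝔔 := hD 𝔔 ▸ hord 𝔔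
    rw [Finsupp.smul_apply, Finsupp.mapRange_apply, smul_eq_mul]
    omega
  have hE0 : Divisor.degree E = 0 := by
    rw [hE, Divisor.degree_zsmul] at hD0
    omega
  obtain ⟨z, hz0, -, hz⟩ := exists_isDivisorOf_of_degree_eq_zero h2 hσ hx htop hg hE0
  have hz3 : z ^ 3 ≠ 0 := pow_ne_zero 3 hz0
  refine ⟨h / z ^ 3, z, div_ne_zero h0 hz3, hz0, ?_, (div_mul_cancel₀ _ hz3).symm⟩
  refine isAlgebraic_of_forall_v_le_one h2 hσ hx htop fun 𝔔 => ?_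
  rw [𝔔.v_le_one_iff (div_ne_zero h0 hz3), 𝔔.ord_div h0 hz3, 𝔔.ord_pow, hD 𝔔, hz 𝔔, hE,
    Finsupp.smul_apply, smul_eq_mul]
  norm_num

/-- If moreover the function has norm one, both factors can be chosen of norm one. -/
theorem exists_normOne_mul_cube (h2 : Module.finrank K F = 2) (hσ : σ ≠ 1)
    (hx : Transcendental k x) (htop : IntermediateField.adjoin k {x} = ⊤)
    (hg : HasGenus (algebraicClosure k F) F 0) {h : F} (h1 : h * σ h = 1)
    (hord : ∀ 𝔔 : Place k F, 3 ∣ 𝔔.ord h) :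
    ∃ u ∈ normOne k σ, ∃ z : F, z * σ z = 1 ∧ h = u * z ^ 3 := by
  obtain ⟨u, z, hu0, hz0, hu, rfl⟩ := exists_constant_mul_cube h2 hσ hx htop hg
    (left_ne_zero_of_mul (h1 ▸ one_ne_zero)) hord
  -- the cube of the norm `m` of `z` is `(u σ(u))⁻¹`, so that `m` is a constant and `u m z` has
  -- norm one
  obtain ⟨m, hm⟩ : ∃ m, m = z * σ z := ⟨_, rfl⟩
  have hm0 : m ≠ 0 := by
    rw [hm]
    exact mul_ne_zero hz0 (by simpa using hz0)
  have hmσ : σ m = m := by rw [hm, map_mul, conj_conj h2 hσ, mul_comm]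
  have hum : u * σ u * m ^ 3 = 1 := by
    rw [map_mul, map_pow] at h1
    rw [← h1, hm]; ring
  have hualg : IsAlgebraic k (σ u) := isAlgebraic_conj hu
  have hmalg : IsAlgebraic k m := by
    refine IsAlgebraic.of_pow (n := 3) three_pos ?_
    have : m ^ 3 = (u * σ u)⁻¹ := eq_inv_of_mul_eq_one_right hum
    rw [this]
    exact (hu.mul hualg).inv
  have hnorm : (u * m * z) * σ (u * m * z) = 1 := by
    simp only [map_mul, hmσ]
    rw [← hum]
    linear_combination -(u * σ u * m ^ 2) * hm
  have hu' : u * (u * m)⁻¹ ^ 3 * σ (u * (u * m)⁻¹ ^ 3) = 1 := by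
    have e1 : u * z ^ 3 = u * (u * m)⁻¹ ^ 3 * (u * m * z) ^ 3 := by field_simp
    rw [e1, map_mul, map_pow σ (u * m * z)] at h1
    have e2 : (u * m * z) ^ 3 * σ (u * m * z) ^ 3 = 1 := by rw [← mul_pow, hnorm, one_pow]
    linear_combination h1 - u * (u * m)⁻¹ ^ 3 * σ (u * (u * m)⁻¹ ^ 3) * e2
  refine ⟨u * (u * m)⁻¹ ^ 3, ⟨?_, hu'⟩, u * m * z, hnorm, by field_simp⟩
  exact mem_algebraicClosure_iff.2 (hu.mul ((hu.mul hmalg).inv.pow 3))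

end Cubes

/-! ### Cubic extensions with a given Kummer generator -/

section Descent

variable {k K F M N : Type*} [Field k] [Field K] [Field F] [Field M] [Field N]
  [Algebra k K] [Algebra k F] [Algebra k M] [Algebra k N]
  [Algebra K F] [Algebra K M] [Algebra K N] [Algebra F N] [Algebra M N]
  [IsScalarTower k K F] [IsScalarTower k K M] [IsScalarTower k F N] [IsScalarTower k M N]
  [IsScalarTower K F N] [IsScalarTower K M N]
  {σ : F ≃ₐ[K] F} {τ : N ≃ₐ[M] N} {T : Finset (Place k K)} {𝔓 : Place k K → Place k F} {x : K}

/-- If a cube root `w` of `f` is inverted by the conjugation of `N / M`, then `w + w⁻¹` generates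
`M`. -/
theorem isDefinedBy_of_cube_root (hσ : σ ≠ 1) (hM : Module.finrank K M = 3)
    (hN : Module.finrank F N = 3) (hMN : Module.finrank M N = 2)
    (hτ : ∀ z, τ (algebraMap F N z) = algebraMap F N (σ z)) {w : N}
    (hw : w ∉ Set.range (algebraMap F N)) (hτw : τ w = w⁻¹) {f : F}
    (hwf : w ^ 3 = algebraMap F N f) {β : K} (hβ : algebraMap K F β = f + f⁻¹) :
    IsDefinedBy M β := by
  have hw0 : w ≠ 0 := by rintro rfl; exact hw ⟨0, map_zero _⟩
  obtain ⟨y, hy⟩ := exists_eq_algebraMap_of_fixed hMN (ne_one_of_extends hσ hτ) (z := w + w⁻¹)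
    (by rw [map_add, map_inv₀, hτw, inv_inv, add_comm])
  refine isDefinedBy_of_root hM (y := y) ?_ ?_
  · rintro ⟨c, rfl⟩
    have := (coordinates_eq_zero hN hw (a := 1) (b := -algebraMap K F c) (c := 1) (by
      rw [map_one, map_neg, ← IsScalarTower.algebraMap_apply,
        IsScalarTower.algebraMap_apply K M N, hy]
      field_simp
      ring)).1
    exact one_ne_zero this
  · refine (algebraMap M N).injective ?_
    rw [map_pow, map_add, map_mul, map_ofNat, ← IsScalarTower.algebraMap_apply,
      IsScalarTower.algebraMap_apply K F N, hβ, hy, map_add, map_inv₀, ← hwf]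
    field_simp
    ring

/-- Two cube roots that generate the same extension are proportional, up to inversion. -/
theorem exists_eq_mul_of_cube_roots (h3 : (3 : k) ≠ 0) (hN : Module.finrank F N = 3) {w w' : N}
    {f f' : F} (hw : w ∉ Set.range (algebraMap F N)) (hwf : w ^ 3 = algebraMap F N f)
    (hw' : w' ∉ Set.range (algebraMap F N)) (hwf' : w' ^ 3 = algebraMap F N f') :
    ∃ c : F, c ≠ 0 ∧ (w' = algebraMap F N c * w ∧ f' = c ^ 3 * f ∨
      w' = algebraMap F N c * w ^ 2 ∧ f' = c ^ 3 * f ^ 2) := by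
  have hf0 : f ≠ 0 := by
    rintro rfl
    rw [map_zero] at hwf
    exact hw ⟨0, by rw [map_zero, pow_eq_zero_iff three_ne_zero |>.1 hwf]⟩
  obtain ⟨c₀, c₁, c₂, h⟩ := exists_coordinates hN hw w'
  obtain ⟨rfl, h1, hf'⟩ := kummer_coordinates (a := 0) (b := f') hN (three_ne_zero_of_algebra h3)
    hwf hw' (by rw [hwf', map_zero]; ring) h
  have hc : c₁ ≠ 0 ∨ c₂ ≠ 0 := by
    by_contra! hc
    exact hw' ⟨0, by rw [h, hc.1, hc.2]; simp⟩
  rcases mul_eq_zero.1 ((mul_eq_zero.1 h1).resolve_right hf0) with rfl | rfl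
  · refine ⟨c₂, hc.resolve_left (by simp), Or.inr ⟨by rw [h]; simp, by rw [← hf']; ring⟩⟩
  · refine ⟨c₁, hc.resolve_right (by simp), Or.inl ⟨by rw [h]; simp, by rw [← hf']; ring⟩⟩

variable (h3 : (3 : k) ≠ 0) (h2 : Module.finrank K F = 2) (hσ : σ ≠ 1)
  (h𝔓 : ∀ 𝔭 ∈ T, LiesOver (𝔓 𝔭) 𝔭 ∧ (𝔓 𝔭).conj σ ≠ 𝔓 𝔭) (hT : T.Nonempty)
  (hM : Module.finrank K M = 3) (hN : Module.finrank F N = 3) (hMN : Module.finrank M N = 2)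
  (hτ : ∀ z, τ (algebraMap F N z) = algebraMap F N (σ z))

/-- A function whose divisor is the sign divisor modulo three is not a cube in `F`. -/
theorem notMem_range_of_cube (h2 : Module.finrank K F = 2) (hσ : σ ≠ 1)
    (h𝔓 : ∀ 𝔭 ∈ T, LiesOver (𝔓 𝔭) 𝔭 ∧ (𝔓 𝔭).conj σ ≠ 𝔓 𝔭) (hT : T.Nonempty) {g : F}
    (hg : ∀ 𝔔 : Place k F, 𝔔.ord g ≡ signDivisor σ T 𝔓 𝔔 [ZMOD 3]) {w : N}
    (hw : w ^ 3 = algebraMap F N g) : w ∉ Set.range (algebraMap F N) := by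
  rintro ⟨z, rfl⟩
  obtain ⟨𝔭, h𝔭⟩ := hT
  have h1 := hg (𝔓 𝔭)
  rw [← map_pow] at hw
  rw [← (algebraMap F N).injective hw, (signDivisor_apply_of_mem h2 hσ h𝔓 h𝔭).1,
    Place.ord_pow, Int.ModEq] at h1
  push_cast at h1
  omega

include h3 h2 hσ h𝔓 hT hM hN hMN hτ

/-- If `F M` is generated by a cube root of a function `g` whose divisor has the given signs, then
`M` is defined by a constant multiple of the given Kummer generator: the conjugation `τ` of `N / M`
inverts `τ(w) / w`, a cube root of `σ(g) / g`, and the divisor of `σ(g) / g` is `-2 ≡ 1` times that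
of `g` modulo three. -/
theorem exists_normOne_isDefinedBy (hx : Transcendental k x)
    (htop : IntermediateField.adjoin k {x} = ⊤)
    (hgenus : HasGenus (algebraicClosure k F) F 0) {f : F} (hf : IsKummerGenerator σ T 𝔓 f)
    {g : F} (hg0 : g ≠ 0) (hg : ∀ 𝔔 : Place k F, 𝔔.ord g ≡ signDivisor σ T 𝔓 𝔔 [ZMOD 3]) {w : N}
    (hwg : w ^ 3 = algebraMap F N g) :
    ∃ u ∈ normOne k σ, ∃ β : K, algebraMap K F β = u * f + (u * f)⁻¹ ∧ IsDefinedBy M β := by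
  have hw := notMem_range_of_cube h2 hσ h𝔓 hT hg hwg
  have hτ1 := ne_one_of_extends hσ hτ
  have hττ : ∀ z, τ (τ z) = z := conj_conj hMN hτ1
  have hw0 : w ≠ 0 := by rintro rfl; exact hw ⟨0, map_zero _⟩
  have hτw0 : τ w ≠ 0 := by simpa using hw0
  have hσg0 : σ g ≠ 0 := by simpa using hg0
  have hτw : τ w ∉ Set.range (algebraMap F N) := by
    rintro ⟨z, hz⟩
    exact hw ⟨σ z, by rw [← hτ, hz, hττ]⟩
  have hτwg : τ w ^ 3 = algebraMap F N (σ g) := by rw [← map_pow, hwg, hτ]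
  have hordσ : ∀ 𝔔 : Place k F, 𝔔.ord (σ g) = (𝔔.conj σ).ord g := fun 𝔔 =>
    (Place.conj_ord h2 hσ 𝔔 g).symm
  -- the sign divisor is anti-invariant
  have hanti : ∀ 𝔔 : Place k F, signDivisor σ T 𝔓 (𝔔.conj σ) = -signDivisor σ T 𝔓 𝔔 := fun 𝔔 => by
    rw [signDivisor_apply h2 hσ, signDivisor_apply h2 hσ, Place.conj_conj h2 hσ]; ring
  have hfdiv : ∀ 𝔔 : Place k F, 3 ∣ 𝔔.ord (σ g / g / f) := fun 𝔔 => by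
    rw [𝔔.ord_div (div_ne_zero hσg0 hg0) hf.ne_zero, 𝔔.ord_div hσg0 hg0, hordσ]
    have e1 := hg 𝔔
    have e2 := hg (𝔔.conj σ)
    have e3 := hf.ord_modEq 𝔔
    rw [hanti] at e2
    rw [Int.ModEq] at e1 e2 e3
    omega
  obtain ⟨u, hu, z, hz, huz⟩ := exists_normOne_mul_cube h2 hσ hx htop hgenus (h := σ g / g / f)
    (by
      rw [map_div₀, map_div₀, conj_conj h2 hσ, hf.conj_eq]
      have := hf.ne_zero
      field_simp) hfdiv
  have hz0 : z ≠ 0 := left_ne_zero_of_mul (hz ▸ one_ne_zero)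
  have hz0' : algebraMap F N z ≠ 0 := by simpa using hz0
  have hσz : σ z = z⁻¹ := eq_inv_of_mul_eq_one_right hz
  have huf := hf.mul_normOne hu
  obtain ⟨β, hβ⟩ := huf.exists_sum h2 hσ
  have hcube : (τ w / w / algebraMap F N z) ^ 3 = algebraMap F N (u * f) := by
    have : σ g = u * z ^ 3 * f * g := by
      rw [← huz]
      have := hf.ne_zero
      field_simp
    rw [div_pow, div_pow, hτwg, hwg, this]
    have hg0' : algebraMap F N g ≠ 0 := by simpa using hg0
    simp only [map_mul, map_pow]
    field_simp
  refine ⟨u, hu, β, hβ, isDefinedBy_of_cube_root hσ hM hN hMN hτ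
    (notMem_range_of_cube h2 hσ h𝔓 hT huf.ord_modEq hcube) ?_ hcube hβ⟩
  rw [map_div₀, map_div₀, hττ, hτ, hσz, map_inv₀]
  field_simp

/-- Kummer generators that define the same extension differ by the cube of a norm one element. -/
theorem exists_normOne_cube {f f' : F} (hf : IsKummerGenerator σ T 𝔓 f)
    (hf' : IsKummerGenerator σ T 𝔓 f') {β β' : K} (hβ : algebraMap K F β = f + f⁻¹)
    (hβ' : algebraMap K F β' = f' + f'⁻¹) (hL : IsDefinedBy M β) (hL' : IsDefinedBy M β') :
    ∃ c : F, c * σ c = 1 ∧ f' = c ^ 3 * f := by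
  obtain ⟨w, y, hy, -, hw0, hwf, hwy, hw, hτw⟩ := exists_cube_root_of_isDefinedBy (K := K) (M := M)
    (N := N) h2 hτ hf.mul_conj (hf.conj_ne h2 hσ hT h𝔓) hβ hL
  obtain ⟨w', y', hy', -, hw0', hwf', hwy', hw', hτw'⟩ := exists_cube_root_of_isDefinedBy (K := K)
    (M := M) (N := N) h2 hτ hf'.mul_conj (hf'.conj_ne h2 hσ hT h𝔓) hβ' hL'
  obtain ⟨c, hc0, ⟨h, h'⟩ | ⟨h, h'⟩⟩ := exists_eq_mul_of_cube_roots h3 hN hw hwf hw' hwf'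
  · refine ⟨c, (algebraMap F N).injective ?_, h'⟩
    have h5 := congrArg τ h
    rw [hτw', map_mul, hτ, hτw, h] at h5
    have hc0' : algebraMap F N c ≠ 0 := by simpa using hc0
    field_simp at h5
    rw [map_mul, map_one, h5]
  · -- the signs exclude a multiple of the square
    exfalso
    obtain ⟨𝔭, h𝔭⟩ := hT
    have e1 := hf.ord_modEq (𝔓 𝔭)
    have e2 := hf'.ord_modEq (𝔓 𝔭)
    rw [(signDivisor_apply_of_mem h2 hσ h𝔓 h𝔭).1, Int.ModEq] at e1 e2
    rw [h', Place.ord_mul _ (pow_ne_zero 3 hc0) (pow_ne_zero 2 hf.ne_zero), Place.ord_pow,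
      Place.ord_pow] at e2
    push_cast at e2
    omega

/-- Conversely, if `f' = c³ f` with `c` of norm one, then `c w` is a cube root of `f'` that `τ`
inverts. -/
theorem isDefinedBy_of_mul_cube {f f' : F} (hf : IsKummerGenerator σ T 𝔓 f)
    (hf' : IsKummerGenerator σ T 𝔓 f') {β β' : K} (hβ : algebraMap K F β = f + f⁻¹)
    (hβ' : algebraMap K F β' = f' + f'⁻¹) (hL : IsDefinedBy M β) {c : F} (hc : c * σ c = 1)
    (h : f' = c ^ 3 * f) : IsDefinedBy M β' := by
  obtain ⟨w, y, hy, -, hw0, hwf, hwy, hw, hτw⟩ := exists_cube_root_of_isDefinedBy (K := K) (M := M)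
    (N := N) h2 hτ hf.mul_conj (hf.conj_ne h2 hσ hT h𝔓) hβ hL
  have hcube : (algebraMap F N c * w) ^ 3 = algebraMap F N f' := by
    rw [mul_pow, hwf, h, map_mul, map_pow]
  refine isDefinedBy_of_cube_root hσ hM hN hMN hτ
    (notMem_range_of_cube h2 hσ h𝔓 hT hf'.ord_modEq hcube) ?_ hcube hβ'
  rw [map_mul, hτ, hτw, eq_inv_of_mul_eq_one_right hc, map_inv₀, mul_inv]

end Descent

/-! ### Descent from an extension of the constants -/

section ConstantExtension

open Polynomial IntermediateField

variable {k K F Ω : Type*} [Field k] [Field K] [Field F] [Field Ω] [Algebra k K] [Algebra k F]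
  [Algebra K F] [IsScalarTower k K F] [Algebra k Ω] [Algebra F Ω] [IsScalarTower k F Ω]
  {σ : F ≃ₐ[K] F} {T : Finset (Place k K)} {𝔓 : Place k K → Place k F}

variable (k F Ω) in
/-- The constant extension of `F` inside `Ω` by all elements that are algebraic over `k`. -/
def constantExtension : IntermediateField F Ω := adjoin F {z : Ω | IsAlgebraic k z}

theorem mem_constantExtension_of_isAlgebraic {z : Ω} (hz : IsAlgebraic k z) :
    z ∈ constantExtension k F Ω := subset_adjoin F _ hz

theorem map_mem_constantExtension (s : Ω ≃ₐ[F] Ω) {z : Ω} (hz : z ∈ constantExtension k F Ω) :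
    s z ∈ constantExtension k F Ω := by
  have h1 : (constantExtension k F Ω).map s.toAlgHom ≤ constantExtension k F Ω := by
    rw [constantExtension, adjoin_map, adjoin_le_iff]
    rintro _ ⟨y, hy, rfl⟩
    exact mem_constantExtension_of_isAlgebraic (hy.algHom (s.toAlgHom.restrictScalars k))
  exact h1 ⟨z, hz, rfl⟩

/-- An element of the constant extension lies in an extension by a single constant. -/
theorem exists_mem_adjoin_constant [PerfectField k] {z : Ω} (hz : z ∈ constantExtension k F Ω) :
    ∃ θ : Ω, IsAlgebraic k θ ∧ z ∈ adjoin F {θ} := by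
  obtain ⟨S, hS, hzS⟩ := exists_finset_of_mem_adjoin hz
  have hfd : FiniteDimensional k (adjoin k (S : Set Ω)) :=
    finiteDimensional_adjoin fun y hy => IsAlgebraic.isIntegral (hS hy)
  obtain ⟨θ, hθ⟩ := Field.exists_primitive_element k (adjoin k (S : Set Ω))
  refine ⟨θ, ?_, ?_⟩
  · exact (isAlgebraic_algebraMap_iff (A := Ω) (a := θ)
      (FaithfulSMul.algebraMap_injective (adjoin k (S : Set Ω)) Ω)).2
      (Algebra.IsAlgebraic.isAlgebraic _)
  · have hk : adjoin k (S : Set Ω) = adjoin k {(θ : Ω)} := by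
      rw [← lift_adjoin_simple, hθ, lift_top]
    have hle : (S : Set Ω) ⊆ adjoin F {(θ : Ω)} := fun y hy => by
      have h1 : y ∈ adjoin k {(θ : Ω)} := hk ▸ subset_adjoin k _ hy
      have h2 : adjoin k {(θ : Ω)} ≤ (adjoin F {(θ : Ω)}).restrictScalars k :=
        adjoin_le_iff.2 (subset_adjoin F _)
      exact h2 h1
    exact adjoin_le_iff.2 hle hzS

/-- If `g` becomes a cube in a constant extension, then its divisor is divisible by three, since
constant extensions are unramified. -/
theorem three_dvd_ord_of_cube [PerfectField k] [Algebra.IsSeparable F Ω] {z : Ω}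
    (hz : z ∈ constantExtension k F Ω) {g : F}
    (hg : z ^ 3 = algebraMap F Ω g) (𝔔 : Place k F) : 3 ∣ 𝔔.ord g := by
  obtain ⟨θ, hθ, hz'⟩ := exists_mem_adjoin_constant hz
  have hfd : FiniteDimensional F (adjoin F {θ}) :=
    adjoin.finiteDimensional (Algebra.IsIntegral.isIntegral θ)
  obtain ⟨𝔑, e, he⟩ := 𝔔.exists_liesOver (F := adjoin F {θ})
  have htower : IsScalarTower k (adjoin F {θ}) Ω := IsScalarTower.of_algebraMap_eq fun _ => rfl
  have halg : IsAlgebraic k (AdjoinSimple.gen F θ) :=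
    (isAlgebraic_algebraMap_iff (A := Ω) (a := AdjoinSimple.gen F θ)
      (FaithfulSMul.algebraMap_injective (adjoin F {θ}) Ω)).1 hθ
  have htop : adjoin F {AdjoinSimple.gen F θ} = ⊤ := by
    refine lift_injective _ ?_
    rw [lift_adjoin_simple, lift_top]
    rfl
  obtain rfl := he.eq_one_of_constant halg htop
  have h1 : (⟨z, hz'⟩ : adjoin F {θ}) ^ 3 = algebraMap F _ g := Subtype.ext hg
  have h2 := congrArg 𝔑.ord h1
  rw [𝔑.ord_pow, he.ord, Nat.cast_one, one_mul] at h2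
  exact Dvd.intro _ h2

/-- A cube root of `f` has degree three over the constant extension, if the divisor of `f` is not
divisible by three. -/
theorem natDegree_minpoly_constantExtension [PerfectField k] [Algebra.IsSeparable F Ω]
    {f : F} {𝔔 : Place k F} (hf : ¬ 3 ∣ 𝔔.ord f) {w : Ω} (hw : w ^ 3 = algebraMap F Ω f) :
    (minpoly (constantExtension k F Ω) w).natDegree = 3 := by
  have hirr : Irreducible (X ^ 3 - C (algebraMap F (constantExtension k F Ω) f)) := by
    refine irreducible_of_degree_le_three_of_not_isRoot
      (by rw [natDegree_X_pow_sub_C]; decide) fun c hc => hf ?_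
    refine three_dvd_ord_of_cube c.2 (g := f) ?_ 𝔔
    have h1 : c ^ 3 = algebraMap F (constantExtension k F Ω) f := by
      have : c ^ 3 - algebraMap F (constantExtension k F Ω) f = 0 := by simpa using hc
      exact sub_eq_zero.1 this
    exact congrArg Subtype.val h1
  rw [← minpoly.eq_of_irreducible_of_monic hirr (by
    simp only [map_sub, map_pow, aeval_X, aeval_C, hw, ← IsScalarTower.algebraMap_apply, sub_self])
    (monic_X_pow_sub_C _ three_ne_zero), natDegree_X_pow_sub_C]

/-- Let `N` be a cubic extension of `F` in `Ω` that becomes contained in `F k̄ (w)`, where `w` is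
a cube root of `f`, but not in `F k̄`. Then `N` contains a multiple of `w` by an element of `F k̄`,
and its cube has the same orders as `f` modulo three. The coordinates of an element of `N` are used:
an automorphism that fixes `N` maps `w` to a constant multiple, and thereby fixes each term
separately. -/
theorem exists_cube_root_of_le [PerfectField k] [IsGalois F Ω]
    {f : F} (hf0 : f ≠ 0) {𝔔₀ : Place k F} (hf : ¬ 3 ∣ 𝔔₀.ord f) {w : Ω}
    (hw : w ^ 3 = algebraMap F Ω f)
    {N : IntermediateField F Ω} (hN : Module.finrank F N = 3)
    (hle : ∀ z ∈ N, ∃ a ∈ constantExtension k F Ω, ∃ b ∈ constantExtension k F Ω,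
      ∃ c ∈ constantExtension k F Ω, z = a + b * w + c * w ^ 2)
    (hnot : ¬ N ≤ constantExtension k F Ω) :
    ∃ w' ∈ N, ∃ g : F, g ≠ 0 ∧ w' ^ 3 = algebraMap F Ω g ∧
      ∀ 𝔔 : Place k F, 𝔔.ord g ≡ 𝔔.ord f [ZMOD 3] := by
  set E := constantExtension k F Ω with hE
  have hdeg := natDegree_minpoly_constantExtension hf hw
  have hfΩ : algebraMap F Ω f ≠ 0 := by simpa using hf0
  have hw0 : w ≠ 0 := by
    rintro rfl
    exact hfΩ (by rw [← hw]; simp)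
  have hfE : algebraMap F Ω f ∈ E := E.algebraMap_mem f
  obtain ⟨v, hvN, hvE⟩ : ∃ v ∈ N, v ∉ E := by
    by_contra! h
    exact hnot h
  obtain ⟨a, ha, b, hb, c, hc, rfl⟩ := hle v hvN
  -- each term of the element is fixed by the automorphisms that fix `N`
  have hterm : b * w ∈ N ∧ c * w ^ 2 ∈ N := by
    have key : ∀ s ∈ N.fixingSubgroup, s (b * w) = b * w ∧ s (c * w ^ 2) = c * w ^ 2 := by
      intro s hs
      have hsv := (mem_fixingSubgroup_iff N s).1 hs _ hvN
      obtain ⟨χ, hχ⟩ : ∃ χ, s w = χ * w := ⟨s w / w, (div_mul_cancel₀ _ hw0).symm⟩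
      have hχ3 : χ ^ 3 = 1 := by
        have h1 : s w ^ 3 = w ^ 3 := by rw [← map_pow, hw, s.commutes]
        rw [hχ, mul_pow] at h1
        exact mul_right_cancel₀ (pow_ne_zero 3 hw0) (by rw [h1, one_mul])
      have hχE : χ ∈ E := mem_constantExtension_of_isAlgebraic
        (IsAlgebraic.of_pow (n := 3) three_pos (by rw [hχ3]; exact isAlgebraic_one))
      have hb' : s b * χ - b ∈ E := sub_mem (mul_mem (map_mem_constantExtension s hb) hχE) hb
      have hc' : s c * χ ^ 2 - c ∈ E :=
        sub_mem (mul_mem (map_mem_constantExtension s hc) (pow_mem hχE 2)) hc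
      have ha' : s a - a ∈ E := sub_mem (map_mem_constantExtension s ha) ha
      obtain ⟨-, h1, h2⟩ := coordinates_eq_zero_of_natDegree hdeg (a := ⟨_, ha'⟩)
        (b := ⟨_, hb'⟩) (c := ⟨_, hc'⟩) (by
          change (s a - a) + (s b * χ - b) * w + (s c * χ ^ 2 - c) * w ^ 2 = 0
          simp only [map_add, map_mul, map_pow, hχ] at hsv
          linear_combination hsv)
      have h1' : s b * χ - b = 0 := congrArg Subtype.val h1
      have h2' : s c * χ ^ 2 - c = 0 := congrArg Subtype.val h2
      refine ⟨?_, ?_⟩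
      · rw [map_mul, hχ]; linear_combination w * h1'
      · rw [map_mul, map_pow, hχ]; linear_combination w ^ 2 * h2'
    have hfix := InfiniteGalois.fixedField_fixingSubgroup N
    refine ⟨?_, ?_⟩
    · rw [← hfix, mem_fixedField_iff]
      exact fun s hs => (key s hs).1
    · rw [← hfix, mem_fixedField_iff]
      exact fun s hs => (key s hs).2
  obtain ⟨d, hd0, hdE, hdN⟩ : ∃ d : Ω, d ≠ 0 ∧ d ∈ E ∧ d * w ∈ N := by
    by_cases hb0 : b = 0
    · have hc0 : c ≠ 0 := by
        rintro rfl
        rw [hb0] at hvE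
        exact hvE (by simpa using ha)
      refine ⟨c ^ 2 * algebraMap F Ω f, mul_ne_zero (pow_ne_zero 2 hc0) hfΩ,
        mul_mem (pow_mem hc 2) hfE, ?_⟩
      have : c ^ 2 * algebraMap F Ω f * w = (c * w ^ 2) ^ 2 := by rw [← hw]; ring
      rw [this]
      exact pow_mem hterm.2 2
    · exact ⟨b, hb0, hb, hterm.1⟩
  -- the intersection of `N` with the constant extension is `F`
  have hinter : ∀ z ∈ N, z ∈ E → ∃ g : F, algebraMap F Ω g = z := by
    intro z hzN hzE
    by_contra! hz
    have h1 := adjoin_eq_top_of_finrank_three hN (z := ⟨z, hzN⟩) (by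
      rintro ⟨g, hg⟩
      exact hz g (congrArg Subtype.val hg))
    have h2 : adjoin F {z} = N := by
      have := lift_adjoin_simple F N ⟨z, hzN⟩
      rw [h1, lift_top] at this
      exact this.symm
    refine hnot ?_
    rw [← h2]
    exact adjoin_simple_le_iff.2 hzE
  obtain ⟨g, hg⟩ := hinter ((d * w) ^ 3) (pow_mem hdN 3) (by
    rw [mul_pow, hw]
    exact mul_mem (pow_mem hdE 3) hfE)
  have hg0 : g ≠ 0 := by
    rintro rfl
    rw [map_zero] at hg
    exact pow_ne_zero 3 (mul_ne_zero hd0 hw0) hg.symm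
  refine ⟨d * w, hdN, g, hg0, hg.symm, fun 𝔔 => ?_⟩
  have h3 := three_dvd_ord_of_cube hdE (g := g / f) (by
    rw [map_div₀, hg, mul_pow, hw, mul_div_cancel_right₀ _ hfΩ]) 𝔔
  rw [𝔔.ord_div hg0 hf0] at h3
  exact (Int.modEq_iff_dvd.2 h3).symm

end ConstantExtension

/-! ### Twists -/

section Separable

variable {K F M N : Type*} [Field K] [Field F] [Field M] [Field N]
  [Algebra K F] [Algebra K M] [Algebra K N] [Algebra F N] [Algebra M N]
  [IsScalarTower K F N] [IsScalarTower K M N]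

theorem isSeparable_compositum (hF : (3 : F) ≠ 0) (h2 : Module.finrank K F = 2)
    (hN : Module.finrank F N = 3) {β : K} (hL : IsDefinedBy M β) : Algebra.IsSeparable F N := by
  obtain ⟨y, hy, hroot⟩ := hL.exists_root
  refine IsDefinedBy.isSeparable hF (β := algebraMap K F β)
    (isDefinedBy_of_root hN (y := algebraMap M N y)
      (algebraMap_notMem_range h2 hL.finrank hy) ?_)
  rw [← map_pow, hroot, map_add, map_mul, map_ofNat, ← IsScalarTower.algebraMap_apply,
    ← IsScalarTower.algebraMap_apply]

end Separable

section Twist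

variable {k : Type u} {K : Type v} {F : Type w} [Field k] [Field K] [Field F]
  [Algebra k K] [Algebra k F] [Algebra K F] [IsScalarTower k K F] {σ : F ≃ₐ[K] F}
  {T : Finset (Place k K)} {𝔓 : Place k K → Place k F} {x : K}

/-- A cubic twist `M` of the extension `L` defined by `f` is defined by a constant multiple of `f`.
The isomorphism over `K k̄` embeds `F M` into `F k̄ (w)`, where `w` is a cube root of `f`, so that
`F M` is generated by a cube root of a function whose divisor has the given signs. -/
theorem exists_normOne_of_isTwist [PerfectField k] (h3 : (3 : k) ≠ 0)
    (h2 : Module.finrank K F = 2) (hσ : σ ≠ 1) (hT : T.Nonempty)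
    (h𝔓 : ∀ 𝔭 ∈ T, LiesOver (𝔓 𝔭) 𝔭 ∧ (𝔓 𝔭).conj σ ≠ 𝔓 𝔭)
    (hx : Transcendental k x) (htop : IntermediateField.adjoin k {x} = ⊤)
    (hgenus : HasGenus (algebraicClosure k F) F 0) {f : F}
    (hf : IsKummerGenerator σ T 𝔓 f) {α : K} (hα : algebraMap K F α = f + f⁻¹)
    {L M : Type v} [Field L] [Algebra k L] [Algebra K L] [IsScalarTower k K L]
    [Field M] [Algebra k M] [Algebra K M] [IsScalarTower k K M]
    (hL : IsDefinedBy L α) (hM : Module.finrank K M = 3) (ht : IsTwist k K L M) :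
    ∃ u ∈ normOne k σ, ∃ β : K, algebraMap K F β = u * f + (u * f)⁻¹ ∧ IsDefinedBy M β := by
  classical
  obtain ⟨Ψ⟩ := ht
  obtain ⟨NL, _, _, _, _, _, _, _, _, _, _, hNL, -, ⟨φL, hφL⟩, τL, hτL⟩ :=
    exists_compositum (k := k) h2 σ (M := L) hL.finrank
  obtain ⟨NM, _, _, _, _, _, _, _, _, _, _, hNM, hMNM, ⟨φM, hφM⟩, τM, hτM⟩ :=
    exists_compositum (k := k) h2 σ (M := M) hM
  obtain ⟨w₀, y, -, -, -, hwf₀, -, hw₀, -⟩ := exists_cube_root_of_isDefinedBy (K := K) (M := L)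
    (N := NL) h2 hτL hf.mul_conj (hf.conj_ne h2 hσ hT h𝔓) hα hL
  have hsep : Algebra.IsSeparable F NL :=
    isSeparable_compositum (M := L) (three_ne_zero_of_algebra h3) h2 hNL hL
  let Ω := SeparableClosure F
  have htower : IsScalarTower k K Ω := IsScalarTower.of_algebraMap_eq fun c => by
    rw [IsScalarTower.algebraMap_apply k F Ω, IsScalarTower.algebraMap_apply k K F,
      IsScalarTower.algebraMap_apply K F Ω]
  -- embeddings of all fields involved into a separable closure of `F`
  let κ : AlgebraicClosure k →ₐ[k] Ω := IsSepClosed.lift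
  let μ : K ⊗[k] AlgebraicClosure k →ₐ[K] Ω :=
    Algebra.TensorProduct.lift (Algebra.ofId K Ω) κ fun _ _ => Commute.all _ _
  let ρL : NL →ₐ[F] Ω := IsSepClosed.lift
  let ψL : L →ₐ[K] Ω := (ρL.restrictScalars K).comp (IsScalarTower.toAlgHom K L NL)
  let lamL : (K ⊗[k] AlgebraicClosure k) ⊗[K] L →ₐ[K] Ω :=
    Algebra.TensorProduct.lift μ ψL fun _ _ => Commute.all _ _
  -- `M` is embedded through the isomorphism of the twist
  let ψM : M →ₐ[K] Ω := lamL.comp ((Ψ.symm.toAlgHom.restrictScalars K).comp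
    Algebra.TensorProduct.includeRight)
  let ρ₀ : F ⊗[K] M →ₐ[F] Ω :=
    Algebra.TensorProduct.lift (Algebra.ofId F Ω) ψM fun _ _ => Commute.all _ _
  let ρM : NM →ₐ[F] Ω := ρ₀.comp φM.symm.toAlgHom
  set E := constantExtension k F Ω with hE
  set w : Ω := ρL w₀ with hw
  have hwf : w ^ 3 = algebraMap F Ω f := by rw [hw, ← map_pow, hwf₀, AlgHom.commutes]
  have hμ : ∀ a, μ a ∈ E := fun a => by
    induction a with
    | zero => rw [map_zero]; exact zero_mem E
    | add a b ha hb => rw [map_add]; exact add_mem ha hb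
    | tmul c t =>
      have h1 : μ (c ⊗ₜ t) = algebraMap K Ω c * κ t := Algebra.TensorProduct.lift_tmul _ _ _ _ _
      rw [h1, IsScalarTower.algebraMap_apply K F Ω]
      exact mul_mem (E.algebraMap_mem _) (mem_constantExtension_of_isAlgebraic
        ((Algebra.IsAlgebraic.isAlgebraic t).algHom κ))
  have hlam : ∀ a l, lamL (a ⊗ₜ l) = μ a * ψL l := fun a l =>
    Algebra.TensorProduct.lift_tmul _ _ _ _ _
  have hρ₀ : ∀ z m, ρ₀ (z ⊗ₜ m) = algebraMap F Ω z * ψM m := fun z m =>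
    Algebra.TensorProduct.lift_tmul _ _ _ _ _
  -- the span of the powers of `w` over `F k̄` contains the images of all these fields
  let V : Submodule E Ω := Submodule.span E {1, w, w ^ 2}
  have hsmul : ∀ e ∈ E, ∀ z ∈ V, e * z ∈ V := fun e he z hz => V.smul_mem ⟨e, he⟩ hz
  have hψL : ∀ l, ψL l ∈ V := fun l => by
    obtain ⟨a, b, c, h⟩ := exists_coordinates hNL hw₀ (algebraMap L NL l)
    have h1 : ψL l = ρL (algebraMap L NL l) := rfl
    rw [h1, h]
    simp only [map_add, map_mul, map_pow, AlgHom.commutes]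
    rw [← hw]
    refine add_mem (add_mem ?_ (hsmul _ (E.algebraMap_mem _) _ (Submodule.subset_span (by simp))))
      (hsmul _ (E.algebraMap_mem _) _ (Submodule.subset_span (by simp)))
    rw [← mul_one (algebraMap F Ω a)]
    exact hsmul _ (E.algebraMap_mem _) _ (Submodule.subset_span (by simp))
  have hlamV : ∀ t, lamL t ∈ V := fun t => by
    induction t with
    | zero => rw [map_zero]; exact zero_mem V
    | add a b ha hb => rw [map_add]; exact add_mem ha hb
    | tmul a l => rw [hlam]; exact hsmul _ (hμ a) _ (hψL l)
  have hρ₀V : ∀ t, ρ₀ t ∈ V := fun t => by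
    induction t with
    | zero => rw [map_zero]; exact zero_mem V
    | add a b ha hb => rw [map_add]; exact add_mem ha hb
    | tmul z m => rw [hρ₀]; exact hsmul _ (E.algebraMap_mem _) _ (hlamV _)
  have hρM : ∀ t, ρM (φM t) = ρ₀ t := fun t => congrArg ρ₀ (φM.symm_apply_apply t)
  obtain ⟨𝔭, h𝔭⟩ := hT
  have hord : ¬ 3 ∣ (𝔓 𝔭).ord f := fun h => by
    have h1 := hf.ord_modEq (𝔓 𝔭)
    rw [(signDivisor_apply_of_mem h2 hσ h𝔓 h𝔭).1, Int.ModEq] at h1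
    omega
  obtain ⟨w', ⟨w₁, hw₁⟩, g, hg0, hg, hgf⟩ := exists_cube_root_of_le (N := ρM.fieldRange) hf.ne_zero
    hord hwf (by
      rw [← hNM]
      exact (AlgEquiv.ofInjectiveField ρM).toLinearEquiv.finrank_eq.symm)
    (by
      rintro _ ⟨n, rfl⟩
      obtain ⟨t, rfl⟩ := φM.surjective n
      have h1 : ρM (φM t) ∈ V := by rw [hρM]; exact hρ₀V t
      obtain ⟨a, b, c, h⟩ := Submodule.mem_span_triple.1 h1
      refine ⟨a, a.2, b, b.2, c, c.2, ?_⟩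
      have h' : (a : Ω) * 1 + b * w + c * w ^ 2 = ρM (φM t) := h
      rw [mul_one] at h'
      exact h'.symm)
    (by
      -- if `F M` were in `F k̄`, then so would be `L`, by the inverse isomorphism, and `w`
      intro hle
      have hψM : ∀ m, ψM m ∈ E := fun m => by
        have h1 : ρM (φM (1 ⊗ₜ m)) = ψM m := by rw [hρM, hρ₀, map_one, one_mul]
        rw [← h1]
        exact hle ⟨_, rfl⟩
      have hback : ∀ t, lamL (Ψ.symm t) ∈ E := fun t => by
        induction t with
        | zero => rw [map_zero, map_zero]; exact zero_mem E
        | add a b ha hb => rw [map_add, map_add]; exact add_mem ha hb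
        | tmul a m =>
          have h1 : (a ⊗ₜ m : (K ⊗[k] AlgebraicClosure k) ⊗[K] M)
              = algebraMap (K ⊗[k] AlgebraicClosure k) _ a * (1 ⊗ₜ m) := by
            rw [Algebra.TensorProduct.algebraMap_apply]
            simp
          have h4 : lamL (algebraMap (K ⊗[k] AlgebraicClosure k) _ a) = μ a := by
            rw [Algebra.TensorProduct.algebraMap_apply]
            change lamL (a ⊗ₜ 1) = _
            rw [hlam, map_one, mul_one]
          rw [h1, map_mul, AlgEquiv.commutes, map_mul, h4]
          exact mul_mem (hμ a) (hψM m)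
      have hψLE : ∀ l, ψL l ∈ E := fun l => by
        have h1 := hback (Ψ (1 ⊗ₜ l))
        rwa [AlgEquiv.symm_apply_apply, hlam, map_one, one_mul] at h1
      have hρL : ∀ t, ρL (φL t) ∈ E := fun t => by
        induction t with
        | zero => rw [map_zero, map_zero]; exact zero_mem E
        | add a b ha hb => rw [map_add, map_add]; exact add_mem ha hb
        | tmul z l =>
          have h1 : (z ⊗ₜ l : F ⊗[K] L) = algebraMap F _ z * (1 ⊗ₜ l) := by
            rw [Algebra.TensorProduct.algebraMap_apply]
            simp
          rw [h1, map_mul, AlgEquiv.commutes, map_mul, AlgHom.commutes, hφL]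
          exact mul_mem (E.algebraMap_mem _) (hψLE l)
      obtain ⟨t, ht⟩ := φL.surjective w₀
      have hwE : w ∈ E := by rw [hw, ← ht]; exact hρL t
      exact hord (three_dvd_ord_of_cube hwE hwf (𝔓 𝔭)))
  have hw₁g : w₁ ^ 3 = algebraMap F NM g := by
    refine ρM.toRingHom.injective ?_
    change ρM (w₁ ^ 3) = ρM (algebraMap F NM g)
    rw [map_pow, AlgHom.commutes, ← hg]
    exact congrArg (· ^ 3) hw₁
  exact exists_normOne_isDefinedBy h3 h2 hσ h𝔓 ⟨𝔭, h𝔭⟩ hM hNM hMNM hτM hx htop hgenus hf hg0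
    (fun 𝔔 => (hgf 𝔔).trans (hf.ord_modEq 𝔔)) hw₁g

end Twist

/-! ### Constant multiples become isomorphic over the algebraic closure -/

section CubeRoots

variable {B : Type*} [CommRing B]

/-- The cube root `w = (f + y) / (y² - 1)` of `f` with `w + w⁻¹ = y`, over a ring. The inverses of
`f` and `w` are carried along. -/
theorem exists_unit_cube_root {f f' y : B} (hf : f * f' = 1) (hy : IsUnit (y ^ 2 - 1))
    (h : y ^ 3 = 3 * y + (f + f')) : ∃ w w' : B, w * w' = 1 ∧ w ^ 3 = f ∧ w + w' = y := by
  obtain ⟨d, hd⟩ := hy.exists_right_inv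
  have h1 : (f + y) * d * ((f' + y) * d) = 1 := by
    have e : (f + y) * (f' + y) = (y ^ 2 - 1) ^ 2 := by linear_combination hf - y * h
    calc (f + y) * d * ((f' + y) * d) = (f + y) * (f' + y) * d ^ 2 := by ring
      _ = ((y ^ 2 - 1) * d) ^ 2 := by rw [e]; ring
      _ = 1 := by rw [hd, one_pow]
  have h2 : (f + y) * d + (f' + y) * d = y := by
    linear_combination y * hd - d * h
  refine ⟨(f + y) * d, (f' + y) * d, h1, ?_, h2⟩
  set w := (f + y) * d with hw
  have h3 : w ^ 2 = y * w - 1 := by linear_combination w * h2 - h1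
  have h4 : w * (y ^ 2 - 1) = f + y := by rw [hw]; linear_combination (f + y) * hd
  linear_combination (w + y) * h3 + h4

/-- The cube root is determined by its cube and by the sum with its inverse. -/
theorem cube_root_unique {s s' t t' : B} (hs : s * s' = 1) (ht : t * t' = 1) (h3 : s ^ 3 = t ^ 3)
    (h : s + s' = t + t') (hu : IsUnit ((s + s') ^ 2 - 1)) : s = t := by
  refine hu.mul_right_cancel ?_
  calc s * ((s + s') ^ 2 - 1) = s ^ 3 + (s + s') := by linear_combination (2 * s + s') * hs
    _ = t ^ 3 + (t + t') := by rw [h3, h]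
    _ = t * ((t + t') ^ 2 - 1) := by linear_combination -(2 * t + t') * ht
    _ = t * ((s + s') ^ 2 - 1) := by rw [h]

end CubeRoots

section BaseChange

variable {K A L M : Type*} [Field K] [CommRing A] [Algebra K A] [Field L] [Field M]
  [Algebra K L] [Algebra K M]

theorem isUnit_sq_sub_one {y : L} (hy : y ∉ Set.range (algebraMap K L)) :
    IsUnit ((1 ⊗ₜ[K] y : A ⊗[K] L) ^ 2 - 1) := by
  have h1 : y ^ 2 - 1 ≠ 0 := by
    intro h1
    have h2 : (y - 1) * (y + 1) = 0 := by linear_combination h1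
    rcases mul_eq_zero.1 h2 with h2 | h2
    · exact hy ⟨1, by rw [map_one]; linear_combination -h2⟩
    · exact hy ⟨-1, by rw [map_neg, map_one]; linear_combination -h2⟩
  have h4 := (IsUnit.mk0 _ h1).map (Algebra.TensorProduct.includeRight : L →ₐ[K] A ⊗[K] L)
  rw [map_sub, map_pow, map_one] at h4
  exact h4

theorem one_tmul_cube {y : L} {β : K} (hy : y ^ 3 = 3 * y + algebraMap K L β) :
    (1 ⊗ₜ[K] y : A ⊗[K] L) ^ 3 = 3 * (1 ⊗ₜ[K] y) + algebraMap A _ (algebraMap K A β) := by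
  have h4 := congrArg (Algebra.TensorProduct.includeRight : L →ₐ[K] A ⊗[K] L) hy
  rw [map_pow, map_add, map_mul, map_ofNat, AlgHom.commutes] at h4
  rw [← IsScalarTower.algebraMap_apply]
  exact h4

/-- Two extensions defined by the same polynomial are isomorphic. -/
theorem IsDefinedBy.nonempty_algEquiv {β : K} (hL : IsDefinedBy L β) (hM : IsDefinedBy M β) :
    Nonempty (L ≃ₐ[K] M) := by
  have hL3 := hL.finrank
  have hM3 := hM.finrank
  have hfdL : FiniteDimensional K L := FiniteDimensional.of_finrank_pos (by omega)
  have hfdM : FiniteDimensional K M := FiniteDimensional.of_finrank_pos (by omega)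
  obtain ⟨y, hy, hyp⟩ := hL
  obtain ⟨z, -, hzp⟩ := hM
  obtain ⟨φ, -⟩ := exists_algHom_of_root (K := K) (θ := y) (a := z)
    (Algebra.IsIntegral.isIntegral y) hy (by rw [hyp, ← hzp, minpoly.aeval])
  refine ⟨AlgEquiv.ofBijective φ ⟨φ.injective, ?_⟩⟩
  exact (LinearMap.injective_iff_surjective_of_finrank_eq_finrank (f := φ.toLinearMap)
    (hL3.trans hM3.symm)).1 φ.injective

/-- The root of the polynomial that defines `M` is sent to `c w + (c w)⁻¹` in `A ⊗ L`, where `w` is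
a cube root of `f`. -/
theorem exists_algHom_of_cube {β : K} {z : M} (hM : Module.finrank K M = 3)
    (hz : z ∉ Set.range (algebraMap K M)) (hzβ : z ^ 3 = 3 * z + algebraMap K M β)
    {f f' c c' : A} (hf : f * f' = 1) (hc : c * c' = 1)
    (hβ : algebraMap K A β = c ^ 3 * f + c' ^ 3 * f')
    {w w' : A ⊗[K] L} (hw : w * w' = 1) (hwf : w ^ 3 = algebraMap A _ f) :
    ∃ Φ : A ⊗[K] M →ₐ[A] A ⊗[K] L,
      Φ (1 ⊗ₜ z) = algebraMap A _ c * w + algebraMap A _ c' * w' := by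
  have hfd : FiniteDimensional K M := FiniteDimensional.of_finrank_pos (by omega)
  have hc2 : algebraMap A (A ⊗[K] L) c * algebraMap A _ c' = 1 := by rw [← map_mul, hc, map_one]
  have hwf' : w' ^ 3 = algebraMap A _ f' := by
    have e1 : w ^ 3 * w' ^ 3 = 1 := by rw [← mul_pow, hw, one_pow]
    have e2 : w ^ 3 * algebraMap A _ f' = 1 := by rw [hwf, ← map_mul, hf, map_one]
    calc w' ^ 3 = w' ^ 3 * (w ^ 3 * algebraMap A _ f') := by rw [e2, mul_one]
      _ = (w ^ 3 * w' ^ 3) * algebraMap A _ f' := by ring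
      _ = _ := by rw [e1, one_mul]
  obtain ⟨φ, hφ⟩ := exists_algHom_of_root (K := K) (θ := z)
    (a := algebraMap A (A ⊗[K] L) c * w + algebraMap A _ c' * w')
    (Algebra.IsIntegral.isIntegral z) (adjoin_eq_top_of_finrank_three hM hz) (by
      rw [minpoly_eq_of_finrank_three hM hz (cubicPoly_monic β) (natDegree_cubicPoly β).le (by
        rw [aeval_cubicPoly, hzβ]; ring), aeval_cubicPoly,
        IsScalarTower.algebraMap_apply K A (A ⊗[K] L), hβ]
      simp only [map_add, map_mul, map_pow, ← hwf, ← hwf']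
      linear_combination 3 * (algebraMap A (A ⊗[K] L) c * w + algebraMap A _ c' * w') * hc2
        + 3 * (algebraMap A (A ⊗[K] L) c * w + algebraMap A _ c' * w')
        * (algebraMap A (A ⊗[K] L) c * algebraMap A _ c') * hw)
  refine ⟨Algebra.TensorProduct.lift (Algebra.ofId A _) φ fun _ _ => Commute.all _ _, ?_⟩
  rw [Algebra.TensorProduct.lift_tmul, map_one, one_mul, hφ]

theorem algHom_eq_id {L : Type*} [Field L] [Algebra K L] (hL : Module.finrank K L = 3) {y : L}
    (hy : y ∉ Set.range (algebraMap K L)) (Φ : A ⊗[K] L →ₐ[A] A ⊗[K] L)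
    (h : Φ (1 ⊗ₜ y) = 1 ⊗ₜ y) : Φ = AlgHom.id A _ := by
  have hfd : FiniteDimensional K L := FiniteDimensional.of_finrank_pos (by omega)
  refine Algebra.TensorProduct.ext (by ext) ?_
  refine AlgHom.ext_of_adjoin_eq_top (Algebra.adjoin_eq_top_of_primitive_element
    (Algebra.IsAlgebraic.isAlgebraic y) (adjoin_eq_top_of_finrank_three hL hy)) ?_
  intro z hz
  rw [Set.mem_singleton_iff] at hz
  subst hz
  exact h

/-- Let `α = f + f⁻¹` and `β = c³ f + (c³ f)⁻¹` in a `K`-algebra `A`. The extensions defined by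
`α` and `β` become isomorphic over `A`. -/
theorem nonempty_algEquiv_of_cube {α β : K} (hL : IsDefinedBy L α) (hM : IsDefinedBy M β)
    {f f' c c' : A} (hf : f * f' = 1) (hc : c * c' = 1) (hα : algebraMap K A α = f + f')
    (hβ : algebraMap K A β = c ^ 3 * f + c' ^ 3 * f') :
    Nonempty ((A ⊗[K] L) ≃ₐ[A] (A ⊗[K] M)) := by
  have hL3 := hL.finrank
  have hM3 := hM.finrank
  obtain ⟨y, hy, hyα⟩ := hL.exists_root
  obtain ⟨z, hz, hzβ⟩ := hM.exists_root
  have hc3 : c ^ 3 * c' ^ 3 = 1 := by rw [← mul_pow, hc, one_pow]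
  have hg : c ^ 3 * f * (c' ^ 3 * f') = 1 := by
    linear_combination c ^ 3 * c' ^ 3 * hf + hc3
  obtain ⟨w, w', hw, hwf, hwy⟩ := exists_unit_cube_root
    (f := algebraMap A (A ⊗[K] L) f) (f' := algebraMap A _ f')
    (by rw [← map_mul, hf, map_one]) (isUnit_sq_sub_one (A := A) hy)
    (by rw [one_tmul_cube hyα, hα, map_add])
  obtain ⟨t, t', ht, htf, htz⟩ := exists_unit_cube_root
    (f := algebraMap A (A ⊗[K] M) (c ^ 3 * f)) (f' := algebraMap A _ (c' ^ 3 * f'))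
    (by rw [← map_mul, hg, map_one]) (isUnit_sq_sub_one (A := A) hz)
    (by rw [one_tmul_cube hzβ, hβ, map_add])
  obtain ⟨Φ, hΦ⟩ := exists_algHom_of_cube (L := L) hM3 hz hzβ hf hc hβ hw hwf
  obtain ⟨Ψ, hΨ⟩ := exists_algHom_of_cube (β := α) (L := M) (c := c') (c' := c) hL3 hy hyα hg
    (by rw [mul_comm, hc]) (by
      rw [hα]
      linear_combination -(f + f') * hc3) ht htf
  have hcL : algebraMap A (A ⊗[K] L) c * algebraMap A _ c' = 1 := by rw [← map_mul, hc, map_one]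
  have hcM : algebraMap A (A ⊗[K] M) c * algebraMap A _ c' = 1 := by rw [← map_mul, hc, map_one]
  -- the images of the cube roots are determined by their cubes
  have hΨw : Ψ w = algebraMap A _ c' * t := by
    refine cube_root_unique (s' := Ψ w') (t' := algebraMap A _ c * t')
      (by rw [← map_mul, hw, map_one]) (by linear_combination hcM * (t * t') + ht) ?_ ?_ ?_
    · rw [← map_pow, hwf, AlgHom.commutes, mul_pow, htf, ← map_pow, ← map_mul]
      congr 1
      linear_combination -f * hc3
    · rw [← map_add, hwy, hΨ]
    · rw [← map_add, hwy, ← map_pow, ← map_one Ψ, ← map_sub]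
      exact (isUnit_sq_sub_one (A := A) hy).map Ψ
  have hΦt : Φ t = algebraMap A _ c * w := by
    refine cube_root_unique (s' := Φ t') (t' := algebraMap A _ c' * w')
      (by rw [← map_mul, ht, map_one]) (by linear_combination hcL * (w * w') + hw) ?_ ?_ ?_
    · rw [← map_pow, htf, AlgHom.commutes, mul_pow, hwf, ← map_pow, ← map_mul]
    · rw [← map_add, htz, hΦ]
    · rw [← map_add, htz, ← map_pow, ← map_one Φ, ← map_sub]
      exact (isUnit_sq_sub_one (A := A) hz).map Φ
  have hΨw' : Ψ w' = algebraMap A _ c * t' := by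
    have e : Ψ w + Ψ w' = Ψ (1 ⊗ₜ y) := by rw [← map_add, hwy]
    rw [hΨ, hΨw] at e
    exact add_left_cancel e
  have hΦt' : Φ t' = algebraMap A _ c' * w' := by
    have e : Φ t + Φ t' = Φ (1 ⊗ₜ z) := by rw [← map_add, htz]
    rw [hΦ, hΦt] at e
    exact add_left_cancel e
  refine ⟨AlgEquiv.ofAlgHom Ψ Φ (algHom_eq_id hM3 hz _ ?_) (algHom_eq_id hL3 hy _ ?_)⟩
  · rw [AlgHom.comp_apply, hΦ, map_add, map_mul, map_mul, AlgHom.commutes, AlgHom.commutes, hΨw,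
      hΨw', ← htz]
    linear_combination (t + t') * hcM
  · rw [AlgHom.comp_apply, hΨ, map_add, map_mul, map_mul, AlgHom.commutes, AlgHom.commutes, hΦt,
      hΦt', ← hwy]
    linear_combination (w + w') * hcL

end BaseChange

section TwistConverse

variable {k K F : Type*} [Field k] [Field K] [Field F]
  [Algebra k K] [Algebra k F] [Algebra K F] [IsScalarTower k K F] {σ : F ≃ₐ[K] F} {x : K}

/-- Constant multiples of norm one define twists: over `K k̄` the constant becomes a cube. If all
constants lie in `K`, so that `F` need not be contained in `K k̄`, then the constant is a sign. -/
theorem isTwist_of_normOne (h2 : Module.finrank K F = 2) (hσ : σ ≠ 1)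
    (hx : Transcendental k x) (htop : IntermediateField.adjoin k {x} = ⊤) {f u : F}
    (hf : f * σ f = 1) (hu : u ∈ normOne k σ) {α β : K} (hα : algebraMap K F α = f + f⁻¹)
    (hβ : algebraMap K F β = u * f + (u * f)⁻¹) {L M : Type*} [Field L] [Algebra K L] [Field M]
    [Algebra K M] (hL : IsDefinedBy L α) (hM : IsDefinedBy M β) : IsTwist k K L M := by
  have hfd : FiniteDimensional K F := FiniteDimensional.of_finrank_pos (by omega)
  have hf0 : f ≠ 0 := left_ne_zero_of_mul (hf ▸ one_ne_zero)
  have hu0 : u ≠ 0 := left_ne_zero_of_mul (hu.2 ▸ one_ne_zero)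
  have hualg := mem_algebraicClosure_iff.1 hu.1
  by_cases hfix : ∀ z : F, IsAlgebraic k z → σ z = z
  · -- then `u` is a sign
    obtain ⟨a, rfl⟩ := exists_eq_algebraMap_of_isAlgebraic_of_fixed h2 hσ hx htop hualg
      (hfix _ hualg)
    have hinv : (algebraMap k F a)⁻¹ = algebraMap k F a := by
      have h1 := hu.2
      rw [hfix _ hualg] at h1
      exact (eq_inv_of_mul_eq_one_right h1).symm
    have ha : a * a = 1 := by
      refine (algebraMap k F).injective ?_
      have h1 := hu.2
      rw [hfix _ hualg] at h1
      rw [map_mul, h1, map_one]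
    have hβ' : β = algebraMap k K a * α := by
      refine (algebraMap K F).injective ?_
      rw [hβ, map_mul, hα, ← IsScalarTower.algebraMap_apply, mul_inv, hinv]
      ring
    obtain ⟨y, hy, hroot⟩ := hL.exists_root
    have hb : algebraMap K L (algebraMap k K a) ^ 2 = 1 := by
      rw [← map_pow, ← map_pow, pow_two, ha, map_one, map_one]
    have hb0 : algebraMap K L (algebraMap k K a) ≠ 0 := by
      intro h
      rw [h] at hb
      simp at hb
    have hL' : IsDefinedBy L β := by
      refine isDefinedBy_of_root hL.finrank (y := algebraMap K L (algebraMap k K a) * y) ?_ ?_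
      · rintro ⟨c, hc⟩
        exact hy ⟨c / algebraMap k K a, by rw [map_div₀, hc, mul_div_cancel_left₀ _ hb0]⟩
      · rw [hβ', map_mul]
        linear_combination algebraMap K L (algebraMap k K a) ^ 3 * hroot
          + (3 * algebraMap K L (algebraMap k K a) * y
            + algebraMap K L (algebraMap k K a) * algebraMap K L α) * hb
    obtain ⟨e⟩ := hL'.nonempty_algEquiv hM
    exact ⟨Algebra.TensorProduct.congr AlgEquiv.refl e⟩
  push Not at hfix
  obtain ⟨θ, hθ, hne⟩ := hfix
  let A := K ⊗[k] AlgebraicClosure k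
  -- it suffices to map `F` to `A` such that `u` becomes a cube
  suffices h : ∃ (ι : F →ₐ[K] A) (c c' : A), c * c' = 1 ∧ c ^ 3 = ι u by
    obtain ⟨ι, c, c', hc, hcu⟩ := h
    have hc3 : c' ^ 3 = ι u⁻¹ := by
      have e1 : c ^ 3 * c' ^ 3 = 1 := by rw [← mul_pow, hc, one_pow]
      have e2 : ι u⁻¹ * c ^ 3 = 1 := by rw [hcu, ← map_mul, inv_mul_cancel₀ hu0, map_one]
      linear_combination ι u⁻¹ * e1 - c' ^ 3 * e2
    refine nonempty_algEquiv_of_cube (A := A) hL hM (f := ι f) (f' := ι f⁻¹) (c := c) (c' := c')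
      (by rw [← map_mul, mul_inv_cancel₀ hf0, map_one]) hc ?_ ?_
    · rw [← map_add, ← hα, AlgHom.commutes]
    · rw [hcu, hc3, ← map_mul, ← map_mul, ← mul_inv, ← map_add, ← hβ, AlgHom.commutes]
  have hconst : ∀ z : F, IsAlgebraic k z → σ z = z → ∃ a : k, algebraMap k F a = z := fun z h h' =>
    exists_eq_algebraMap_of_isAlgebraic_of_fixed h2 hσ hx htop h h'
  have hσθ : IsAlgebraic k (σ θ) := isAlgebraic_conj hθ
  obtain ⟨t, ht⟩ := hconst (θ + σ θ) (hθ.add hσθ) (by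
    rw [map_add, CubicFunctionField.conj_conj h2 hσ, add_comm])
  obtain ⟨n, hn⟩ := hconst (θ * σ θ) (hθ.mul hσθ) (by
    rw [map_mul, CubicFunctionField.conj_conj h2 hσ, mul_comm])
  have hd : θ - σ θ ≠ 0 := sub_ne_zero.2 (Ne.symm hne)
  have hσu : IsAlgebraic k (σ u) := isAlgebraic_conj hualg
  obtain ⟨b, hb⟩ := hconst ((u - σ u) / (θ - σ θ)) (by
    rw [div_eq_mul_inv]; exact (hualg.sub hσu).mul (hθ.sub hσθ).inv) (by
    rw [map_div₀, map_sub, map_sub, CubicFunctionField.conj_conj h2 hσ,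
      CubicFunctionField.conj_conj h2 hσ, ← neg_sub, ← neg_sub θ, neg_div_neg_eq])
  have hb' : algebraMap k F b * (θ - σ θ) = u - σ u := by rw [hb, div_mul_cancel₀ _ hd]
  have hσk : ∀ a : k, σ (algebraMap k F a) = algebraMap k F a := fun a => by
    rw [IsScalarTower.algebraMap_apply k K F, σ.commutes]
  obtain ⟨a, ha⟩ := hconst (u - algebraMap k F b * θ)
    (hualg.sub ((isAlgebraic_algebraMap b).mul hθ)) (by
      rw [map_sub, map_mul, hσk]
      linear_combination hb')
  -- the embedding of the constants into `k̄` extends to `F`, which is generated by the constant `θ`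
  let j : algebraicClosure k F →ₐ[k] AlgebraicClosure k := IsAlgClosed.lift
  let θ' : algebraicClosure k F := ⟨θ, mem_algebraicClosure_iff.2 hθ⟩
  have hθ2 : θ' ^ 2 + (-algebraMap k _ t * θ' + algebraMap k _ n) = 0 := Subtype.ext (by
    change θ ^ 2 + (-algebraMap k F t * θ + algebraMap k F n) = 0
    rw [ht, hn]; ring)
  have hθ3 := congrArg j hθ2
  simp only [map_add, map_mul, map_pow, map_neg, map_zero, AlgHom.commutes] at hθ3
  let i : AlgebraicClosure k →ₐ[k] A := Algebra.TensorProduct.includeRight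
  have hθ4 := congrArg i hθ3
  simp only [map_add, map_mul, map_pow, map_neg, map_zero, AlgHom.commutes] at hθ4
  have hθK := notMem_range_of_apply_ne hne
  obtain ⟨ι, hι⟩ := exists_algHom_of_root (K := K) (θ := θ) (a := i (j θ'))
    (Algebra.IsIntegral.isIntegral θ) (adjoin_eq_top_of_finrank_two h2 hθK) (by
      rw [minpoly_eq_of_finrank_two h2 hθK (quadratic_monic (-algebraMap k K t) (algebraMap k K n))
        (natDegree_quadratic_le_two _ _) (by
          simp only [map_add, map_mul, map_pow, Polynomial.aeval_X, Polynomial.aeval_C, map_neg,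
            ← IsScalarTower.algebraMap_apply, ht, hn]
          ring)]
      simp only [map_add, map_mul, map_pow, Polynomial.aeval_X, Polynomial.aeval_C, map_neg,
        ← IsScalarTower.algebraMap_apply]
      exact hθ4)
  obtain ⟨c, hc⟩ := IsAlgClosed.exists_pow_nat_eq
    (algebraMap k (AlgebraicClosure k) a + algebraMap k _ b * j θ') (n := 3) three_pos
  have hιk : ∀ d : k, ι (algebraMap k F d) = algebraMap k A d := fun d => by
    rw [IsScalarTower.algebraMap_apply k K F, AlgHom.commutes, ← IsScalarTower.algebraMap_apply]
  have hcu : i c ^ 3 = ι u := by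
    have hu1 : u = algebraMap k F a + algebraMap k F b * θ := by rw [ha]; ring
    rw [← map_pow, hc, hu1]
    simp only [map_add, map_mul, AlgHom.commutes, hιk, hι]
  have hc0 : c ≠ 0 := by
    rintro rfl
    rw [map_zero, zero_pow three_ne_zero] at hcu
    have : Nontrivial A := (Algebra.TensorProduct.includeLeft_injective (R := k) (S := k) (A := K)
      (B := AlgebraicClosure k) (FaithfulSMul.algebraMap_injective _ _)).nontrivial
    exact hu0 (ι.toRingHom.injective (hcu.symm.trans (map_zero ι).symm))
  exact ⟨ι, i c, i c⁻¹, by rw [← map_mul, mul_inv_cancel₀ hc0, map_one], hcu⟩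

end TwistConverse

/-! ### The function `σ(ϑ) / ϑ` -/

section ThetaQuotient

variable {k K F : Type*} [Field k] [Field K] [Field F] [Algebra k K] [Algebra k F] [Algebra K F]
  [IsScalarTower k K F] {σ : F ≃ₐ[K] F} {T : Finset (Place k K)} {𝔓 : Place k K → Place k F}
  {D : Divisor k F} {ϑ : F}

theorem IsDivisorOf.ord_conj_div (h2 : Module.finrank K F = 2) (hσ : σ ≠ 1)
    (hϑ : IsDivisorOf D ϑ) (h0 : ϑ ≠ 0) (𝔔 : Place k F) :
    𝔔.ord (σ ϑ / ϑ) = D (𝔔.conj σ) - D 𝔔 := by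
  rw [Place.ord_div _ (by simpa using h0) h0, ← Place.conj_ord h2 hσ, hϑ, hϑ]

theorem single_eq_zero_of_liesOver (h𝔓 : ∀ 𝔭 ∈ T, LiesOver (𝔓 𝔭) 𝔭 ∧ (𝔓 𝔭).conj σ ≠ 𝔓 𝔭)
    {𝔭 𝔮 : Place k K} (h𝔮 : 𝔮 ∈ T) (hne : 𝔭 ≠ 𝔮) {𝔔 : Place k F} (h𝔔 : LiesOver 𝔔 𝔭) :
    (Finsupp.single (𝔓 𝔮) 1 : Divisor k F) 𝔔 = 0 := by
  classical
  rw [Finsupp.single_apply, if_neg]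
  rintro rfl
  exact hne (h𝔔.place_eq (h𝔓 𝔮 h𝔮).1)

/-- The quotient `σ(ϑ) / ϑ` has norm one, and its divisor is given by `IsThetaDivisor.conj_sub`. -/
theorem IsThetaDivisor.isKummerGenerator (h2 : Module.finrank K F = 2) (hσ : σ ≠ 1)
    (h𝔓 : ∀ 𝔭 ∈ T, LiesOver (𝔓 𝔭) 𝔭 ∧ (𝔓 𝔭).conj σ ≠ 𝔓 𝔭) (hD : IsThetaDivisor T 𝔓 D)
    (hϑ : IsDivisorOf D ϑ) (h0 : ϑ ≠ 0) : IsKummerGenerator σ T 𝔓 (σ ϑ / ϑ) where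
  mul_conj := by
    have h0' : σ ϑ ≠ 0 := by simpa using h0
    rw [map_div₀, CubicFunctionField.conj_conj h2 hσ]
    field_simp
  ord_modEq 𝔔 := by
    rw [hϑ.ord_conj_div h2 hσ h0]
    rcases hD.conj_sub h2 hσ with ⟨-, h⟩ | ⟨-, 𝔭₁, h𝔭₁, h⟩ <;> rw [h, Int.ModEq]
    omega
  ord_eq_zero 𝔔 𝔭 h𝔔 h𝔭 := by
    rw [hϑ.ord_conj_div h2 hσ h0]
    have hs := signDivisor_apply_of_notMem h2 hσ h𝔓 h𝔭 h𝔔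
    rcases hD.conj_sub h2 hσ with ⟨-, h⟩ | ⟨-, 𝔭₁, h𝔭₁, h⟩
    · rw [h, hs]
    · have hne : 𝔭 ≠ 𝔭₁ := fun h => h𝔭 (h ▸ h𝔭₁)
      rw [h, hs, single_eq_zero_of_liesOver h𝔓 h𝔭₁ hne h𝔔,
        single_eq_zero_of_liesOver h𝔓 h𝔭₁ hne h𝔔.conj]
      rfl

theorem IsThetaDivisor.neg_one_le_ord (h2 : Module.finrank K F = 2) (hσ : σ ≠ 1)
    (h𝔓 : ∀ 𝔭 ∈ T, LiesOver (𝔓 𝔭) 𝔭 ∧ (𝔓 𝔭).conj σ ≠ 𝔓 𝔭) (hD : IsThetaDivisor T 𝔓 D)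
    (hϑ : IsDivisorOf D ϑ) (h0 : ϑ ≠ 0) {α : K}
    (hα : algebraMap K F α = σ ϑ / ϑ + (σ ϑ / ϑ)⁻¹) (hexc : ¬ IsExceptional F T)
    {𝔭 : Place k K} (h𝔭 : 𝔭 ∈ T) : -1 ≤ 𝔭.ord α := by
  rw [((hD.isKummerGenerator h2 hσ h𝔓 hϑ h0).ord_of_mem h2 hσ h𝔓 hα h𝔭).1,
    hϑ.ord_conj_div h2 hσ h0]
  rcases hD.conj_sub h2 hσ with ⟨-, h⟩ | ⟨h, -⟩
  · rw [h, (signDivisor_apply_of_mem h2 hσ h𝔓 h𝔭).1]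
    norm_num
  · exact absurd h hexc

/-- In the exceptional case, the order of `σ(ϑ) / ϑ` at `𝔓⁻` over the place `𝔭₁` that enters in `ϑ`
is `-1 + 3 = 2`. -/
theorem IsThetaDivisor.exists_ord_eq_neg_two (h2 : Module.finrank K F = 2) (hσ : σ ≠ 1)
    (h𝔓 : ∀ 𝔭 ∈ T, LiesOver (𝔓 𝔭) 𝔭 ∧ (𝔓 𝔭).conj σ ≠ 𝔓 𝔭) (hD : IsThetaDivisor T 𝔓 D)
    (hϑ : IsDivisorOf D ϑ) (h0 : ϑ ≠ 0) {α : K}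
    (hα : algebraMap K F α = σ ϑ / ϑ + (σ ϑ / ϑ)⁻¹) (hexc : IsExceptional F T) :
    ∃ 𝔭 ∈ T, 𝔭.ord α = -2 ∧ ∀ 𝔭' ∈ T, 𝔭' ≠ 𝔭 → -1 ≤ 𝔭'.ord α := by
  classical
  have hf := hD.isKummerGenerator h2 hσ h𝔓 hϑ h0
  rcases hD.conj_sub h2 hσ with ⟨h, -⟩ | ⟨-, 𝔭₁, h𝔭₁, h⟩
  · exact absurd hexc h
  refine ⟨𝔭₁, h𝔭₁, ?_, fun 𝔭 h𝔭 hne => ?_⟩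
  · rw [(hf.ord_of_mem h2 hσ h𝔓 hα h𝔭₁).1, hϑ.ord_conj_div h2 hσ h0, h,
      (signDivisor_apply_of_mem h2 hσ h𝔓 h𝔭₁).1, Finsupp.single_eq_same, Finsupp.single_apply,
      if_neg (h𝔓 𝔭₁ h𝔭₁).2.symm]
    norm_num
  · have h𝔔 := (h𝔓 𝔭 h𝔭).1
    rw [(hf.ord_of_mem h2 hσ h𝔓 hα h𝔭).1, hϑ.ord_conj_div h2 hσ h0, h,
      (signDivisor_apply_of_mem h2 hσ h𝔓 h𝔭).1, single_eq_zero_of_liesOver h𝔓 h𝔭₁ hne h𝔔,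
      single_eq_zero_of_liesOver h𝔓 h𝔭₁ hne h𝔔.conj]
    norm_num

open Polynomial in
/-- The conjugate of a root of `X² - a X - b`. -/
theorem notMem_range_and_conj_of_minpoly {r : F} {a b : K}
    (h2 : Module.finrank K F = 2) (hσ : σ ≠ 1)
    (hr : minpoly K r = X ^ 2 - C a * X - C b) :
    r ∉ Set.range (algebraMap K F) ∧ r ^ 2 = algebraMap K F a * r + algebraMap K F b ∧
      σ r = algebraMap K F a - r := by
  have hd : (minpoly K r).natDegree = 2 := by
    rw [hr]
    compute_degree!
  have hrK : r ∉ Set.range (algebraMap K F) := by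
    rintro ⟨c, rfl⟩
    rw [minpoly.eq_X_sub_C, natDegree_X_sub_C] at hd
    omega
  have h0 := minpoly.aeval K r
  rw [hr] at h0
  simp only [map_sub, map_mul, map_pow, aeval_X, aeval_C] at h0
  have h1 := congrArg σ h0
  simp only [map_sub, map_mul, map_pow, AlgEquiv.commutes, map_zero] at h1
  refine ⟨hrK, by linear_combination h0, ?_⟩
  have hne : σ r - r ≠ 0 := fun h => by
    obtain ⟨c, hc⟩ := exists_eq_algebraMap_of_fixed h2 hσ (sub_eq_zero.1 h)
    exact hrK ⟨c, hc⟩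
  refine mul_left_cancel₀ hne ?_
  linear_combination h1 - h0

/-- The sum `f + f⁻¹` is the quotient of `σ(ϑ)² + ϑ²` by the norm of `ϑ`. -/
theorem eq_div_of_theta {P Q a b α : K} {r : F} (hϑ : ϑ = algebraMap K F P + algebraMap K F Q * r)
    (h0 : ϑ ≠ 0) (hr : r ^ 2 = algebraMap K F a * r + algebraMap K F b)
    (hσr : σ r = algebraMap K F a - r) (hα : algebraMap K F α = σ ϑ / ϑ + (σ ϑ / ϑ)⁻¹) :
    α = (2 * (P ^ 2 + a * P * Q) + (a ^ 2 + 2 * b) * Q ^ 2) / (P ^ 2 + a * P * Q - b * Q ^ 2) := by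
  have h0' : σ ϑ ≠ 0 := by simpa using h0
  have hn : algebraMap K F (P ^ 2 + a * P * Q - b * Q ^ 2) = ϑ * σ ϑ := by
    simp only [hϑ, map_add, map_sub, map_mul, map_pow, AlgEquiv.commutes, hσr]
    linear_combination algebraMap K F Q ^ 2 * hr
  have hs : algebraMap K F (2 * (P ^ 2 + a * P * Q) + (a ^ 2 + 2 * b) * Q ^ 2)
      = σ ϑ ^ 2 + ϑ ^ 2 := by
    simp only [hϑ, map_add, map_mul, map_pow, AlgEquiv.commutes, hσr, map_ofNat]
    linear_combination -2 * algebraMap K F Q ^ 2 * hr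
  refine (algebraMap K F).injective ?_
  rw [map_div₀, hn, hs, hα]
  field_simp

end ThetaQuotient

/-! ### Classification of the cubic extensions -/

section Classification

theorem IsDefinedBy.of_algEquiv {K M M' : Type*} [Field K] [Field M] [Field M'] [Algebra K M]
    [Algebra K M'] {β : K} (h : IsDefinedBy M β) (e : M ≃ₐ[K] M') : IsDefinedBy M' β := by
  obtain ⟨y, hy, hroot⟩ := h.exists_root
  refine isDefinedBy_of_root (e.toLinearEquiv.finrank_eq.symm.trans h.finrank) (y := e y) ?_ ?_
  · rintro ⟨c, hc⟩
    exact hy ⟨c, e.injective (by rw [e.commutes, hc])⟩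
  · rw [← map_pow, hroot, map_add, map_mul, map_ofNat, e.commutes]

variable {k : Type u} {K : Type v} {F : Type w} [Field k] [Field K] [Field F]
  [Algebra k K] [Algebra k F] [Algebra K F] [IsScalarTower k K F] {σ : F ≃ₐ[K] F}
  {T : Finset (Place k K)} {𝔓 : Place k K → Place k F} {x : K} {f : F}

/-- Cubic extensions defined by `f` and `f'` are isomorphic if and only if `f` and `f'` agree up to
cubes of norm one. -/
theorem IsKummerGenerator.nonempty_algEquiv_iff (h3 : (3 : k) ≠ 0)
    (h2 : Module.finrank K F = 2) (hσ : σ ≠ 1) (hT : T.Nonempty)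
    (h𝔓 : ∀ 𝔭 ∈ T, LiesOver (𝔓 𝔭) 𝔭 ∧ (𝔓 𝔭).conj σ ≠ 𝔓 𝔭)
    (hf : IsKummerGenerator σ T 𝔓 f) {f' : F} (hf' : IsKummerGenerator σ T 𝔓 f') {β β' : K}
    (hβ : algebraMap K F β = f + f⁻¹) (hβ' : algebraMap K F β' = f' + f'⁻¹) {M M' : Type v}
    [Field M] [Algebra K M] [Field M'] [Algebra K M'] (hM : IsDefinedBy M β)
    (hM' : IsDefinedBy M' β') :
    Nonempty (M ≃ₐ[K] M') ↔ ∃ c, c * σ c = 1 ∧ f = c ^ 3 * f' := by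
  let _ : Algebra k M' := ((algebraMap K M').comp (algebraMap k K)).toAlgebra
  have _ : IsScalarTower k K M' := IsScalarTower.of_algebraMap_eq fun _ => rfl
  obtain ⟨N, _, _, _, _, _, _, _, _, _, _, hN, hMN, -, τ, hτ⟩ :=
    exists_compositum (k := k) h2 σ (M := M') hM'.finrank
  constructor
  · rintro ⟨e⟩
    exact exists_normOne_cube h3 h2 hσ h𝔓 hT hM'.finrank hN hMN hτ hf' hf hβ' hβ hM'
      (hM.of_algEquiv e)
  · rintro ⟨c, hc, h⟩
    exact hM.nonempty_algEquiv
      (isDefinedBy_of_mul_cube h3 h2 hσ h𝔓 hT hM'.finrank hN hMN hτ hf' hf hβ' hβ hM' hc h)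

/-- The extensions that correspond to the data are those defined by the multiples of `f` by
constants of norm one. -/
theorem IsKummerGenerator.corresponds_iff [PerfectField k] (h3 : (3 : k) ≠ 0)
    (h2 : Module.finrank K F = 2) (hσ : σ ≠ 1) (hT : T.Nonempty)
    (h𝔓 : ∀ 𝔭 ∈ T, LiesOver (𝔓 𝔭) 𝔭 ∧ (𝔓 𝔭).conj σ ≠ 𝔓 𝔭)
    (hx : Transcendental k x) (htop : IntermediateField.adjoin k {x} = ⊤)
    (hgenus : HasGenus (algebraicClosure k F) F 0)
    (hf : IsKummerGenerator σ T 𝔓 f) {M : Type v} [Field M] [Algebra k M] [Algebra K M]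
    [IsScalarTower k K M] :
    Corresponds σ T 𝔓 M ↔
      ∃ u ∈ normOne k σ, ∃ β : K, algebraMap K F β = u * f + (u * f)⁻¹ ∧ IsDefinedBy M β := by
  constructor
  · intro h
    have hM := h.cubic.degree
    obtain ⟨w, g, hg0, -, hwg, hg⟩ := h.signs
    obtain ⟨N, _, _, _, _, _, _, _, _, _, _, hN, hMN, ⟨φ, -⟩, τ, hτ⟩ :=
      exists_compositum (k := k) h2 σ (M := M) hM
    exact exists_normOne_isDefinedBy h3 h2 hσ h𝔓 hT hM hN hMN hτ hx htop hgenus hf hg0 hg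
      (w := φ w) (by rw [← map_pow, hwg, φ.commutes])
  · rintro ⟨u, hu, β, hβ, hM⟩
    exact (hf.mul_normOne hu).corresponds h3 h2 hσ hT h𝔓 hβ hM

/-- The cubic twists of the extension defined by `f` are those defined by the multiples of `f` by
constants of norm one. -/
theorem IsKummerGenerator.isTwist_iff [PerfectField k] (h3 : (3 : k) ≠ 0)
    (h2 : Module.finrank K F = 2) (hσ : σ ≠ 1) (hT : T.Nonempty)
    (h𝔓 : ∀ 𝔭 ∈ T, LiesOver (𝔓 𝔭) 𝔭 ∧ (𝔓 𝔭).conj σ ≠ 𝔓 𝔭)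
    (hx : Transcendental k x) (htop : IntermediateField.adjoin k {x} = ⊤)
    (hgenus : HasGenus (algebraicClosure k F) F 0)
    (hf : IsKummerGenerator σ T 𝔓 f) {α : K} (hα : algebraMap K F α = f + f⁻¹) {L M : Type v}
    [Field L] [Algebra k L] [Algebra K L] [IsScalarTower k K L]
    [Field M] [Algebra k M] [Algebra K M] [IsScalarTower k K M] (hL : IsDefinedBy L α) :
    IsCubicExtension k K M ∧ IsTwist k K L M ↔
      ∃ u ∈ normOne k σ, ∃ β : K, algebraMap K F β = u * f + (u * f)⁻¹ ∧ IsDefinedBy M β := by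
  constructor
  · rintro ⟨hM, ht⟩
    exact exists_normOne_of_isTwist h3 h2 hσ hT h𝔓 hx htop hgenus hf hα hL hM.degree ht
  · rintro ⟨u, hu, β, hβ, hM⟩
    exact ⟨((hf.mul_normOne hu).corresponds h3 h2 hσ hT h𝔓 hβ hM).cubic,
      isTwist_of_normOne h2 hσ hx htop hf.mul_conj hu hα hβ hL hM⟩

end Classification

end CubicFunctionField

theorem mainTheorem2 {k : Type u} {K : Type v} {K' : Type w}
    [Field k] [PerfectField k] [Field K] [Field K'] [Algebra k K] [Algebra k K'] [Algebra K K']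
    [IsScalarTower k K K']
    -- the characteristic is not three
    (h3 : (3 : k) ≠ 0)
    -- `K = k(x)`
    (hK : ∃ x : K, Transcendental k x ∧ IntermediateField.adjoin k {x} = ⊤)
    -- `K' = K(r)` is a separable quadratic extension of genus zero, `⟨σ⟩` its Galois group
    (hK' : Module.finrank K K' = 2)
    (hgenus : HasGenus (algebraicClosure k K') K' 0)
    (σ : K' ≃ₐ[K] K') (hσ : σ ≠ 1)
    (r : K') (a b : K)
    (hr : minpoly K r = Polynomial.X ^ 2 - Polynomial.C a * Polynomial.X - Polynomial.C b)
    -- `T`, and the choice of a decomposition `𝔭 = 𝔓⁻ + σ(𝔓⁻)`, `𝔓⁻ = 𝔓 𝔭`, for `𝔭 ∈ T`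
    (T : Finset (Place k K)) (hT : T.Nonempty)
    (𝔓 : Place k K → Place k K')
    (h𝔓 : ∀ 𝔭 ∈ T, LiesOver (𝔓 𝔭) 𝔭 ∧ (𝔓 𝔭).conj σ ≠ 𝔓 𝔭) :
    -- `ϑ` is found as a non-zero element of an explicit Riemann–Roch space, which is
    -- one-dimensional over the field of constants of `K'`
    (∃ D : Divisor k K', IsThetaDivisor T 𝔓 D) ∧
    ∀ D : Divisor k K', IsThetaDivisor T 𝔓 D →
      Module.finrank k (riemannRochSpace (-D)) = Module.finrank k (algebraicClosure k K') ∧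
      ∀ ϑ ∈ riemannRochSpace (-D), ϑ ≠ 0 →
        ∃ (P Q α : K) (f : K'),
          ϑ = algebraMap K K' P + algebraMap K K' Q * r ∧
          f = σ ϑ / ϑ ∧
          algebraMap K K' α = f + f⁻¹ ∧
          α = (2 * (P ^ 2 + a * P * Q) + (a ^ 2 + 2 * b) * Q ^ 2)
                / (P ^ 2 + a * P * Q - b * Q ^ 2) ∧
          -- `x³ - 3 x - α` defines an extension that corresponds to the data
          Irreducible (cubicPoly α) ∧
          (∀ (L : Type v) [Field L] [Algebra k L] [Algebra K L] [IsScalarTower k K L],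
            IsDefinedBy L α → Corresponds σ T 𝔓 L) ∧
          -- the poles of `α`
          (∀ 𝔭 : Place k K, 𝔭.ord α < 0 ↔ 𝔭 ∈ T) ∧
          (¬ IsExceptional K' T → ∀ 𝔭 ∈ T, -1 ≤ 𝔭.ord α) ∧
          (IsExceptional K' T →
            ∃ 𝔭 ∈ T, 𝔭.ord α = -2 ∧ ∀ 𝔭' ∈ T, 𝔭' ≠ 𝔭 → -1 ≤ 𝔭'.ord α) ∧
          -- replacing `f` by `u f` with `u ∈ N₁` gives a cubic extension
          (∀ u ∈ normOne k σ, ∃ β : K, algebraMap K K' β = u * f + (u * f)⁻¹ ∧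
            Irreducible (cubicPoly β)) ∧
          -- the extensions obtained in this way are the twists of `L`
          (∀ (L M : Type v) [Field L] [Algebra k L] [Algebra K L] [IsScalarTower k K L]
            [Field M] [Algebra k M] [Algebra K M] [IsScalarTower k K M],
            IsDefinedBy L α →
              (IsCubicExtension k K M ∧ IsTwist k K L M ↔
                ∃ u ∈ normOne k σ, ∃ β : K,
                  algebraMap K K' β = u * f + (u * f)⁻¹ ∧ IsDefinedBy M β)) ∧
          -- they are all the extensions that correspond to the data
          (∀ (M : Type v) [Field M] [Algebra k M] [Algebra K M] [IsScalarTower k K M],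
            Corresponds σ T 𝔓 M ↔
              ∃ u ∈ normOne k σ, ∃ β : K,
                algebraMap K K' β = u * f + (u * f)⁻¹ ∧ IsDefinedBy M β) ∧
          -- two of them are isomorphic if and only if `u` and `u'` agree in `N₁ / N₁³`
          (∀ (M M' : Type v) [Field M] [Algebra K M] [Field M'] [Algebra K M'] (u u' : K')
            (β β' : K), u ∈ normOne k σ → u' ∈ normOne k σ →
            algebraMap K K' β = u * f + (u * f)⁻¹ →
            algebraMap K K' β' = u' * f + (u' * f)⁻¹ →
            IsDefinedBy M β → IsDefinedBy M' β' →
              (Nonempty (M ≃ₐ[K] M') ↔ ∃ c ∈ normOne k σ, u = u' * c ^ 3)) := by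
  obtain ⟨x, hx, htop⟩ := hK
  refine ⟨exists_isThetaDivisor hK' hσ hx htop hgenus h𝔓, fun D hD =>
    ⟨finrank_riemannRochSpace_neg hK' hσ hx htop hgenus (hD.degree hK' hσ h𝔓), fun ϑ hmem h0 => ?_⟩⟩
  have hϑ := isDivisorOf_of_mem hK' hσ hx htop (hD.degree hK' hσ h𝔓) h0 hmem
  have hf := hD.isKummerGenerator hK' hσ h𝔓 hϑ h0
  obtain ⟨hrK, hr2, hσr⟩ := notMem_range_and_conj_of_minpoly hK' hσ hr
  obtain ⟨P, Q, hPQ⟩ := exists_add_mul_of_finrank_two hK' hrK ϑ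
  obtain ⟨α, hα⟩ := hf.exists_sum hK' hσ
  refine ⟨P, Q, α, σ ϑ / ϑ, hPQ, rfl, hα, eq_div_of_theta hPQ h0 hr2 hσr hα,
    hf.irreducible hK' hσ hT h𝔓 hα, fun L _ _ _ _ => hf.corresponds h3 hK' hσ hT h𝔓 hα,
    hf.ord_lt_zero_iff hK' hσ h𝔓 hα, fun hexc _ => hD.neg_one_le_ord hK' hσ h𝔓 hϑ h0 hα hexc,
    hD.exists_ord_eq_neg_two hK' hσ h𝔓 hϑ h0 hα, fun u hu => ?_,
    fun L M _ _ _ _ _ _ _ _ => hf.isTwist_iff h3 hK' hσ hT h𝔓 hx htop hgenus hα,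
    fun M _ _ _ _ => hf.corresponds_iff h3 hK' hσ hT h𝔓 hx htop hgenus,
    fun M M' _ _ _ _ u u' β β' hu hu' hβ hβ' hM hM' => ?_⟩
  · obtain ⟨β, hβ⟩ := (hf.mul_normOne hu).exists_sum hK' hσ
    exact ⟨β, hβ, (hf.mul_normOne hu).irreducible hK' hσ hT h𝔓 hβ⟩
  · rw [(hf.mul_normOne hu).nonempty_algEquiv_iff h3 hK' hσ hT h𝔓 (hf.mul_normOne hu') hβ hβ' hM hM']
    constructor
    · rintro ⟨c, hc, h⟩
      have huc : u = u' * c ^ 3 := mul_right_cancel₀ hf.ne_zero (by linear_combination h)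
      have hu0 : u' ≠ 0 := left_ne_zero_of_mul (hu'.2 ▸ one_ne_zero)
      refine ⟨c, ⟨mem_algebraicClosure_iff.2 (IsAlgebraic.of_pow three_pos ?_), hc⟩, huc⟩
      -- the cube of `c` is the constant `u / u'`
      rw [show c ^ 3 = u * u'⁻¹ by rw [huc]; field_simp]
      exact (mem_algebraicClosure_iff.1 hu.1).mul (mem_algebraicClosure_iff.1 hu'.1).inv
    · rintro ⟨c, hc, h⟩
      exact ⟨c, hc.2, by rw [h]; ring⟩
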